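/- Let $K$ be an algebraically closed field of characteristic $0$ and $\mathfrak g$ a finite-dimensional reductive Lie algebra over $K$ (for example the Lie algebra of a reductive algebraic group), with a nondegenerate invariant symmetric bilinear form $(\cdot,\cdot)$. Let $(e,h,f)$ be an $\mathfrak{sl}_2$-triple in $\mathfrak g$ (so $e\neq 0$ is nilpotent), $\mathfrak g(i)=\{x\in\mathfrak g: [h,x]=ix\}$, and $\chi=(e,\cdot)\in\mathfrak g^*$. Let $\theta\in\mathfrak g$ commute with $e,h,f$ and let $\operatorname{ad}\theta$ be diagonalizable on $\mathfrak g$ with integral eigenvalues (for example, $\theta$ is the differential of a one-parameter subgroup of a maximal torus of the centralizer of $(e,h,f)$ in the group). Let $l\subset\mathfrak g(-1)$ be an $\operatorname{ad}\theta$-stable subspace that is lagrangian for the form $\langle\chi,[\xi,\eta]\rangle$, put $\mathfrak m=l\oplus\bigoplus_{i\le -2}\mathfrak g(i)$ and $\mathfrak m_\chi=\{\xi-\langle\chi,\xi\rangle:\xi\in\mathfrak m\}$, and let $\mathcal W=(U(\mathfrak g)/U(\mathfrak g)\mathfrak m_\chi)^{\operatorname{ad}\mathfrak m}$ be the W-algebra,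 with the multiplication induced from $U(\mathfrak g)$. The image of $\theta$ in $U(\mathfrak g)/U(\mathfrak g)\mathfrak m_\chi$ lies in $\mathcal W$; for $\alpha\in\mathbb Z$ let $\mathcal W_\alpha=\{w\in\mathcal W:[\theta,w]=\alpha w\}$ and $\mathcal W_{>0}=\bigoplus_{\alpha>0}\mathcal W_\alpha$. Let $\mathfrak z_{\mathfrak g}(e)_{>0}$ be the sum of the eigenspaces of $\operatorname{ad}\theta$ on the centralizer $\mathfrak z_{\mathfrak g}(e)$ with positive eigenvalues. Let $(x_i)$ be a homogeneous basis of $\mathfrak z_{\mathfrak g}(e)_{>0}$, with $[\theta,x_i]=\alpha_ix_i$ and $[h,x_i]=n_ix_i$, and let $f_i\in\mathcal W$ be corresponding generators, that is, $f_i\in\mathcal W_{\alpha_i}$, $f_i$ has degree at most $n_i+2$ in the Kazhdan filtration (the one for which elements of $\mathfrak g(j)$ have degree $j+2$), and the symbol of $f_i$ in degree $n_i+2$, restricted to the Slodowy slice $S=\{(e+z,\cdot): z\in\mathfrak g,\ [f,z]=0\}\subset\mathfrak g^*$, is the restriction to $S$ of the linear function $x_i$ on $\mathfrak g^*$. Then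 for a finitely generated left $\mathcal W$-module $M$ the condition (*) for every $m\in M$ there is $\alpha\in\mathbb Z$ such that $\mathcal W_\beta m=0$ for all $\beta\ge\alpha$ is equivalent to either of the following two conditions: (*') every element of $\mathcal W_{>0}$ acts on $M$ by a locally nilpotent endomorphism; (*'') every $f_i$ acts on $M$ by a locally nilpotent endomorphism. -/

import Mathlib

noncomputable section

universe u v

/-- Standing data: a reductive Lie algebra `g` with a nondegenerate invariant symmetric form,
an `sl₂`-triple `(e, h, f)`, an integral semisimple element `θ` commuting with the triple
(the differential at `1` of a one-parameter subgroup of the centralizer of the triple), and a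
`θ`-stable lagrangian subspace `l` of `g(-1)`, the `(-1)`-eigenspace of `ad h`. -/
structure WDatum (K : Type u) (g : Type v) [Field K] [LieRing g] [LieAlgebra K g] where
  form : LinearMap.BilinForm K g
  form_symm : ∀ x y : g, form x y = form y x
  form_invariant : ∀ x y z : g, form ⁅x, y⁆ z = form x ⁅y, z⁆
  form_nondegenerate : form.Nondegenerate
  e : g
  h : g
  f : g
  sl2 : IsSl2Triple h e f
  θ : g
  lie_θ_e : ⁅θ, e⁆ = 0
  lie_θ_h : ⁅θ, h⁆ = 0
  lie_θ_f : ⁅θ, f⁆ = 0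
  θ_integral : (⨆ α : ℤ, Module.End.eigenspace (LieAlgebra.ad K g θ) (α : K)) = ⊤
  l : Submodule K g
  l_le : ∀ x ∈ l, ⁅h, x⁆ = -x
  l_lagrangian : ∀ x : g, ⁅h, x⁆ = -x → (x ∈ l ↔ ∀ y ∈ l, form e ⁅x, y⁆ = 0)
  l_stable : ∀ x ∈ l, ⁅θ, x⁆ ∈ l

namespace WDatum

variable {K : Type u} {g : Type v} [Field K] [LieRing g] [LieAlgebra K g] (D : WDatum K g)

/-- `χ = (e, ·)`. -/
def χ : Module.Dual K g := D.form D.e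

/-- `g(i)`, the eigenspace of `ad h` with eigenvalue `i`. -/
def gr (i : ℤ) : Submodule K g := Module.End.eigenspace (LieAlgebra.ad K g D.h) (i : K)

/-- The eigenspace of `ad θ` on `g` with eigenvalue `α`. -/
def θEigenspace (α : ℤ) : Submodule K g :=
  Module.End.eigenspace (LieAlgebra.ad K g D.θ) (α : K)

/-- `m = l ⊕ ⨁_{i ≤ -2} g(i)`. -/
def m : Submodule K g := D.l ⊔ ⨆ i : {i : ℤ // i ≤ -2}, D.gr i

/-- The canonical map of `g` to its universal enveloping algebra. -/
abbrev ιU (_D : WDatum K g) (x : g) : UniversalEnvelopingAlgebra K g :=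
  UniversalEnvelopingAlgebra.ι K x

/-- The left ideal `U m_χ` of the universal enveloping algebra, generated by the elements
`ξ - χ(ξ)`, `ξ ∈ m`. -/
def leftIdeal : Ideal (UniversalEnvelopingAlgebra K g) :=
  Ideal.span {u | ∃ ξ ∈ D.m, u = D.ιU ξ - algebraMap K _ (D.χ ξ)}

lemma mul_lie_mem {u v : UniversalEnvelopingAlgebra K g} (hu : u ∈ D.leftIdeal)
    (hv : ∀ ξ ∈ D.m, D.ιU ξ * v - v * D.ιU ξ ∈ D.leftIdeal) : u * v ∈ D.leftIdeal := by
  unfold leftIdeal Ideal.span at hu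
  induction hu using Submodule.span_induction with
  | mem x hx =>
    obtain ⟨ξ, hξ, rfl⟩ := hx
    have h1 : D.ιU ξ - algebraMap K _ (D.χ ξ) ∈ D.leftIdeal :=
      Ideal.subset_span ⟨ξ, hξ, rfl⟩
    have h2 := D.leftIdeal.add_mem (hv ξ hξ) (D.leftIdeal.mul_mem_left v h1)
    have h3 : (D.ιU ξ - algebraMap K _ (D.χ ξ)) * v
        = (D.ιU ξ * v - v * D.ιU ξ) + v * (D.ιU ξ - algebraMap K _ (D.χ ξ)) := by
      rw [sub_mul, mul_sub, Algebra.commutes (D.χ ξ) v]; abel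
    rw [h3]; exact h2
  | zero => rw [zero_mul]; exact D.leftIdeal.zero_mem
  | add x y _ _ hx hy => rw [add_mul]; exact D.leftIdeal.add_mem hx hy
  | smul a x _ hx => rw [smul_eq_mul, mul_assoc]; exact D.leftIdeal.mul_mem_left a hx

/-- The elements of `U` whose class in `U / U m_χ` is `ad m`-invariant; they form a subalgebra. -/
def invariants : Subalgebra K (UniversalEnvelopingAlgebra K g) where
  carrier := {u | ∀ ξ ∈ D.m, D.ιU ξ * u - u * D.ιU ξ ∈ D.leftIdeal}
  mul_mem' := by
    intro a b ha hb ξ hξ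
    have h : D.ιU ξ * (a * b) - a * b * D.ιU ξ
        = (D.ιU ξ * a - a * D.ιU ξ) * b + a * (D.ιU ξ * b - b * D.ιU ξ) := by
      noncomm_ring
    rw [h]
    exact D.leftIdeal.add_mem (D.mul_lie_mem (ha ξ hξ) hb)
      (D.leftIdeal.mul_mem_left a (hb ξ hξ))
  add_mem' := by
    intro a b ha hb ξ hξ
    have h : D.ιU ξ * (a + b) - (a + b) * D.ιU ξ
        = (D.ιU ξ * a - a * D.ιU ξ) + (D.ιU ξ * b - b * D.ιU ξ) := by
      noncomm_ring
    rw [h]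
    exact D.leftIdeal.add_mem (ha ξ hξ) (hb ξ hξ)
  algebraMap_mem' := by
    intro r ξ _
    rw [Algebra.commutes r (D.ιU ξ), sub_self]
    exact D.leftIdeal.zero_mem

/-- The elements of the subalgebra `invariants` with class zero in `U / U m_χ`. -/
def invariantsIdeal : Ideal D.invariants where
  carrier := {u | (u : UniversalEnvelopingAlgebra K g) ∈ D.leftIdeal}
  add_mem' := fun ha hb => D.leftIdeal.add_mem ha hb
  zero_mem' := D.leftIdeal.zero_mem
  smul_mem' := fun c _ hx => D.leftIdeal.mul_mem_left c hx

instance : D.invariantsIdeal.IsTwoSided where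
  mul_mem_of_left := fun b ha => D.mul_lie_mem ha b.2

/-- The W-algebra `(U / U m_χ)^{ad m}`, with the multiplication induced from `U`. -/
abbrev W : Type (max u v) := D.invariants ⧸ D.invariantsIdeal

/-- The class in the W-algebra of an element of `U` that is invariant modulo `U m_χ`. -/
def mkW (u : UniversalEnvelopingAlgebra K g) (hu : u ∈ D.invariants) : D.W :=
  Ideal.Quotient.mk D.invariantsIdeal ⟨u, hu⟩

lemma lie_θ_gr {i : ℤ} {x : g} (hx : x ∈ D.gr i) : ⁅D.θ, x⁆ ∈ D.gr i := by
  rw [gr, Module.End.mem_eigenspace_iff] at hx ⊢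
  simp only [LieAlgebra.ad_apply] at hx ⊢
  rw [leibniz_lie, hx, ← lie_skew D.h D.θ, D.lie_θ_h]
  simp

lemma lie_θ_m {x : g} (hx : x ∈ D.m) : ⁅D.θ, x⁆ ∈ D.m := by
  have h : D.m ≤ D.m.comap (LieAlgebra.ad K g D.θ) := by
    refine sup_le ?_ (iSup_le fun i => ?_)
    · intro y hy
      exact Submodule.mem_sup_left (D.l_stable y hy)
    · intro y hy
      exact Submodule.mem_sup_right
        (Submodule.mem_iSup_of_mem (p := fun i : {i : ℤ // i ≤ -2} => D.gr i) i (D.lie_θ_gr hy))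
  exact h hx

lemma θ_mem : D.ιU D.θ ∈ D.invariants := by
  intro ξ hξ
  have h1 : D.χ ⁅ξ, D.θ⁆ = 0 := by
    have h : D.χ ⁅D.θ, ξ⁆ = 0 := by
      rw [χ, ← D.form_invariant, ← lie_skew, D.lie_θ_e]; simp
    rw [← lie_skew, map_neg, h, neg_zero]
  have h2 : ⁅ξ, D.θ⁆ ∈ D.m := by
    rw [← lie_skew]; exact D.m.neg_mem (D.lie_θ_m hξ)
  have h3 : D.ιU ξ * D.ιU D.θ - D.ιU D.θ * D.ιU ξ
      = D.ιU ⁅ξ, D.θ⁆ - algebraMap K _ (D.χ ⁅ξ, D.θ⁆) := by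
    rw [h1, map_zero, sub_zero]
    let _ : LieRing (UniversalEnvelopingAlgebra K g) := LieRing.ofAssociativeRing
    exact (LieHom.map_lie (UniversalEnvelopingAlgebra.ι K) ξ D.θ).symm
  rw [h3]
  exact Ideal.subset_span ⟨_, h2, rfl⟩

/-- The image of `θ` in the W-algebra. -/
def θW : D.W := D.mkW (D.ιU D.θ) D.θ_mem

/-- `W_α`, the eigenspace of `ad θ` on the W-algebra with eigenvalue `α`. -/
def weightSpace (α : ℤ) : Submodule K D.W where
  carrier := {w | D.θW * w - w * D.θW = (α : K) • w}
  add_mem' := by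
    intro a b ha hb
    simp only [Set.mem_ofPred_eq] at ha hb ⊢
    rw [smul_add, ← ha, ← hb]; noncomm_ring
  zero_mem' := by simp
  smul_mem' := by
    intro c a ha
    simp only [Set.mem_ofPred_eq] at ha ⊢
    rw [mul_smul_comm, smul_mul_assoc, ← smul_sub, ha, smul_comm]

/-- `W_{>0} = ⨁_{α > 0} W_α`. -/
def posPart : Submodule K D.W := ⨆ α : {α : ℤ // 0 < α}, D.weightSpace α

/-- `z_g(e)_{>0}`, the sum of the eigenspaces of `ad θ` on the centralizer of `e` with positive
eigenvalues. -/
def centralizerPos : Submodule K g :=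
  ⨆ α : {α : ℤ // 0 < α}, LinearMap.ker (LieAlgebra.ad K g D.e) ⊓ D.θEigenspace α

/-- The part of degree `k` of the tensor algebra of `g` for the Kazhdan grading, in which
`g(i)` has degree `i + 2`. -/
def kazhdanTensor (k : ℤ) : Submodule K (TensorAlgebra K g) :=
  Submodule.span K {t | ∃ L : List (ℤ × g), (∀ p ∈ L, p.2 ∈ D.gr p.1) ∧
    (L.map fun p => p.1 + 2).sum = k ∧ t = (L.map fun p => TensorAlgebra.ι K p.2).prod}

/-- The Kazhdan filtration of the universal enveloping algebra: the span of the products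
`y₁ ⋯ y_r` with `y_j ∈ g(i_j)` and `∑ (i_j + 2) ≤ k`. -/
def kazhdan (k : ℤ) : Submodule K (UniversalEnvelopingAlgebra K g) :=
  (⨆ j : {j : ℤ // j ≤ k}, D.kazhdanTensor j).map
    (UniversalEnvelopingAlgebra.mkAlgHom K g).toLinearMap

/-- `w ∈ W` lies in degree `≤ k` of the Kazhdan filtration and its symbol in degree `k`, viewed as
a polynomial function on the Slodowy slice `S = {(e + z, ·) | z ∈ z_g(f)} ⊆ g^*`, is the
restriction to `S` of the linear function `x` on `g^*`. Here `w` is the class of `t + v` with `t`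
homogeneous of degree `k` and `v` of degree `≤ k - 1`, and `TensorAlgebra.lift K s t` is the value
at `s ∈ g^*` of the image of `t` in `S(g) = K[g^*]`. -/
def HasSliceSymbol (k : ℤ) (w : D.W) (x : g) : Prop :=
  ∃ t ∈ D.kazhdanTensor k, ∃ v ∈ D.kazhdan (k - 1),
    ∃ hu : UniversalEnvelopingAlgebra.mkAlgHom K g t + v ∈ D.invariants,
      w = D.mkW (UniversalEnvelopingAlgebra.mkAlgHom K g t + v) hu ∧
      ∀ z : g, ⁅D.f, z⁆ = 0 →
        TensorAlgebra.lift K (D.form (D.e + z)) t = D.form (D.e + z) x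

/-- `w` is a system of elements of `W_{>0}` corresponding to a homogeneous basis of `z_g(e)_{>0}`:
for some basis `x i` of `z_g(e)_{>0}` with `[θ, x i] = a i • x i` and `[h, x i] = n i • x i`, the
element `w i` has weight `a i`, and its symbol, of Kazhdan degree `n i + 2`, is the linear function
`x i` on the Slodowy slice. -/
def IsGeneratorSystem {ι : Type*} (w : ι → D.W) : Prop :=
  ∃ (x : Module.Basis ι K D.centralizerPos) (a n : ι → ℤ), ∀ i,
    (x i : g) ∈ D.θEigenspace (a i) ∧ (x i : g) ∈ D.gr (n i) ∧
    w i ∈ D.weightSpace (a i) ∧ D.HasSliceSymbol (n i + 2) (w i) (x i)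

/-- Every vector is killed by `W_β` for all sufficiently large `β`. -/
def KilledByLargeWeights (M : Type*) [AddCommGroup M] [Module D.W M] : Prop :=
  ∀ m : M, ∃ α : ℤ, ∀ β ≥ α, ∀ w ∈ D.weightSpace β, w • m = 0

/-- `w` acts on `M` by a locally nilpotent endomorphism. -/
def ActsLocallyNilpotently (w : D.W) (M : Type*) [AddCommGroup M] [Module D.W M] : Prop :=
  ∀ m : M, ∃ N : ℕ, w ^ N • m = 0

end WDatum

end

/-! Weights settle one direction: the N-th power of an element of W_{>0} has only weights at least
N, so under (*) it kills a given vector once N is large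
(`KilledByLargeWeights.actsLocallyNilpotently`). Each f_i lies in W_{>0}, so it remains to deduce
(*) from (*'').

That deduction rests on a PBW-type statement, `weightSpace_le_monomialSpan`: W_β is spanned by
ordered products w₀ ∏ f_l^{b_l} of total weight β, with w₀ of weight at most 0. For large β some
exponent b_l must be large, and `exists_list_prod_pow_smul_eq_zero` shows that ∏ f_l^{b_l} then
kills the given vector.

The spanning is proved by induction on the Kazhdan degree from two halves of gr W = K[S]: every
homogeneous function on the slice is the symbol of some element of W (`exists_hasSymbol`), and an
element whose symbol vanishes on S has smaller degree (`HasSymbol.mem_fil_of_zero`). On S, a vector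
of g of positive θ-weight restricts to the same function as its projection to z_g(e)_{>0}, a
combination of the x_l; hence functions of weight at most 0 times monomials in the x_l span K[S].

For gr W = K[S], put Q = U/U m_χ. A homogeneous basis ξ_k of m acts on gr Q by operators X_k. The
nondegenerate pairing χ([·,·]) yields y_k with χ([ξ_j, y_k]) = δ_jk (`exists_dual_family`); let Y_k
be multiplication by y_k. Then X_k Y_k - Y_k X_k = 1, the family is triangular when ordered by ad
h-degree (`Frame.triangular`), and X_k is locally nilpotent because the filtration of Q vanishes in
negative degrees (`fil_eq_bot`). Such a family splits gr Q into the common kernel of the X_k and the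
sum of the images of the Y_k. The common kernel consists of symbols of invariants
(`exists_lift_of_triangular`), and modulo the images a tensor acts through its restriction to S
(`Frame.τ_sub_sliceHom_mem`). The PBW theorem for U(g) is not needed. -/

/-! ### Finite-dimensional sl₂-modules: diagonalizability and integrality of h. -/

namespace IsSl2Triple

open LieModule Module

variable {K L V : Type*} [Field K] [LieRing L] [LieAlgebra K L]
  [AddCommGroup V] [Module K V] [LieRingModule L V] [LieModule K L V]
  {h e f : L}

lemma eigenspace_lie_e (t : IsSl2Triple h e f) {v : V} {i : ℤ} (hv : ⁅h, v⁆ = (i : K) • v) :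
    ⁅h, ⁅e, v⁆⁆ = ((i + 2 : ℤ) : K) • ⁅e, v⁆ := by
  rw [leibniz_lie h, t.lie_h_e_smul K, hv, lie_smul, smul_lie]
  push_cast; module

lemma eigenspace_lie_f (t : IsSl2Triple h e f) {v : V} {i : ℤ} (hv : ⁅h, v⁆ = (i : K) • v) :
    ⁅h, ⁅f, v⁆⁆ = ((i - 2 : ℤ) : K) • ⁅f, v⁆ := by
  rw [leibniz_lie h, t.lie_lie_smul_f K, hv, lie_smul, neg_lie, smul_lie]
  push_cast; module

lemma lie_f_pow_succ_toEnd_e (t : IsSl2Triple h e f) {v : V} {μ : K} (hv : ⁅h, v⁆ = μ • v)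
    (hef : ⁅e, ⁅f, v⁆⁆ = 0) (n : ℕ) :
    ⁅f, ((toEnd K L V e) ^ (n + 1)) v⁆ = (-((n + 1) * (μ + n))) • ((toEnd K L V e) ^ n) v := by
  have key : ∀ w : V, ⁅f, ⁅e, w⁆⁆ = ⁅e, ⁅f, w⁆⁆ - ⁅h, w⁆ := by
    intro w; rw [leibniz_lie e, t.lie_e_f]; abel
  induction n with
  | zero => simp [key, hef, hv]
  | succ n ih =>
    rw [pow_succ', Module.End.mul_apply, toEnd_apply_apply, key, ih, lie_smul,
      t.lie_h_pow_toEnd_e hv, pow_succ' _ n, Module.End.mul_apply, toEnd_apply_apply, ← sub_smul]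
    congr 1
    push_cast; ring

variable [CharZero K] [FiniteDimensional K V]

/-- The vectors e^n v have pairwise distinct h-eigenvalues, so finite dimension forces one of them
to vanish; the last nonzero one is primitive. -/
lemma exists_primitive (t : IsSl2Triple h e f) {v : V} {μ : K} (hv : ⁅h, v⁆ = μ • v)
    (hv0 : v ≠ 0) :
    ∃ n : ℕ, HasPrimitiveVectorWith t (((toEnd K L V e) ^ n) v) (μ + 2 * n) := by
  have : ∃ n : ℕ, ((toEnd K L V e) ^ n) v = 0 := by
    by_contra! hne
    have hinf : (Set.range fun n : ℕ => μ + 2 * (n : K)).Infinite := by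
      rw [Set.infinite_range_iff (fun n m => by simp)]; infer_instance
    refine hinf ((toEnd K L V h).finite_hasEigenvalue.subset ?_)
    rintro _ ⟨n, rfl⟩
    exact Module.End.hasEigenvalue_of_hasEigenvector
      ⟨Module.End.mem_eigenspace_iff.2 (t.lie_h_pow_toEnd_e hv n), hne n⟩
  obtain ⟨n, hn₁, hn₂⟩ := Nat.exists_not_and_succ_of_not_zero_of_exists hv0 this
  refine ⟨n, hn₁, t.lie_h_pow_toEnd_e hv n, ?_⟩
  rwa [pow_succ', Module.End.mul_apply, toEnd_apply_apply] at hn₂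

lemma exists_int_eq (t : IsSl2Triple h e f) {v : V} {μ : K} (hv : ⁅h, v⁆ = μ • v)
    (hv0 : v ≠ 0) : ∃ n : ℤ, μ = n := by
  obtain ⟨n, hn⟩ := t.exists_primitive hv hv0
  obtain ⟨k, hk⟩ := hn.exists_nat
  exact ⟨k - 2 * n, by push_cast; rw [← hk]; ring⟩

/-- If e^n v is the last nonzero power, then 0 = f e^{n+1} v = -(n+1)(μ+n) e^n v, which determines
μ. -/
lemma exists_nat_of_lie_e_lie_f (t : IsSl2Triple h e f) {v : V} {μ : K} (hv : ⁅h, v⁆ = μ • v)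
    (hv0 : v ≠ 0) (hef : ⁅e, ⁅f, v⁆⁆ = 0) : ∃ n : ℕ, μ = -n := by
  obtain ⟨n, hn⟩ := t.exists_primitive hv hv0
  have h1 := t.lie_f_pow_succ_toEnd_e hv hef n
  rw [pow_succ', Module.End.mul_apply, toEnd_apply_apply, hn.lie_e, lie_zero, eq_comm,
    smul_eq_zero_iff_left hn.ne_zero, neg_eq_zero, mul_eq_zero] at h1
  exact ⟨n, eq_neg_of_add_eq_zero_left (h1.resolve_left (Nat.cast_add_one_ne_zero n))⟩

lemma exists_nat_of_lie_f_lie_e (t : IsSl2Triple h e f) {v : V} {μ : K} (hv : ⁅h, v⁆ = μ • v)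
    (hv0 : v ≠ 0) (hfe : ⁅f, ⁅e, v⁆⁆ = 0) : ∃ n : ℕ, μ = n := by
  obtain ⟨n, hn⟩ := t.symm.exists_nat_of_lie_e_lie_f (μ := -μ) (by simp [hv]) hv0 hfe
  exact ⟨n, neg_injective hn⟩

/-- No Jordan block of h can sit on a vector killed by e. Otherwise u = (h - μ)v is primitive of
some weight n, and e f^{n+1} v = (n+1) f^n u is nonzero. So f^{n+1} v is a nonzero eigenvector of
weight -n-2 killed by fe, while `exists_nat_of_lie_f_lie_e` makes such a weight nonnegative. -/
lemma lie_h_eq_of_lie_e_eq_zero (t : IsSl2Triple h e f) {v : V} {μ : K} (he : ⁅e, v⁆ = 0)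
    (hv : ⁅h, ⁅h, v⁆ - μ • v⁆ = μ • (⁅h, v⁆ - μ • v)) : ⁅h, v⁆ = μ • v := by
  by_contra hne
  set u := ⁅h, v⁆ - μ • v with hu
  have hu0 : u ≠ 0 := sub_ne_zero.2 hne
  have heu : ⁅e, u⁆ = 0 := by
    rw [hu, lie_sub, lie_smul, he, leibniz_lie e, he, ← lie_skew, t.lie_h_e_smul K, neg_lie,
      smul_lie, he]; simp
  have P : HasPrimitiveVectorWith t u μ := ⟨hu0, hv, heu⟩
  obtain ⟨n, hn⟩ := P.exists_nat
  have hh : ∀ k : ℕ, ⁅h, ((toEnd K L V f) ^ k) v⁆ =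
      (μ - 2 * k) • ((toEnd K L V f) ^ k) v + ((toEnd K L V f) ^ k) u := by
    intro k
    induction k with
    | zero => simp [hu]
    | succ k ih =>
      rw [pow_succ', Module.End.mul_apply, Module.End.mul_apply, toEnd_apply_apply,
        toEnd_apply_apply, leibniz_lie h, t.lie_lie_smul_f K, ih, lie_add, lie_smul, neg_lie,
        smul_lie]
      push_cast; module
  have hE : ∀ k : ℕ, ⁅e, ((toEnd K L V f) ^ (k + 1)) v⁆ =
      ((k + 1 : K) * (μ - k)) • ((toEnd K L V f) ^ k) v
        + (k + 1 : K) • ((toEnd K L V f) ^ k) u := by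
    intro k
    induction k with
    | zero => simp [leibniz_lie e, t.lie_e_f, he, hu]
    | succ k ih =>
      rw [pow_succ', Module.End.mul_apply, toEnd_apply_apply, leibniz_lie e, t.lie_e_f, ih, hh,
        lie_add, lie_smul, lie_smul, pow_succ' _ k, Module.End.mul_apply, Module.End.mul_apply,
        toEnd_apply_apply, toEnd_apply_apply]
      push_cast; module
  have hfn : ∀ k ≤ n, ((toEnd K L V f) ^ k) u ≠ 0 := fun k hk =>
    P.pow_toEnd_f_ne_zero_of_eq_nat hn hk
  have hfn1 : ((toEnd K L V f) ^ (n + 1)) u = 0 := P.pow_toEnd_f_eq_zero_of_eq_nat hn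
  have hEn := hE n
  rw [hn, sub_self, mul_zero, zero_smul, zero_add] at hEn
  have hx0 : ((toEnd K L V f) ^ (n + 1)) v ≠ 0 := by
    intro h0
    rw [h0, lie_zero, eq_comm, smul_eq_zero_iff_left (hfn n le_rfl)] at hEn
    exact Nat.cast_add_one_ne_zero n hEn
  obtain ⟨k, hk⟩ := t.exists_nat_of_lie_f_lie_e (v := ((toEnd K L V f) ^ (n + 1)) v)
    (μ := μ - 2 * ((n + 1 : ℕ) : K)) (by rw [hh, hfn1, add_zero]) hx0 (by
      rw [hEn, lie_smul, P.lie_f_pow_toEnd_f, hfn1, smul_zero])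
  rw [hn] at hk
  have : ((n : ℤ) - 2 * (n + 1) : ℤ) = k := by exact_mod_cast hk
  omega

/-- On a weight space of positive weight ef is injective by `exists_nat_of_lie_e_lie_f`, hence
surjective by finite dimension. -/
lemma exists_lie_e_lie_f (t : IsSl2Triple h e f) {v : V} {i : ℤ} (hi : 0 < i)
    (hv : ⁅h, v⁆ = (i : K) • v) : ∃ w : V, ⁅h, w⁆ = (i : K) • w ∧ ⁅e, ⁅f, w⁆⁆ = v := by
  let G := (toEnd K L V h).eigenspace (i : K)
  have hmem : ∀ w, w ∈ G ↔ ⁅h, w⁆ = (i : K) • w := fun w => Module.End.mem_eigenspace_iff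
  let A : V →ₗ[K] V := toEnd K L V e ∘ₗ toEnd K L V f
  have hA : ∀ w ∈ G, A w ∈ G := by
    intro w hw
    rw [hmem] at hw ⊢
    have h1 := t.eigenspace_lie_e (t.eigenspace_lie_f hw)
    rwa [sub_add_cancel] at h1
  have hinj : Function.Injective (A.restrict hA) := by
    rw [injective_iff_map_eq_zero]
    rintro ⟨w, hw⟩ h0
    by_contra hne
    have hw0 : w ≠ 0 := fun h => hne (by simp [h])
    obtain ⟨n, hn⟩ := t.exists_nat_of_lie_e_lie_f ((hmem w).1 hw) hw0
      (by simpa [A] using congrArg Subtype.val h0)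
    have : i = -n := by exact_mod_cast hn
    omega
  obtain ⟨⟨w, hw⟩, hw'⟩ := LinearMap.injective_iff_surjective.1 hinj ⟨v, (hmem v).2 hv⟩
  exact ⟨w, (hmem w).1 hw, by simpa [A] using congrArg Subtype.val hw'⟩

/-- Downward induction on n, starting above all natural eigenvalues. By induction ev is a true
eigenvector of weight n+2 > 0, so ev = efw with w of the same weight; v - fw is then killed by e and
has the same defect u, and `lie_h_eq_of_lie_e_eq_zero` applies. -/
lemma lie_h_eq_of_nat (t : IsSl2Triple h e f) {v : V} (n : ℕ)
    (hv : ⁅h, ⁅h, v⁆ - (n : K) • v⁆ = (n : K) • (⁅h, v⁆ - (n : K) • v)) :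
    ⁅h, v⁆ = (n : K) • v := by
  obtain ⟨N, hN⟩ : ∃ N : ℕ, ∀ n ≥ N, ∀ v : V, ⁅h, v⁆ = (n : K) • v → v = 0 := by
    have hfin : {n : ℕ | (toEnd K L V h).HasEigenvalue (n : K)}.Finite :=
      (toEnd K L V h).finite_hasEigenvalue.preimage Nat.cast_injective.injOn
    obtain ⟨N, hN⟩ := hfin.bddAbove
    refine ⟨N + 1, fun n hn v hv => ?_⟩
    by_contra hv0
    have := hN (Module.End.hasEigenvalue_of_hasEigenvector
      (f := toEnd K L V h) ⟨Module.End.mem_eigenspace_iff.2 hv, hv0⟩)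
    omega
  induction hj : N - n using Nat.strong_induction_on generalizing n v with
  | _ j ih =>
  by_cases hn : N ≤ n
  · exact sub_eq_zero.1 (hN n hn _ hv)
  set u := ⁅h, v⁆ - (n : K) • v with hu
  have h1 : ⁅h, ⁅e, v⁆⁆ - ((n + 2 : ℕ) : K) • ⁅e, v⁆ = ⁅e, u⁆ := by
    rw [leibniz_lie h, t.lie_h_e_smul K, hu, lie_sub, lie_smul, smul_lie]
    push_cast; module
  have h2 : ⁅h, ⁅e, v⁆⁆ = ((n + 2 : ℕ) : K) • ⁅e, v⁆ := by
    refine ih (N - (n + 2)) (by omega) (n + 2) ?_ rfl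
    rw [h1]
    have := t.eigenspace_lie_e (K := K) (v := u) (i := n) (by exact_mod_cast hv)
    exact_mod_cast this
  obtain ⟨w, hw, hw'⟩ := t.exists_lie_e_lie_f (K := K) (v := ⁅e, v⁆) (i := (n + 2 : ℕ)) (by positivity)
    (by exact_mod_cast h2)
  have hfw := t.eigenspace_lie_f (K := K) hw
  have hfw' : ⁅h, ⁅f, w⁆⁆ = (n : K) • ⁅f, w⁆ := by
    rw [hfw]; congr 1; push_cast; ring
  have h3 : ⁅h, v - ⁅f, w⁆⁆ - (n : K) • (v - ⁅f, w⁆) = u := by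
    rw [lie_sub, hfw', hu]; module
  have h4 := t.lie_h_eq_of_lie_e_eq_zero (v := v - ⁅f, w⁆) (μ := (n : K))
    (by rw [lie_sub, hw', sub_self]) (by rw [h3]; exact hv)
  exact sub_eq_zero.1 (h3.symm.trans (sub_eq_zero.2 h4))

lemma lie_h_eq_of_lie_h_sub (t : IsSl2Triple h e f) {v : V} {μ : K}
    (hv : ⁅h, ⁅h, v⁆ - μ • v⁆ = μ • (⁅h, v⁆ - μ • v)) : ⁅h, v⁆ = μ • v := by
  by_contra hne
  obtain ⟨n, rfl⟩ := t.exists_int_eq hv (sub_ne_zero.2 hne)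
  refine hne ?_
  obtain ⟨k, rfl | rfl⟩ := n.eq_nat_or_neg
  · have := t.lie_h_eq_of_nat (K := K) (v := v) k (by exact_mod_cast hv)
    exact_mod_cast this
  -- Negative eigenvalues of h are positive ones for the opposite triple.
  · have := t.symm.lie_h_eq_of_nat (v := v) k (by
      have h1 : ⁅-h, v⁆ - (k : K) • v = -(⁅h, v⁆ - ((-(k : ℤ) : ℤ) : K) • v) := by
        rw [neg_lie]; push_cast; module
      rw [h1, neg_lie, lie_neg, hv]; push_cast; module)
    rw [neg_lie, neg_eq_iff_eq_neg] at this
    rw [this]; push_cast; module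

/-- Excluding Jordan blocks of size two excludes all nontrivial blocks, so generalized eigenvectors
are eigenvectors. Complete reducibility is not used. -/
theorem iSup_eigenspace_eq_top [IsAlgClosed K] (t : IsSl2Triple h e f) :
    ⨆ i : ℤ, (toEnd K L V h).eigenspace (i : K) = ⊤ := by
  rw [eq_top_iff, ← Module.End.iSup_maxGenEigenspace_eq_top (toEnd K L V h)]
  refine iSup_le fun μ v hv => ?_
  have h1 : ⁅h, v⁆ = μ • v := by
    obtain ⟨n, hn⟩ := Module.End.mem_maxGenEigenspace _ _ _ |>.1 hv
    set A := toEnd K L V h - μ • (1 : Module.End K V) with hA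
    have key : ∀ n (v : V), (A ^ (n + 1)) v = 0 → A v = 0 := by
      intro n
      induction n with
      | zero => intro v hv; simpa using hv
      | succ n ih =>
        intro v hv
        rw [pow_succ, Module.End.mul_apply] at hv
        have := ih _ hv
        simp only [hA, LinearMap.sub_apply, LinearMap.smul_apply, Module.End.one_apply,
          toEnd_apply_apply] at this ⊢
        exact sub_eq_zero.2 (t.lie_h_eq_of_lie_h_sub (sub_eq_zero.1 this))
    have := key n v (by rw [pow_succ', Module.End.mul_apply, hn, map_zero])
    simp only [hA, LinearMap.sub_apply, LinearMap.smul_apply, Module.End.one_apply,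
      toEnd_apply_apply] at this
    exact sub_eq_zero.1 this
  by_cases hv0 : v = 0
  · rw [hv0]; exact Submodule.zero_mem _
  obtain ⟨n, rfl⟩ := t.exists_int_eq h1 hv0
  exact Submodule.mem_iSup_of_mem n (Module.End.mem_eigenspace_iff.2 h1)

end IsSl2Triple


/-! ### Graded subspaces and homogeneous components. -/

lemma Submodule.le_iSup_inf_eigenspace_intCast {K V : Type*} [Field K] [AddCommGroup V]
    [Module K V] [FiniteDimensional K V] {A : Module.End K V}
    (hA : ⨆ i : ℤ, A.eigenspace (i : K) = ⊤) {p : Submodule K V} (hp : ∀ x ∈ p, A x ∈ p) :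
    p ≤ ⨆ i : ℤ, p ⊓ A.eigenspace (i : K) := by
  have htop : ⨆ μ : K, A.genEigenspace μ 1 = ⊤ :=
    top_le_iff.1 (hA ▸ iSup_le fun i => le_iSup (fun μ : K => A.genEigenspace μ 1) (i : K))
  conv_lhs => rw [Submodule.eq_iSup_inf_genEigenspace 1 hp htop]
  refine iSup_le fun μ => ?_
  by_cases hμ : ∃ i : ℤ, μ = i
  · obtain ⟨i, rfl⟩ := hμ
    exact le_iSup (fun i : ℤ => p ⊓ A.eigenspace (i : K)) i
  -- A non-integral eigenvalue would have an eigenspace independent of the integral ones, which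
  -- already span.
  · have hd := A.eigenspaces_iSupIndep μ
    have h1 : (⊤ : Submodule K V) ≤ ⨆ (ν : K) (_ : ν ≠ μ), A.eigenspace ν := by
      rw [← hA]
      exact iSup_le fun i => le_iSup₂_of_le (i : K) (fun h => hμ ⟨i, h.symm⟩) le_rfl
    have h2 : A.genEigenspace μ 1 = ⊥ := by
      rw [eq_bot_iff]
      exact hd le_rfl (le_top.trans h1)
    rw [h2, inf_bot_eq]; exact bot_le

/-- A linear map homogeneous of degree `c` for gradings `p`, `q`: homogeneous elements of the range
come from homogeneous elements. -/
lemma Submodule.exists_mem_of_map_mem {K V V' ι : Type*} [Field K] [AddCommGroup V] [Module K V]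
    [AddCommGroup V'] [Module K V'] {p : ι → Submodule K V} {q : ι → Submodule K V'}
    (hq : iSupIndep q) (A : V →ₗ[K] V') (hA : ∀ i, ∀ x ∈ p i, A x ∈ q i)
    {i : ι} {v : V} (hv : v ∈ ⨆ i, p i) (hAv : A v ∈ q i) : ∃ w ∈ p i, A w = A v := by
  classical
  obtain ⟨c, hc, rfl⟩ := (Submodule.mem_iSup_iff_exists_finsupp p v).1 hv
  refine ⟨c i, hc i, ?_⟩
  have h1 : A (c.sum fun _ x => x) - A (c i) ∈ ⨆ (j) (_ : j ≠ i), q j := by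
    rw [Finsupp.sum, ← map_sub]
    by_cases hi : i ∈ c.support
    · rw [← Finset.add_sum_erase _ _ hi, add_sub_cancel_left, map_sum]
      exact Submodule.sum_mem _ fun j hj => Submodule.mem_iSup_of_mem j
        (Submodule.mem_iSup_of_mem (Finset.ne_of_mem_erase hj) (hA j _ (hc j)))
    · rw [Finsupp.notMem_support_iff.1 hi, sub_zero, map_sum]
      refine Submodule.sum_mem _ fun j hj => Submodule.mem_iSup_of_mem j
        (Submodule.mem_iSup_of_mem ?_ (hA j _ (hc j)))
      rintro rfl; exact hi hj
  have h2 := (Submodule.disjoint_def.1 (hq i)) _ (sub_mem hAv (hA i _ (hc i))) h1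
  exact (sub_eq_zero.1 h2).symm

/-! ### The bigrading of g by ad h and ad θ, the subspace m, and its dual family. -/

namespace WDatum

open Module LieAlgebra

variable {K : Type*} {g : Type*} [Field K] [LieRing g] [LieAlgebra K g] (D : WDatum K g)

/-- The joint eigenspaces of `ad h` and `ad θ`. -/
def bigr (s : ℤ × ℤ) : Submodule K g := D.gr s.1 ⊓ D.θEigenspace s.2

variable {D}

lemma mem_gr {i : ℤ} {x : g} : x ∈ D.gr i ↔ ⁅D.h, x⁆ = (i : K) • x :=
  Module.End.mem_eigenspace_iff

lemma mem_θEigenspace {i : ℤ} {x : g} : x ∈ D.θEigenspace i ↔ ⁅D.θ, x⁆ = (i : K) • x :=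
  Module.End.mem_eigenspace_iff

lemma lie_mem_gr {i j : ℤ} {x y : g} (hx : x ∈ D.gr i) (hy : y ∈ D.gr j) :
    ⁅x, y⁆ ∈ D.gr (i + j) := by
  rw [mem_gr] at *
  rw [leibniz_lie, hx, hy, smul_lie, lie_smul, ← add_smul]; push_cast; rfl

lemma lie_mem_θEigenspace {i j : ℤ} {x y : g} (hx : x ∈ D.θEigenspace i)
    (hy : y ∈ D.θEigenspace j) : ⁅x, y⁆ ∈ D.θEigenspace (i + j) := by
  rw [mem_θEigenspace] at *
  rw [leibniz_lie, hx, hy, smul_lie, lie_smul, ← add_smul]; push_cast; rfl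

lemma lie_mem_bigr {s t : ℤ × ℤ} {x y : g} (hx : x ∈ D.bigr s) (hy : y ∈ D.bigr t) :
    ⁅x, y⁆ ∈ D.bigr (s + t) :=
  ⟨lie_mem_gr hx.1 hy.1, lie_mem_θEigenspace hx.2 hy.2⟩

lemma e_mem_bigr : D.e ∈ D.bigr (2, 0) :=
  ⟨mem_gr.2 (by simpa using D.sl2.lie_h_e_smul K), mem_θEigenspace.2 (by simp [D.lie_θ_e])⟩

lemma f_mem_bigr : D.f ∈ D.bigr (-2, 0) :=
  ⟨mem_gr.2 (by simpa using D.sl2.lie_lie_smul_f K), mem_θEigenspace.2 (by simp [D.lie_θ_f])⟩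

lemma form_lie_left (a x y : g) : D.form ⁅a, x⁆ y = -D.form x ⁅a, y⁆ := by
  rw [← lie_skew, map_neg, LinearMap.neg_apply, D.form_invariant]

variable (D) in
/-- The subspaces stable under `ad h` and `ad θ`. -/
def Stable (p : Submodule K g) : Prop := ∀ x ∈ p, ⁅D.h, x⁆ ∈ p ∧ ⁅D.θ, x⁆ ∈ p

lemma Stable.inf {p q : Submodule K g} (hp : D.Stable p) (hq : D.Stable q) : D.Stable (p ⊓ q) :=
  fun x hx => ⟨⟨(hp x hx.1).1, (hq x hx.2).1⟩, ⟨(hp x hx.1).2, (hq x hx.2).2⟩⟩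

lemma stable_m : D.Stable D.m := by
  refine fun x hx => ⟨?_, D.lie_θ_m hx⟩
  have h : D.m ≤ D.m.comap (LieAlgebra.ad K g D.h) := by
    refine sup_le ?_ (iSup_le fun i => ?_)
    · intro y hy
      rw [Submodule.mem_comap, ad_apply, D.l_le y hy]
      exact D.m.neg_mem (Submodule.mem_sup_left hy)
    · intro y hy
      rw [Submodule.mem_comap, ad_apply, mem_gr.1 hy]
      exact D.m.smul_mem _ (Submodule.mem_sup_right
        (Submodule.mem_iSup_of_mem (p := fun i : {i : ℤ // i ≤ -2} => D.gr i) i hy))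
  exact h hx

lemma stable_ker_ad {s : ℤ × ℤ} {x : g} (hx : x ∈ D.bigr s) :
    D.Stable (LinearMap.ker (ad K g x)) := by
  intro y hy
  rw [LinearMap.mem_ker, ad_apply] at hy
  constructor
  · rw [LinearMap.mem_ker, ad_apply, leibniz_lie, hy, ← lie_skew x D.h, mem_gr.1 hx.1, neg_lie,
      smul_lie, hy]; simp
  · rw [LinearMap.mem_ker, ad_apply, leibniz_lie, hy, ← lie_skew x D.θ, mem_θEigenspace.1 hx.2, neg_lie,
      smul_lie, hy]; simp

lemma stable_range_ad {s : ℤ × ℤ} {x : g} (hx : x ∈ D.bigr s) :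
    D.Stable (LinearMap.range (ad K g x)) := by
  rintro _ ⟨y, rfl⟩
  constructor
  · rw [ad_apply, leibniz_lie, mem_gr.1 hx.1, smul_lie]
    exact add_mem (Submodule.smul_mem _ _ ⟨y, rfl⟩) ⟨_, rfl⟩
  · rw [ad_apply, leibniz_lie, mem_θEigenspace.1 hx.2, smul_lie]
    exact add_mem (Submodule.smul_mem _ _ ⟨y, rfl⟩) ⟨_, rfl⟩

lemma stable_top : D.Stable ⊤ := fun _ _ => ⟨trivial, trivial⟩

section

variable [CharZero K]

lemma iSupIndep_gr : iSupIndep D.gr :=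
  (ad K g D.h).eigenspaces_iSupIndep.comp (Int.cast_injective (α := K))

lemma iSupIndep_θEigenspace : iSupIndep D.θEigenspace :=
  (ad K g D.θ).eigenspaces_iSupIndep.comp (Int.cast_injective (α := K))

lemma eq_zero_of_mem_gr {i j : ℤ} (hij : i ≠ j) {x : g} (hi : x ∈ D.gr i) (hj : x ∈ D.gr j) :
    x = 0 :=
  Submodule.disjoint_def.1 (iSupIndep_gr.pairwiseDisjoint hij) x hi hj

lemma eq_zero_of_mem_θEigenspace {i j : ℤ} (hij : i ≠ j) {x : g} (hi : x ∈ D.θEigenspace i)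
    (hj : x ∈ D.θEigenspace j) : x = 0 :=
  Submodule.disjoint_def.1 (iSupIndep_θEigenspace.pairwiseDisjoint hij) x hi hj

lemma iSupIndep_bigr : iSupIndep D.bigr := by
  rw [iSupIndep_def]
  intro s
  rw [Submodule.disjoint_def]
  intro x hx hx'
  -- A bidegree t ≠ s differs from s in the first coordinate, or agrees there and differs in the
  -- second; the two independences are used in turn.
  have hle : (⨆ (t) (_ : t ≠ s), D.bigr t) ≤
      (⨆ (i) (_ : i ≠ s.1), D.gr i) ⊔ (D.gr s.1 ⊓ ⨆ (c) (_ : c ≠ s.2), D.θEigenspace c) := by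
    refine iSup₂_le fun t ht => ?_
    by_cases h1 : t.1 = s.1
    · refine le_sup_of_le_right (le_inf (h1 ▸ inf_le_left) ?_)
      exact inf_le_right.trans (le_iSup₂_of_le t.2 (fun h => ht (Prod.ext h1 h)) le_rfl)
    · exact le_sup_of_le_left (inf_le_left.trans (le_iSup₂_of_le t.1 h1 le_rfl))
  obtain ⟨a, ha, b, hb, rfl⟩ := Submodule.mem_sup.1 (hle hx')
  have ha0 : a = 0 := Submodule.disjoint_def.1 (iSupIndep_gr s.1) a
    (by simpa using sub_mem hx.1 hb.1) ha
  rw [ha0, zero_add] at hx ⊢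
  exact Submodule.disjoint_def.1 (iSupIndep_θEigenspace s.2) b hx.2 hb.2

/-- Invariance under h gives (i + j)(x, y) = 0. -/
lemma form_eq_zero {i j : ℤ} (hij : i + j ≠ 0) {x y : g} (hx : x ∈ D.gr i) (hy : y ∈ D.gr j) :
    D.form x y = 0 := by
  have h1 := form_lie_left (D := D) D.h x y
  rw [mem_gr.1 hx, mem_gr.1 hy, map_smul, map_smul, LinearMap.smul_apply, smul_eq_mul,
    smul_eq_mul] at h1
  have h2 : ((i + j : ℤ) : K) * D.form x y = 0 := by push_cast; linear_combination h1
  exact (mul_eq_zero.1 h2).resolve_left (Int.cast_ne_zero.2 hij)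

lemma form_eq_zero_of_θ {i j : ℤ} (hij : i + j ≠ 0) {x y : g} (hx : x ∈ D.θEigenspace i)
    (hy : y ∈ D.θEigenspace j) : D.form x y = 0 := by
  have h1 := form_lie_left (D := D) D.θ x y
  rw [mem_θEigenspace.1 hx, mem_θEigenspace.1 hy, map_smul, map_smul, LinearMap.smul_apply,
    smul_eq_mul, smul_eq_mul] at h1
  have h2 : ((i + j : ℤ) : K) * D.form x y = 0 := by push_cast; linear_combination h1
  exact (mul_eq_zero.1 h2).resolve_left (Int.cast_ne_zero.2 hij)

lemma χ_eq_zero_of_gr {i : ℤ} (hi : i ≠ -2) {x : g} (hx : x ∈ D.gr i) : D.χ x = 0 :=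
  form_eq_zero (by omega) e_mem_bigr.1 hx

lemma χ_eq_zero {s : ℤ × ℤ} (hs : s ≠ (-2, 0)) {x : g} (hx : x ∈ D.bigr s) : D.χ x = 0 := by
  by_cases h1 : s.1 = -2
  · have h2 : s.2 ≠ 0 := fun h2 => hs (Prod.ext h1 h2)
    exact form_eq_zero_of_θ (by simpa using h2) e_mem_bigr.2 hx.2
  · exact χ_eq_zero_of_gr h1 hx.1

variable [IsAlgClosed K] [FiniteDimensional K g]

lemma iSup_gr : ⨆ i, D.gr i = ⊤ := D.sl2.iSup_eigenspace_eq_top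

lemma Stable.le_iSup {p : Submodule K g} (hp : D.Stable p) : p ≤ ⨆ s, p ⊓ D.bigr s := by
  refine (Submodule.le_iSup_inf_eigenspace_intCast (A := ad K g D.h) iSup_gr
    (fun x hx => (hp x hx).1)).trans (iSup_le fun i => ?_)
  refine (Submodule.le_iSup_inf_eigenspace_intCast (A := ad K g D.θ) (p := p ⊓ D.gr i) D.θ_integral
    (fun x hx => ⟨(hp x hx.1).2, D.lie_θ_gr hx.2⟩)).trans (iSup_le fun c => ?_)
  rw [inf_assoc]
  exact _root_.le_iSup (fun s : ℤ × ℤ => p ⊓ D.bigr s) (i, c)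

lemma Stable.eq_bot {p : Submodule K g} (hp : D.Stable p)
    (h : ∀ s, ∀ x ∈ p, x ∈ D.bigr s → x = 0) : p = ⊥ := by
  rw [eq_bot_iff]
  exact hp.le_iSup.trans (iSup_le fun s x hx => h s x hx.1 hx.2)

lemma Stable.le_of_forall {p q : Submodule K g} (hp : D.Stable p)
    (h : ∀ s, ∀ x ∈ p, x ∈ D.bigr s → x ∈ q) : p ≤ q :=
  hp.le_iSup.trans (iSup_le fun s x hx => h s x hx.1 hx.2)

/-- A stable subspace has a basis of joint eigenvectors, ordered by the eigenvalues of `ad h`. -/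
lemma Stable.exists_basis {p : Submodule K g} (hp : D.Stable p) :
    ∃ (r : ℕ) (v : Fin r → g) (s : Fin r → ℤ × ℤ), LinearIndependent K v ∧
      Submodule.span K (Set.range v) = p ∧ (∀ k, v k ∈ D.bigr (s k)) ∧
      Monotone fun k => (s k).1 := by
  obtain ⟨b, hb, hspan, hli⟩ := exists_linearIndependent K {x | x ∈ p ∧ ∃ s, x ∈ D.bigr s}
  have hspan' : Submodule.span K b = p := by
    rw [hspan]
    refine le_antisymm (Submodule.span_le.2 fun x hx => hx.1) ?_
    exact hp.le_of_forall fun s x hx hs => Submodule.subset_span ⟨hx, s, hs⟩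
  have hfin : Finite b := hli.finite
  choose s hs using fun x : b => (hb x.2).2
  obtain ⟨r, ⟨ε⟩⟩ := Finite.exists_equiv_fin b
  let F : Fin r → ℤ := fun k => (s (ε.symm k)).1
  let τ := (Tuple.sort F).trans ε.symm
  refine ⟨r, fun k => τ k, fun k => s (τ k), hli.comp _ τ.injective, ?_, fun k => hs _,
    Tuple.monotone_sort F⟩
  rw [← hspan']
  congr 1
  ext x
  constructor
  · rintro ⟨k, rfl⟩; exact (τ k).2
  · intro hx; exact ⟨τ.symm ⟨x, hx⟩, by simp⟩

omit [IsAlgClosed K] [FiniteDimensional K g] in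
/-- A joint eigenvector only involves the basis vectors of the same weights. -/
lemma mem_span_of_mem_bigr {ι : Type*} [Finite ι] {v : ι → g} {s : ι → ℤ × ℤ}
    (hs : ∀ k, v k ∈ D.bigr (s k)) {t : ℤ × ℤ} {x : g} (hx : x ∈ Submodule.span K (Set.range v))
    (hxt : x ∈ D.bigr t) : x ∈ Submodule.span K (v '' {k | s k = t}) := by
  have h1 : x ∈ ⨆ u, Submodule.span K (v '' {k | s k = u}) := by
    refine Submodule.span_le.2 ?_ hx
    rintro _ ⟨k, rfl⟩
    exact Submodule.mem_iSup_of_mem (s k) (Submodule.subset_span ⟨k, rfl, rfl⟩)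
  obtain ⟨w, hw, hw'⟩ := Submodule.exists_mem_of_map_mem (iSupIndep_bigr (D := D)) LinearMap.id
    (p := fun u => Submodule.span K (v '' {k | s k = u})) (fun u => by
      change Submodule.span K (v '' {k | s k = u}) ≤ D.bigr u
      rw [Submodule.span_le]
      rintro _ ⟨k, rfl, rfl⟩
      exact hs k) h1 hxt
  simp only [LinearMap.id_apply] at hw'
  exact hw' ▸ hw

omit [IsAlgClosed K] in
lemma exists_lie_f_lie_e_eq {i : ℤ} (hi : i < 0) {x : g} (hx : x ∈ D.gr i) :
    ∃ w ∈ D.gr i, ⁅D.f, ⁅D.e, w⁆⁆ = x := by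
  obtain ⟨w, hw, hw'⟩ := D.sl2.symm.exists_lie_e_lie_f (K := K) (i := -i) (v := x) (by omega)
    (by rw [neg_lie, mem_gr.1 hx]; push_cast; module)
  refine ⟨w, mem_gr.2 ?_, hw'⟩
  rw [neg_lie, neg_eq_iff_eq_neg] at hw
  rw [hw]; push_cast; module

omit [IsAlgClosed K] in
lemma eq_zero_of_lie_e {i : ℤ} (hi : i < 0) {x : g} (hx : x ∈ D.gr i) (he : ⁅D.e, x⁆ = 0) :
    x = 0 := by
  by_contra h0
  obtain ⟨n, hn⟩ := IsSl2Triple.HasPrimitiveVectorWith.exists_nat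
    (t := D.sl2) ⟨h0, mem_gr.1 hx, he⟩
  have : i = n := by exact_mod_cast hn
  omega

omit [IsAlgClosed K] in
lemma eq_zero_of_lie_f_lie_e {i : ℤ} (hi : i < 0) {x : g} (hx : x ∈ D.gr i)
    (h : ⁅D.f, ⁅D.e, x⁆⁆ = 0) : x = 0 := by
  by_contra h0
  obtain ⟨n, hn⟩ := D.sl2.exists_nat_of_lie_f_lie_e (mem_gr.1 hx) h0 h
  have : i = n := by exact_mod_cast hn
  omega

omit [IsAlgClosed K] in
lemma eq_zero_of_lie_e_lie_f {i : ℤ} (hi : 0 < i) {x : g} (hx : x ∈ D.gr i)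
    (h : ⁅D.e, ⁅D.f, x⁆⁆ = 0) : x = 0 := by
  by_contra h0
  obtain ⟨n, hn⟩ := D.sl2.exists_nat_of_lie_e_lie_f (mem_gr.1 hx) h0 h
  have : i = -n := by exact_mod_cast hn
  omega

variable (D) in
/-- The complements `z_g(e)` and `[f, g]`. -/
lemma isCompl_ker_range :
    IsCompl (LinearMap.ker (ad K g D.e)) (LinearMap.range (ad K g D.f)) := by
  refine IsCompl.of_eq (((stable_ker_ad e_mem_bigr).inf
    (stable_range_ad f_mem_bigr)).eq_bot ?_) ?_
  · rintro s x ⟨hx, ⟨v, rfl⟩⟩ hs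
    obtain ⟨w, hw, hw'⟩ := Submodule.exists_mem_of_map_mem (q := D.bigr) iSupIndep_bigr
      (ad K g D.f) (p := fun s => D.bigr (s - (-2, 0))) (i := s) (v := v)
      (fun t x hx => by simpa using lie_mem_bigr f_mem_bigr hx) (by
        have h1 := stable_top.le_iSup (D := D) (x := v) trivial
        simp only [top_inf_eq] at h1
        have h2 : ⨆ t, D.bigr t ≤ ⨆ t, D.bigr (t - (-2, 0)) :=
          iSup_le fun t => le_iSup_of_le (t + (-2, 0)) (by simp)
        exact h2 h1) hs
    rw [← hw'] at hx hs ⊢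
    -- ad e is injective in negative degrees. Otherwise the preimage w has positive degree, where ad
    -- e ∘ ad f is injective.
    by_cases hs0 : s.1 < 0
    · exact eq_zero_of_lie_e hs0 hs.1 hx
    · have : w = 0 := eq_zero_of_lie_e_lie_f (i := s.1 + 2) (by omega)
        (by simpa [bigr] using hw.1) hx
      rw [this, map_zero]
  · rw [eq_top_iff, ← iSup_gr (D := D)]
    refine iSup_le fun i v hv => ?_
    -- In negative degree ad f ∘ ad e is onto. Otherwise solve [e, [f, w]] = [e, v] in degree i + 2
    -- > 0, so that v - [f, w] centralizes e.
    by_cases hi : i < 0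
    · obtain ⟨w, -, rfl⟩ := exists_lie_f_lie_e_eq hi hv
      exact Submodule.mem_sup_right ⟨_, rfl⟩
    · obtain ⟨w, hw, hw'⟩ := D.sl2.exists_lie_e_lie_f (K := K) (i := i + 2) (v := ⁅D.e, v⁆)
        (by omega) (D.sl2.eigenspace_lie_e (mem_gr.1 hv))
      have h1 : v = (v - ⁅D.f, w⁆) + ⁅D.f, w⁆ := by abel
      rw [h1]
      refine Submodule.add_mem_sup ?_ ⟨w, rfl⟩
      rw [LinearMap.mem_ker, ad_apply, lie_sub, hw', sub_self]

/-- χ only sees degree -2, where the centralizer of e is zero. -/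
lemma χ_eq_zero_of_lie_e {x : g} (hx : ⁅D.e, x⁆ = 0) : D.χ x = 0 := by
  have h : LinearMap.ker (ad K g D.e) ≤ LinearMap.ker D.χ := by
    refine (stable_ker_ad e_mem_bigr).le_of_forall fun s x hx hs => ?_
    by_cases h2 : s.1 = -2
    · rw [eq_zero_of_lie_e (by omega) hs.1 hx]; exact Submodule.zero_mem _
    · exact χ_eq_zero_of_gr h2 hs.1
  exact h hx

omit [CharZero K] [IsAlgClosed K] [FiniteDimensional K g] in
lemma mem_m_of_gr {i : ℤ} (hi : i ≤ -2) {x : g} (hx : x ∈ D.gr i) : x ∈ D.m :=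
  Submodule.mem_sup_right
    (Submodule.mem_iSup_of_mem (p := fun i : {i : ℤ // i ≤ -2} => D.gr i) ⟨i, hi⟩ hx)

omit [CharZero K] [IsAlgClosed K] [FiniteDimensional K g] in
lemma m_le_iSup : D.m ≤ ⨆ (i : ℤ) (_ : i < 0), D.gr i := by
  refine sup_le (fun x hx => ?_) (iSup_le fun i => ?_)
  · exact Submodule.mem_iSup_of_mem (-1) (Submodule.mem_iSup_of_mem (by norm_num)
      (mem_gr.2 (by simpa using D.l_le x hx)))
  · exact le_iSup₂_of_le (i : ℤ) (by have := i.2; omega) le_rfl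

omit [IsAlgClosed K] [FiniteDimensional K g] in
lemma neg_of_mem_m {i : ℤ} {x : g} (hx : x ∈ D.m) (hi : x ∈ D.gr i) (h0 : x ≠ 0) : i < 0 := by
  by_contra hn
  refine h0 (Submodule.disjoint_def.1 (iSupIndep_gr i) x hi ?_)
  refine (m_le_iSup.trans (iSup₂_le fun j hj => ?_)) hx
  exact le_iSup₂_of_le j (by omega) le_rfl

omit [IsAlgClosed K] [FiniteDimensional K g] in
lemma mem_l_of_mem_m {x : g} (hx : x ∈ D.m) (hi : x ∈ D.gr (-1)) : x ∈ D.l := by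
  obtain ⟨a, ha, b, hb, rfl⟩ := Submodule.mem_sup.1 hx
  have hb0 : b = 0 := by
    refine Submodule.disjoint_def.1 (iSupIndep_gr (D := D) (-1)) b ?_ ?_
    · simpa using sub_mem hi (mem_gr.2 (by simpa using D.l_le a ha) : a ∈ D.gr (-1))
    · have h2 : ⨆ i : {i : ℤ // i ≤ -2}, D.gr i ≤ ⨆ (i : ℤ) (_ : i ≠ -1), D.gr i :=
        iSup_le fun j => le_iSup₂_of_le (j : ℤ) (by have := j.2; omega) le_rfl
      exact h2 hb
  rwa [hb0, add_zero]

-- Nonzero homogeneous elements of m have negative degree, so the bracket has degree at most -2. χ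
-- could be nonzero only for two elements of degree -1, and l is isotropic.
omit [IsAlgClosed K] [FiniteDimensional K g] in
lemma lie_mem_m {i j : ℤ} {x y : g} (hx : x ∈ D.m) (hxi : x ∈ D.gr i) (hy : y ∈ D.m)
    (hyj : y ∈ D.gr j) : ⁅x, y⁆ ∈ D.m ∧ D.χ ⁅x, y⁆ = 0 := by
  by_cases hx0 : x = 0
  · simp [hx0]
  by_cases hy0 : y = 0
  · simp [hy0]
  have hi := neg_of_mem_m hx hxi hx0
  have hj := neg_of_mem_m hy hyj hy0
  refine ⟨mem_m_of_gr (by omega) (lie_mem_gr hxi hyj), ?_⟩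
  by_cases hij : i + j = -2
  · obtain rfl : i = -1 := by omega
    obtain rfl : j = -1 := by omega
    exact (D.l_lagrangian x (by simpa using mem_gr.1 hxi)).1 (mem_l_of_mem_m hx hxi) y
      (mem_l_of_mem_m hy hyj)
  · exact χ_eq_zero_of_gr hij (lie_mem_gr hxi hyj)

-- With `lie_f_eq_zero`, this makes z_g(f) the orthogonal of [f, g]: directions of the slice
-- correspond to linear functions on g vanishing on [f, g].
omit [CharZero K] [IsAlgClosed K] [FiniteDimensional K g] in
lemma form_eq_zero_of_lie_f {y z : g} (hy : y ∈ LinearMap.range (ad K g D.f))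
    (hz : ⁅D.f, z⁆ = 0) : D.form y z = 0 := by
  obtain ⟨v, rfl⟩ := hy
  rw [ad_apply, form_lie_left, hz, map_zero, neg_zero]

omit [CharZero K] [IsAlgClosed K] [FiniteDimensional K g] in
lemma lie_f_eq_zero {z : g} (h : ∀ y ∈ LinearMap.range (ad K g D.f), D.form y z = 0) :
    ⁅D.f, z⁆ = 0 := by
  refine D.form_nondegenerate.2 _ fun v => ?_
  have h1 := h _ ⟨v, rfl⟩
  rwa [ad_apply, form_lie_left, neg_eq_zero] at h1

/-- A dual basis: `χ [v j, y k] = δ_{jk}` for a basis `v` of `m`. -/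
lemma exists_dual_family {r : ℕ} {v : Fin r → g} {s : Fin r → ℤ × ℤ}
    (hli : LinearIndependent K v) (hspan : Submodule.span K (Set.range v) = D.m)
    (hs : ∀ k, v k ∈ D.bigr (s k)) :
    ∃ y : Fin r → g, (∀ k, y k ∈ D.bigr ((-2, 0) - s k)) ∧
      (∀ j k, D.χ ⁅v j, y k⁆ = if j = k then 1 else 0) ∧
      LinearMap.range (ad K g D.f) ≤ D.m ⊔ Submodule.span K (Set.range y) := by
  classical
  let A : g →ₗ[K] g := ad K g D.f ∘ₗ ad K g D.e
  -- The pairing of m with [f, g] becomes the form against A m. As A = ad f ∘ ad e is injective on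
  -- m, the A (v j) are independent and nondegeneracy provides dual vectors.
  have hApair : ∀ x w, D.χ ⁅x, ⁅D.f, w⁆⁆ = -D.form (A x) w := by
    intro x w
    change D.form D.e _ = -D.form ⁅D.f, ⁅D.e, x⁆⁆ w
    rw [← D.form_invariant, form_lie_left D.f, neg_neg]
  have hAinj : Set.InjOn A (Submodule.span K (Set.range v)) := by
    rw [hspan]
    have hbot : D.m ⊓ LinearMap.ker A = ⊥ := by
      refine (stable_m.inf ?_).eq_bot fun t x hx ht => ?_
      · intro x hx
        rw [LinearMap.mem_ker] at hx
        have key : ∀ a : g, ⁅a, D.f⁆ ∈ K ∙ D.f → ⁅a, D.e⁆ ∈ K ∙ D.e → A ⁅a, x⁆ = 0 := by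
          intro a h1 h2
          obtain ⟨c, hc⟩ := Submodule.mem_span_singleton.1 h1
          obtain ⟨d, hd⟩ := Submodule.mem_span_singleton.1 h2
          have hx' : ⁅D.f, ⁅D.e, x⁆⁆ = 0 := hx
          change ⁅D.f, ⁅D.e, ⁅a, x⁆⁆⁆ = 0
          have e1 : ⁅D.e, ⁅a, x⁆⁆ = ⁅a, ⁅D.e, x⁆⁆ - d • ⁅D.e, x⁆ := by
            rw [leibniz_lie a D.e x, ← hd, smul_lie]; abel
          have e2 : ⁅D.f, ⁅a, ⁅D.e, x⁆⁆⁆ = ⁅a, ⁅D.f, ⁅D.e, x⁆⁆⁆ - c • ⁅D.f, ⁅D.e, x⁆⁆ := by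
            rw [leibniz_lie a D.f, ← hc, smul_lie]; abel
          rw [e1, lie_sub, e2, lie_smul, hx', lie_zero, smul_zero, smul_zero, sub_zero, sub_zero]
        refine ⟨key _ ?_ ?_, key _ ?_ ?_⟩ <;> rw [Submodule.mem_span_singleton]
        · exact ⟨_, (mem_gr.1 f_mem_bigr.1).symm⟩
        · exact ⟨_, (mem_gr.1 e_mem_bigr.1).symm⟩
        · exact ⟨0, by rw [D.lie_θ_f, zero_smul]⟩
        · exact ⟨0, by rw [D.lie_θ_e, zero_smul]⟩
      · by_contra h0
        exact h0 (eq_zero_of_lie_f_lie_e (neg_of_mem_m hx.1 ht.1 h0) ht.1 hx.2)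
    intro x hx x' hx' hxx
    have : x - x' ∈ D.m ⊓ LinearMap.ker A :=
      ⟨sub_mem hx hx', show A (x - x') = 0 by rw [map_sub, sub_eq_zero]; exact hxx⟩
    rw [hbot, Submodule.mem_bot] at this
    exact sub_eq_zero.1 this
  have hli' : LinearIndependent K (A ∘ v) := hli.map_injOn A hAinj
  have hex : ∀ k, ∃ w : g, ∀ j, -D.form (A (v j)) w = if j = k then 1 else 0 := by
    intro k
    obtain ⟨φ, hφ⟩ := LinearMap.exists_extend ((Basis.span hli').coord k)
    refine ⟨-(D.form.toDual D.form_nondegenerate).symm φ, fun j => ?_⟩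
    rw [map_neg, neg_neg, D.form_symm, LinearMap.BilinForm.apply_toDual_symm_apply]
    have h1 : φ (A (v j)) = (Basis.span hli').coord k ((Basis.span hli') j) := by
      rw [← hφ]; simp [Basis.span_apply]
    rw [h1, Basis.coord_apply, Basis.repr_self, Finsupp.single_apply]
  choose w hw using hex
  have hy : ∀ k, ∃ y : g, y ∈ LinearMap.range (ad K g D.f) ∧ y ∈ D.bigr ((-2, 0) - s k) ∧
      ∀ j, D.χ ⁅v j, y⁆ = if j = k then 1 else 0 := by
    intro k
    -- χ sees only bidegree (-2, 0), so [f, w k] can be replaced by its component of bidegree (-2,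
    -- 0) - s k. The pairings with v j survive when s j = s k and vanish otherwise.
    obtain ⟨c, hc, hcs⟩ := (Submodule.mem_iSup_iff_exists_finsupp _ _).1
      ((stable_range_ad f_mem_bigr).le_iSup (D := D) (x := ⁅D.f, w k⁆) ⟨w k, rfl⟩)
    refine ⟨c ((-2, 0) - s k), (hc _).1, (hc _).2, fun j => ?_⟩
    by_cases hj : s j = s k
    · rw [← hw k j, ← hApair, ← hcs, Finsupp.sum, lie_sum, map_sum,
        Finset.sum_eq_single ((-2, 0) - s k)]
      · intro t _ ht
        refine χ_eq_zero ?_ (lie_mem_bigr (hs j) (hc t).2)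
        rw [hj]; contrapose! ht; rw [← ht]; abel
      · intro h
        rw [Finsupp.notMem_support_iff.1 h, lie_zero, map_zero]
    · rw [if_neg (fun h => hj (by rw [h]))]
      refine χ_eq_zero ?_ (lie_mem_bigr (hs j) (hc _).2)
      contrapose! hj
      rw [add_sub_left_comm, add_eq_left] at hj
      exact sub_eq_zero.1 hj
  choose y hy1 hy2 hy3 using hy
  refine ⟨y, hy2, fun j k => hy3 k j, ?_⟩
  intro x hx
  -- This correction makes x' pair to zero with m. Such an element of [f, g] is shown to lie in m,
  -- one homogeneous component at a time.
  set x' := x - ∑ k, D.χ ⁅v k, x⁆ • y k with hx'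
  have hx'r : x' ∈ LinearMap.range (ad K g D.f) :=
    sub_mem hx (Submodule.sum_mem _ fun k _ => Submodule.smul_mem _ _ (hy1 k))
  have hx'v : ∀ j, D.χ ⁅v j, x'⁆ = 0 := by
    intro j
    rw [hx', lie_sub, map_sub, lie_sum, map_sum]
    simp [hy3]
  suffices h : x' ∈ D.m by
    have : x = x' + ∑ k, D.χ ⁅v k, x⁆ • y k := by rw [hx']; abel
    rw [this]
    exact Submodule.add_mem_sup h (Submodule.sum_mem _ fun k _ =>
      Submodule.smul_mem _ _ (Submodule.subset_span ⟨k, rfl⟩))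
  have hx'm : ∀ ξ ∈ D.m, D.χ ⁅ξ, x'⁆ = 0 := by
    intro ξ hξ
    rw [← hspan] at hξ
    induction hξ using Submodule.span_induction with
    | mem _ h => obtain ⟨j, rfl⟩ := h; exact hx'v j
    | zero => simp
    | add a b _ _ ha hb => rw [add_lie, map_add, ha, hb, add_zero]
    | smul a b _ hb => rw [smul_lie, map_smul, hb, smul_zero]
  obtain ⟨c, hc, hcs⟩ := (Submodule.mem_iSup_iff_exists_finsupp _ _).1
    ((stable_range_ad f_mem_bigr).le_iSup (D := D) hx'r)
  rw [← hcs]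
  refine Submodule.sum_mem _ fun t _ => ?_
  have hct : ∀ t', ∀ ξ ∈ D.m, ξ ∈ D.bigr t' → D.χ ⁅ξ, c t⁆ = 0 := by
    intro t' ξ hξ hξt
    by_cases htt : t' + t = (-2, 0)
    · rw [← hx'm ξ hξ, ← hcs, Finsupp.sum, lie_sum, map_sum, Finset.sum_eq_single t]
      · intro u _ hu
        refine χ_eq_zero ?_ (lie_mem_bigr hξt (hc u).2)
        contrapose! hu
        exact add_left_cancel (hu.trans htt.symm)
      · intro h
        rw [Finsupp.notMem_support_iff.1 h, lie_zero, map_zero]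
    · exact χ_eq_zero htt (lie_mem_bigr hξt (hc t).2)
  have hct' : ∀ ξ ∈ D.m, D.χ ⁅ξ, c t⁆ = 0 := by
    have h1 : D.m ≤ LinearMap.ker (D.χ ∘ₗ ad K g (c t)) :=
      stable_m.le_of_forall fun t' ξ hξ hξt => by
        rw [LinearMap.mem_ker, LinearMap.comp_apply, ad_apply, ← lie_skew, map_neg,
          hct t' ξ hξ hξt, neg_zero]
    intro ξ hξ
    have h2 : D.χ ⁅c t, ξ⁆ = 0 := h1 hξ
    rw [← lie_skew, map_neg, h2, neg_zero]
  -- Degrees at most -2 lie in m; degree -1 uses the maximality of the isotropic subspace l. In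
  -- degree at least 0, [e, c t] is orthogonal to all of g, so c t lies in z_g(e) ∩ [f, g] = 0.
  rcases lt_trichotomy t.1 (-1) with h | h | h
  · exact mem_m_of_gr (by omega) (hc t).2.1
  · refine Submodule.mem_sup_left ((D.l_lagrangian _ ?_).2 fun ξ hξ => ?_)
    · simpa [h] using mem_gr.1 (hc t).2.1
    · have := hct' ξ (Submodule.mem_sup_left hξ)
      rw [← lie_skew, map_neg, neg_eq_zero] at this
      exact this
  · have h0 : c t = 0 := by
      have he : ⁅D.e, c t⁆ = 0 := by
        refine D.form_nondegenerate.1 _ fun ξ => ?_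
        have h1 : ∀ j, ∀ ξ ∈ D.gr j, D.form ⁅D.e, c t⁆ ξ = 0 := by
          intro j ξ hξ
          by_cases hj : j ≤ -2
          · have := hct' ξ (mem_m_of_gr hj hξ)
            rw [D.form_invariant]
            rw [← lie_skew, map_neg, neg_eq_zero] at this
            exact this
          · exact form_eq_zero (by simp; omega) (lie_mem_bigr e_mem_bigr (hc t).2).1 hξ
        have h2 : ⨆ j, D.gr j ≤ LinearMap.ker (D.form ⁅D.e, c t⁆) := iSup_le fun j ξ hξ => h1 j ξ hξ
        rw [iSup_gr] at h2
        exact h2 trivial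
      exact Submodule.disjoint_def.1 D.isCompl_ker_range.disjoint _ he (hc t).1
    rw [h0]; exact Submodule.zero_mem _

end

end WDatum


/-! ### Locally nilpotent Heisenberg pairs and triangular families of them. -/

section HeisenbergPair

open Finset

variable {K B : Type*} [Field K] [AddCommGroup B] [Module K B] {X Y : Module.End K B}

lemma Module.End.mul_pow_succ_of_heisenberg (h : X * Y = Y * X + 1) (n : ℕ) :
    X * Y ^ (n + 1) = Y ^ (n + 1) * X + (n + 1 : K) • Y ^ n := by
  induction n with
  | zero => simp [h]
  | succ n ih =>
    rw [pow_succ Y (n + 1), ← mul_assoc, ih, add_mul, mul_assoc, h, mul_add, ← mul_assoc,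
      smul_mul_assoc, ← pow_succ]
    push_cast
    rw [mul_one, add_smul _ _ (Y ^ (n + 1)), one_smul]
    abel

lemma Module.End.pow_succ_mul_of_heisenberg (h : X * Y = Y * X + 1) (n : ℕ) :
    X ^ (n + 1) * Y = Y * X ^ (n + 1) + (n + 1 : K) • X ^ n := by
  induction n with
  | zero => simp [h]
  | succ n ih =>
    rw [pow_succ' X (n + 1), mul_assoc, ih, mul_add, ← mul_assoc, h, add_mul,
      mul_smul_comm, ← pow_succ', mul_assoc, ← pow_succ']
    push_cast
    rw [one_mul]
    module

variable [CharZero K]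

/-- Applying X^{n+1} Y = Y X^{n+1} + (n+1) X^n to d shows that X^{n+1} d = 0 implies X^n d = 0;
descend from N to 0. -/
lemma Module.End.eq_zero_of_heisenberg (h : X * Y = Y * X + 1) {N : ℕ} {d : B}
    (hN : (X ^ N) d = 0) (hd : X (Y d) = 0) : d = 0 := by
  have key : ∀ n, (X ^ (n + 1)) d = 0 → (X ^ n) d = 0 := by
    intro n hn
    have h1 := congrArg (fun A : Module.End K B => A d) (pow_succ_mul_of_heisenberg h n)
    simp only [LinearMap.add_apply, LinearMap.smul_apply, Module.End.mul_apply, hn, map_zero,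
      zero_add] at h1
    rw [pow_succ, Module.End.mul_apply, hd, map_zero, eq_comm, smul_eq_zero] at h1
    exact h1.resolve_left (Nat.cast_add_one_ne_zero n)
  induction N with
  | zero => simpa using hN
  | succ N ih => exact ih (key N hN)

/-- X Y^{j+1} X^j = Y^{j+1} X^{j+1} + (j+1) Y^j X^j, so with these coefficients XY turns the sum
into a telescoping one, whose last term vanishes because X^N b = 0. -/
lemma Module.End.exists_of_heisenberg (h : X * Y = Y * X + 1) {N : ℕ} {b : B}
    (hN : (X ^ N) b = 0) :
    X (Y (∑ j ∈ range N, ((-1) ^ j / (j + 1).factorial : K) • (Y ^ j) ((X ^ j) b))) = b := by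
  have h1 : ∀ j, X (Y (((-1) ^ j / (j + 1).factorial : K) • (Y ^ j) ((X ^ j) b))) =
      ((-1) ^ j / j.factorial : K) • (Y ^ j) ((X ^ j) b) -
      ((-1) ^ (j + 1) / (j + 1).factorial : K) • (Y ^ (j + 1)) ((X ^ (j + 1)) b) := by
    intro j
    have h2 := congrArg (fun A : Module.End K B => A ((X ^ j) b)) (mul_pow_succ_of_heisenberg h j)
    simp only [LinearMap.add_apply, LinearMap.smul_apply, Module.End.mul_apply] at h2
    rw [map_smul, map_smul, ← Module.End.mul_apply Y, ← pow_succ', h2, smul_add, smul_smul,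
      ← Module.End.mul_apply X, ← pow_succ', Nat.factorial_succ]
    have h3 : (j + 1 : K) ≠ 0 := Nat.cast_add_one_ne_zero j
    have h4 : (j.factorial : K) ≠ 0 := Nat.cast_ne_zero.2 j.factorial_ne_zero
    have e1 : ((-1) ^ j / ((j + 1) * j.factorial : ℕ) * (j + 1) : K) = (-1) ^ j / j.factorial := by
      push_cast; field_simp
    have e2 : ((-1) ^ (j + 1) / ((j + 1) * j.factorial : ℕ) : K)
        = -((-1) ^ j / ((j + 1) * j.factorial : ℕ)) := by
      rw [pow_succ]; ring
    rw [e1, e2, neg_smul]; abel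
  rw [map_sum, map_sum, sum_congr rfl (fun j _ => h1 j), sum_range_sub', hN]
  simp

end HeisenbergPair

/-- Operators `X k`, `Y k` on a module with homogeneous parts `H i`, where `X k` lowers and `Y k`
raises degrees by `s k`: a triangular family of Heisenberg pairs. -/
structure TriangularHeisenberg {K B I : Type*} [Field K] [AddCommGroup B] [Module K B]
    [AddCommGroup I] {r : ℕ} (H : I → Submodule K B) (s : Fin r → I)
    (X Y : Fin r → Module.End K B) : Prop where
  X_mem : ∀ k i, ∀ b ∈ H i, X k b ∈ H (i - s k)
  Y_mem : ∀ k i, ∀ b ∈ H i, Y k b ∈ H (i + s k)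
  nilp : ∀ k b, ∃ N : ℕ, (X k ^ N) b = 0
  X_Y_self : ∀ k, X k * Y k = Y k * X k + 1
  X_Y : ∀ j k, j < k → X j * Y k = Y k * X j
  Y_Y : ∀ j k, Y j * Y k = Y k * Y j
  X_X : ∀ k b, (∀ j < k, X j b = 0) → ∀ j < k, X j (X k b) = 0

namespace TriangularHeisenberg

variable {K B I : Type*} [Field K] [AddCommGroup B] [Module K B]
    [AddCommGroup I] {r : ℕ} {H : I → Submodule K B} {s : Fin r → I}
    {X Y : Fin r → Module.End K B} (T : TriangularHeisenberg H s X Y)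

include T

lemma X_pow_mem (k : Fin r) {i : I} {b : B} (hb : b ∈ H i) (n : ℕ) :
    (X k ^ n) b ∈ H (i - n • s k) := by
  induction n with
  | zero => simpa using hb
  | succ n ih =>
    rw [pow_succ', Module.End.mul_apply, succ_nsmul, ← sub_sub]
    exact T.X_mem _ _ _ ih

lemma Y_pow_mem (k : Fin r) {i : I} {b : B} (hb : b ∈ H i) (n : ℕ) :
    (Y k ^ n) b ∈ H (i + n • s k) := by
  induction n with
  | zero => simpa using hb
  | succ n ih =>
    rw [pow_succ', Module.End.mul_apply, succ_nsmul, ← add_assoc]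
    exact T.Y_mem _ _ _ ih

lemma X_pow_inv (k : Fin r) {b : B} (hb : ∀ j < k, X j b = 0) (n : ℕ) :
    ∀ j < k, X j ((X k ^ n) b) = 0 := by
  induction n with
  | zero => simpa using hb
  | succ n ih =>
    rw [pow_succ', Module.End.mul_apply]
    exact T.X_X k _ ih

lemma Y_inv {j k : Fin r} (hjk : j < k) {b : B} (hb : X j b = 0) : X j (Y k b) = 0 := by
  rw [← Module.End.mul_apply, T.X_Y j k hjk, Module.End.mul_apply, hb, map_zero]

lemma Y_pow_inv {j k : Fin r} (hjk : j < k) {b : B} (hb : X j b = 0) (n : ℕ) :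
    X j ((Y k ^ n) b) = 0 := by
  induction n with
  | zero => simpa using hb
  | succ n ih =>
    rw [pow_succ', Module.End.mul_apply]
    exact T.Y_inv hjk ih

variable [CharZero K]

/-- The explicit solution is a combination of the Y_k^n X_k^n b, and Y_k^n X_k^n preserves degrees
and the common kernel of the earlier X_j. -/
lemma exists_antiderivative (k : Fin r) {b : B} (hb : ∀ j < k, X j b = 0) :
    ∃ d, X k (Y k d) = b ∧ (∀ j < k, X j d = 0) ∧ ∀ i, b ∈ H i → d ∈ H i := by
  obtain ⟨N, hN⟩ := T.nilp k b
  refine ⟨_, Module.End.exists_of_heisenberg (T.X_Y_self k) hN, fun j hj => ?_, fun i hi => ?_⟩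
  · rw [map_sum]
    refine Finset.sum_eq_zero fun n _ => ?_
    rw [map_smul, T.Y_pow_inv hj (T.X_pow_inv k hb n j hj), smul_zero]
  · refine Submodule.sum_mem _ fun n _ => Submodule.smul_mem _ _ ?_
    simpa using T.Y_pow_mem k (T.X_pow_mem k hi n) n

/-- Each step kills X_n b' by subtracting Y_n d with X_n Y_n d = X_n b'. The earlier conditions
survive because X_j commutes with Y_n for j < n. -/
lemma exists_projection_aux (n : ℕ) {i : I} {b : B} (hb : b ∈ H i) :
    ∃ b' ∈ H i, (∀ j : Fin r, j.val < n → X j b' = 0) ∧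
      b' - b ∈ ⨆ k, LinearMap.range (Y k) := by
  induction n with
  | zero => exact ⟨b, hb, by simp, by simp⟩
  | succ n ih =>
    obtain ⟨b', hb', h1, h2⟩ := ih
    by_cases hn : n < r
    · obtain ⟨d, hd1, hd2, hd3⟩ := T.exists_antiderivative ⟨n, hn⟩ (b := X ⟨n, hn⟩ b')
        (T.X_X _ _ fun j hj => h1 j hj)
      refine ⟨b' - Y ⟨n, hn⟩ d, sub_mem hb' ?_, fun j hj => ?_, ?_⟩
      · have := T.Y_mem ⟨n, hn⟩ _ _ (hd3 _ (T.X_mem _ _ _ hb'))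
        rwa [sub_add_cancel] at this
      · rcases Nat.lt_succ_iff_lt_or_eq.1 hj with hj | hj
        · rw [map_sub, h1 j hj, T.Y_inv (k := ⟨n, hn⟩) hj (hd2 j hj), sub_zero]
        · obtain rfl : j = ⟨n, hn⟩ := Fin.ext hj
          rw [map_sub, hd1, sub_self]
      · rw [sub_right_comm]
        exact sub_mem h2 (Submodule.mem_iSup_of_mem _ ⟨d, rfl⟩)
    · exact ⟨b', hb', fun j _ => h1 j (by omega), h2⟩

lemma exists_projection {i : I} {b : B} (hb : b ∈ H i) :
    ∃ b' ∈ H i, (∀ j, X j b' = 0) ∧ b' - b ∈ ⨆ k, LinearMap.range (Y k) := by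
  obtain ⟨b', h1, h2, h3⟩ := T.exists_projection_aux r hb
  exact ⟨b', h1, fun j => h2 j j.2, h3⟩

lemma exists_decomposition (k : Fin r) {b : B} (hb : ∀ j < k, X j b = 0) :
    ∃ b' d, b = b' + Y k d ∧ (∀ j ≤ k, X j b' = 0) ∧ ∀ j < k, X j d = 0 := by
  obtain ⟨d, hd1, hd2, -⟩ := T.exists_antiderivative k (b := X k b) (T.X_X _ _ hb)
  refine ⟨b - Y k d, d, by abel, fun j hj => ?_, hd2⟩
  rcases hj.lt_or_eq with hj | rfl
  · rw [map_sub, hb j hj, T.Y_inv hj (hd2 j hj), sub_zero]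
  · rw [map_sub, hd1, sub_self]

/-- The summands Y_k c_k are eliminated one index at a time: b becomes a sum over k ≥ n with
coefficients killed by all X_j, j < n, and at n = r the sum is empty. -/
lemma eq_zero_of_mem {b : B} (hb : ∀ j, X j b = 0) (hbY : b ∈ ⨆ k, LinearMap.range (Y k)) :
    b = 0 := by
  have key : ∀ n : ℕ, ∃ c : Fin r → B, (∀ k : Fin r, ∀ j : Fin r, j.val < n → X j (c k) = 0) ∧
      b = ∑ k ∈ Finset.univ.filter (fun k : Fin r => n ≤ k.val), Y k (c k) := by
    intro n
    induction n with
    | zero =>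
      obtain ⟨f, hf, hfs⟩ := (Submodule.mem_iSup_iff_exists_finsupp _ _).1 hbY
      choose c hc using hf
      refine ⟨c, by simp, ?_⟩
      rw [← hfs, Finsupp.sum_fintype _ _ (fun _ => rfl)]
      simp [hc]
    | succ n ih =>
      obtain ⟨c, hc, hbc⟩ := ih
      by_cases hn : n < r
      · set κ : Fin r := ⟨n, hn⟩ with hκ
        have hdec : ∀ k, ∃ b' d, c k = b' + Y κ d ∧ (∀ j ≤ κ, X j b' = 0) ∧
            ∀ j < κ, X j d = 0 := fun k => T.exists_decomposition κ fun j hj => hc k j hj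
        choose c' d hcd hc' hd using hdec
        set S := Finset.univ.filter (fun k : Fin r => n + 1 ≤ k.val) with hS
        have hfilter : Finset.univ.filter (fun k : Fin r => n ≤ k.val) = insert κ S := by
          ext k
          simp only [hS, hκ, Finset.mem_filter, Finset.mem_univ, true_and, Finset.mem_insert,
            Fin.ext_iff]
          omega
        have hκS : κ ∉ S := by simp [hS, hκ]
        set D := c κ + ∑ k ∈ S, Y k (d k) with hD
        have hb1 : b = Y κ D + ∑ k ∈ S, Y k (c' k) := by
          rw [hbc, hfilter, Finset.sum_insert hκS, hD, map_add, map_sum, add_assoc,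
            ← Finset.sum_add_distrib]
          congr 1
          refine Finset.sum_congr rfl fun k _ => ?_
          rw [hcd k, map_add, ← Module.End.mul_apply, T.Y_Y k κ, Module.End.mul_apply, add_comm]
        -- X_κ kills b and every Y_k c'_k with k > κ, so X_κ Y_κ D = 0, and X_κ Y_κ is injective.
        have hD0 : D = 0 := by
          obtain ⟨N, hN⟩ := T.nilp κ D
          refine Module.End.eq_zero_of_heisenberg (T.X_Y_self κ) hN ?_
          have h1 := hb κ
          rw [hb1, map_add, map_sum, Finset.sum_eq_zero, add_zero] at h1
          · exact h1
          · intro k hk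
            refine T.Y_inv ?_ (hc' k κ le_rfl)
            simp only [hS, Finset.mem_filter, Finset.mem_univ, true_and] at hk
            exact hk
        refine ⟨c', fun k j hj => hc' k j (Nat.lt_succ_iff.1 hj), ?_⟩
        rw [hb1, hD0, map_zero, zero_add]
      · refine ⟨c, fun k j hj => hc k j (by omega), ?_⟩
        rw [hbc]
        refine Finset.sum_congr ?_ fun _ _ => rfl
        ext k
        simp only [Finset.mem_filter, Finset.mem_univ, true_and]
        omega
  obtain ⟨c, -, hbc⟩ := key r
  rw [hbc, Finset.filter_false_of_mem (by intro k _; omega), Finset.sum_empty]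

end TriangularHeisenberg

/-! ### Associated graded modules, symbols, and lifting of common kernels. -/

noncomputable section Filtered

open DirectSum

variable {K Q : Type*} [Field K] [AddCommGroup Q] [Module K Q] (F : ℤ × ℤ → Submodule K Q)

/-- The graded module associated with a family of submodules filtered in the first index. -/
def BiGraded : Type _ := ⨁ i : ℤ × ℤ, F i ⧸ (F (i - (1, 0))).submoduleOf (F i)

instance : AddCommGroup (BiGraded F) :=
  inferInstanceAs (AddCommGroup (⨁ i : ℤ × ℤ, F i ⧸ (F (i - (1, 0))).submoduleOf (F i)))

instance : Module K (BiGraded F) :=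
  inferInstanceAs (Module K (⨁ i : ℤ × ℤ, F i ⧸ (F (i - (1, 0))).submoduleOf (F i)))

/-- The inclusion of a homogeneous part. -/
def BiGraded.incl (i : ℤ × ℤ) :
    (F i ⧸ (F (i - (1, 0))).submoduleOf (F i)) →ₗ[K] BiGraded F :=
  lof K (ℤ × ℤ) (fun i : ℤ × ℤ => F i ⧸ (F (i - (1, 0))).submoduleOf (F i)) i

variable {F}

lemma BiGraded.incl_injective (i : ℤ × ℤ) : Function.Injective (BiGraded.incl F i) :=
  DirectSum.of_injective (β := fun i : ℤ × ℤ => F i ⧸ (F (i - (1, 0))).submoduleOf (F i)) i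

lemma BiGraded.incl_induction {P : BiGraded F → Prop} (b : BiGraded F) (hzero : P 0)
    (hincl : ∀ i a, P (BiGraded.incl F i a)) (hadd : ∀ a b, P a → P b → P (a + b)) : P b :=
  DirectSum.induction_on
    (β := fun i : ℤ × ℤ => F i ⧸ (F (i - (1, 0))).submoduleOf (F i)) b hzero hincl hadd

/-- The universal property of the direct sum. -/
def BiGraded.lift {N : Type*} [AddCommGroup N] [Module K N]
    (φ : ∀ i, (F i ⧸ (F (i - (1, 0))).submoduleOf (F i)) →ₗ[K] N) : BiGraded F →ₗ[K] N :=
  toModule K (ℤ × ℤ) N φ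

lemma BiGraded.lift_incl {N : Type*} [AddCommGroup N] [Module K N]
    (φ : ∀ i, (F i ⧸ (F (i - (1, 0))).submoduleOf (F i)) →ₗ[K] N) (i : ℤ × ℤ)
    (a : F i ⧸ (F (i - (1, 0))).submoduleOf (F i)) :
    BiGraded.lift φ (BiGraded.incl F i a) = φ i a :=
  DirectSum.toModule_lof (R := K) (ι := ℤ × ℤ)
    (M := fun i : ℤ × ℤ => F i ⧸ (F (i - (1, 0))).submoduleOf (F i)) (N := N) (φ := φ) i a

open Classical in
variable (F) in
/-- The symbol of an element of `F i` in the associated graded module. -/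
def symbol (i : ℤ × ℤ) (q : Q) : BiGraded F :=
  if h : q ∈ F i then BiGraded.incl F i (Submodule.Quotient.mk ⟨q, h⟩) else 0

lemma symbol_of_mem {i : ℤ × ℤ} {q : Q} (h : q ∈ F i) : symbol F i q =
    BiGraded.incl F i (Submodule.Quotient.mk ⟨q, h⟩) := dif_pos h

lemma symbol_eq_zero_iff {i : ℤ × ℤ} {q : Q} (h : q ∈ F i) :
    symbol F i q = 0 ↔ q ∈ F (i - (1, 0)) := by
  rw [symbol_of_mem h, map_eq_zero_iff _ (BiGraded.incl_injective i),
    Submodule.Quotient.mk_eq_zero]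
  rfl

lemma symbol_add {i : ℤ × ℤ} {q q' : Q} (h : q ∈ F i) (h' : q' ∈ F i) :
    symbol F i (q + q') = symbol F i q + symbol F i q' := by
  rw [symbol_of_mem h, symbol_of_mem h', symbol_of_mem (add_mem h h'), ← map_add]
  rfl

lemma symbol_smul {i : ℤ × ℤ} {q : Q} (h : q ∈ F i) (c : K) :
    symbol F i (c • q) = c • symbol F i q := by
  rw [symbol_of_mem h, symbol_of_mem ((F i).smul_mem c h), ← map_smul]
  rfl

lemma symbol_sub {i : ℤ × ℤ} {q q' : Q} (h : q ∈ F i) (h' : q' ∈ F i) :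
    symbol F i (q - q') = symbol F i q - symbol F i q' := by
  have h1 : q - q' = q + (-1 : K) • q' := by module
  rw [h1, symbol_add h ((F i).smul_mem _ h'), symbol_smul h']
  module

lemma symbol_zero (i : ℤ × ℤ) : symbol F i 0 = 0 :=
  (symbol_eq_zero_iff (zero_mem _)).2 (zero_mem _)

variable (F) in
/-- The homogeneous parts of the associated graded module. -/
def homPart (i : ℤ × ℤ) : Submodule K (BiGraded F) :=
  LinearMap.range (BiGraded.incl F i)

lemma mem_homPart {i : ℤ × ℤ} {b : BiGraded F} :
    b ∈ homPart F i ↔ ∃ q ∈ F i, symbol F i q = b := by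
  constructor
  · rintro ⟨a, rfl⟩
    obtain ⟨⟨q, hq⟩, rfl⟩ := Submodule.Quotient.mk_surjective _ a
    exact ⟨q, hq, symbol_of_mem hq⟩
  · rintro ⟨q, hq, rfl⟩
    rw [symbol_of_mem hq]
    exact ⟨_, rfl⟩

lemma BiGraded.induction {P : BiGraded F → Prop} (b : BiGraded F)
    (hsym : ∀ i, ∀ q ∈ F i, P (symbol F i q)) (hadd : ∀ a b, P a → P b → P (a + b)) : P b := by
  induction b using BiGraded.incl_induction with
  | hzero => rw [← symbol_zero (F := F) 0]; exact hsym _ _ (zero_mem _)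
  | hincl i x =>
    obtain ⟨⟨q, hq⟩, rfl⟩ := Submodule.Quotient.mk_surjective _ x
    have := hsym i q hq
    rwa [symbol_of_mem hq] at this
  | hadd a b ha hb => exact hadd a b ha hb

lemma BiGraded.hom_ext {N : Type*} [AddCommGroup N] [Module K N] {A A' : BiGraded F →ₗ[K] N}
    (h : ∀ i, ∀ q ∈ F i, A (symbol F i q) = A' (symbol F i q)) : A = A' :=
  LinearMap.ext fun b => by
    induction b using BiGraded.induction with
    | hsym i q hq => exact h i q hq
    | hadd a b ha hb => rw [map_add, map_add, ha, hb]

/-- The homogeneous endomorphism of the associated graded module induced by a filtered map. -/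
def gradedMap (A : Q →ₗ[K] Q) (s : ℤ × ℤ) (hA : ∀ i, ∀ q ∈ F i, A q ∈ F (i + s)) :
    Module.End K (BiGraded F) :=
  BiGraded.lift fun i => BiGraded.incl F (i + s) ∘ₗ
      Submodule.mapQ _ _ (A.restrict (hA i)) (fun x hx => by
        have := hA _ _ hx
        rwa [sub_add_eq_add_sub] at this)

lemma gradedMap_symbol {A : Q →ₗ[K] Q} {s : ℤ × ℤ} (hA : ∀ i, ∀ q ∈ F i, A q ∈ F (i + s))
    {i : ℤ × ℤ} {q : Q} (hq : q ∈ F i) :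
    gradedMap A s hA (symbol F i q) = symbol F (i + s) (A q) := by
  rw [symbol_of_mem hq, symbol_of_mem (hA i q hq), gradedMap, BiGraded.lift_incl]
  rfl

lemma gradedMap_mem_homPart {A : Q →ₗ[K] Q} {s : ℤ × ℤ} (hA : ∀ i, ∀ q ∈ F i, A q ∈ F (i + s))
    {i : ℤ × ℤ} {b : BiGraded F} (hb : b ∈ homPart F i) :
    gradedMap A s hA b ∈ homPart F (i + s) := by
  obtain ⟨q, hq, rfl⟩ := mem_homPart.1 hb
  rw [gradedMap_symbol hA hq]
  exact mem_homPart.2 ⟨_, hA i q hq, rfl⟩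

lemma gradedMap_pow_symbol {A : Q →ₗ[K] Q} {s : ℤ × ℤ}
    (hA : ∀ i, ∀ q ∈ F i, A q ∈ F (i + s)) {i : ℤ × ℤ} {q : Q} (hq : q ∈ F i) (n : ℕ) :
    (gradedMap A s hA ^ n) (symbol F i q) ∈ homPart F (i + n • s) := by
  induction n with
  | zero => simpa using mem_homPart.2 ⟨q, hq, rfl⟩
  | succ n ih =>
    rw [pow_succ', Module.End.mul_apply, succ_nsmul, ← add_assoc]
    exact gradedMap_mem_homPart hA ih

lemma gradedMap_locally_nilpotent (hF : ∀ i : ℤ × ℤ, i.1 < 0 → F i = ⊥) {A : Q →ₗ[K] Q}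
    {s : ℤ × ℤ} (hA : ∀ i, ∀ q ∈ F i, A q ∈ F (i + s)) (hs : s.1 < 0) (b : BiGraded F) :
    ∃ n : ℕ, (gradedMap A s hA ^ n) b = 0 := by
  induction b using BiGraded.induction with
  | hsym i q hq =>
    refine ⟨i.1.toNat + 1, ?_⟩
    obtain ⟨q', hq', h'⟩ := mem_homPart.1 (gradedMap_pow_symbol hA hq (i.1.toNat + 1))
    rw [hF, Submodule.mem_bot] at hq'
    · rw [← h', hq', symbol_zero]
    · have h1 : (i + (i.1.toNat + 1) • s).1 = i.1 + (i.1.toNat + 1) * s.1 := by simp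
      rw [h1]
      have := Int.self_le_toNat i.1
      nlinarith
  | hadd a b ha hb =>
    obtain ⟨n, hn⟩ := ha
    obtain ⟨n', hn'⟩ := hb
    refine ⟨n + n', ?_⟩
    rw [map_add, pow_add, Module.End.mul_apply, Module.End.mul_apply, hn', map_zero, add_zero,
      ← Module.End.mul_apply, ← pow_add, add_comm, pow_add, Module.End.mul_apply, hn, map_zero]

/-- Exact common zeros of filtered operators lift common zeros of their graded maps. -/
lemma exists_lift_of_triangular [CharZero K] (hF : ∀ i : ℤ × ℤ, i.1 < 0 → F i = ⊥)
    (hmono : ∀ i, F (i - (1, 0)) ≤ F i)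
    {r : ℕ} {s : Fin r → ℤ × ℤ} {A : Fin r → Q →ₗ[K] Q}
    (hA : ∀ k, ∀ i, ∀ q ∈ F i, A k q ∈ F (i + -s k)) {Y : Fin r → Module.End K (BiGraded F)}
    (T : TriangularHeisenberg (B := BiGraded F) (homPart F) s (fun k => gradedMap (A k) (-s k) (hA k)) Y)
    (hAA : ∀ k q, (∀ j < k, A j q = 0) → ∀ j < k, A j (A k q) = 0)
    {i : ℤ × ℤ} {q : Q} (hq : q ∈ F i)
    (hinv : ∀ k, gradedMap (A k) (-s k) (hA k) (symbol F i q) = 0) :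
    ∃ q' ∈ F i, (∀ k, A k q' = 0) ∧ symbol F i q' = symbol F i q := by
  have key : ∀ n : ℕ, ∀ i, ∀ q ∈ F i, (∀ k : Fin r, k.val < n →
      gradedMap (A k) (-s k) (hA k) (symbol F i q) = 0) →
      ∃ q' ∈ F i, (∀ k : Fin r, k.val < n → A k q' = 0) ∧ symbol F i q' = symbol F i q := by
    intro n
    induction n with
    | zero => exact fun i q hq _ => ⟨q, hq, by simp, rfl⟩
    | succ n ih =>
      intro i q hq hinv
      by_cases hn : n < r
      swap
      · obtain ⟨q', h1, h2, h3⟩ := ih i q hq fun k hk => hinv k (by omega)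
        exact ⟨q', h1, fun k _ => h2 k (by omega), h3⟩
      set κ : Fin r := ⟨n, hn⟩ with hκ
      -- A κ maps the common kernel of the earlier operators onto itself, with control of degrees:
      -- solve on symbols, lift the solution by the outer induction, and correct the error of
      -- smaller degree by the inner one.
      have surj : ∀ N : ℕ, ∀ j : ℤ × ℤ, j.1 < N → ∀ q ∈ F j, (∀ k < κ, A k q = 0) →
          ∃ q' ∈ F (j + s κ), (∀ k < κ, A k q' = 0) ∧ A κ q' = q := by
        intro N
        induction N with
        | zero =>
          intro j hj q hq _
          rw [hF j hj, Submodule.mem_bot] at hq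
          exact ⟨0, zero_mem _, by simp, by simp [hq]⟩
        | succ N ihN =>
          intro j hj q hq hqinv
          obtain ⟨d, hd1, hd2, hd3⟩ := T.exists_antiderivative κ (b := symbol F j q)
            (fun k hk => by rw [gradedMap_symbol (hA k) hq, hqinv k hk, symbol_zero])
          obtain ⟨q1, hq1, hq1'⟩ := mem_homPart.1
            (T.Y_mem κ _ _ (hd3 j (mem_homPart.2 ⟨q, hq, rfl⟩)))
          obtain ⟨q2, hq2, hq2inv, hq2'⟩ := ih _ q1 hq1 fun k hk => by
            rw [hq1']; exact T.Y_inv (j := k) (k := κ) hk (hd2 k hk)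
          have h3 : A κ q2 ∈ F j := by simpa using hA κ _ _ hq2
          have h4 : A κ q2 - q ∈ F (j - (1, 0)) := by
            rw [← symbol_eq_zero_iff (sub_mem h3 hq), symbol_sub h3 hq, sub_eq_zero]
            have h5 := gradedMap_symbol (hA κ) hq2
            rw [hq2', hq1', hd1, add_neg_cancel_right] at h5
            exact h5.symm
          obtain ⟨q3, hq3, hq3inv, hq3'⟩ := ihN (j - (1, 0)) (by simp; omega) _ h4 fun k hk => by
            rw [map_sub, hqinv k hk, hAA κ q2 (fun k hk => hq2inv k hk) k hk, sub_zero]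
          have h6 : q3 ∈ F (j + s κ) := by
            rw [sub_add_eq_add_sub] at hq3
            exact hmono _ hq3
          refine ⟨q2 - q3, sub_mem hq2 h6, fun k hk => ?_, ?_⟩
          · rw [map_sub, hq2inv k hk, hq3inv k hk, sub_zero]
          · rw [map_sub, hq3', sub_sub_cancel]
      obtain ⟨q1, hq1, hq1inv, hq1'⟩ := ih i q hq fun k hk => hinv k (by omega)
      -- As the graded operator kills the symbol, A κ q1 drops one extra degree. It then has a
      -- preimage of degree below i, whose subtraction leaves the symbol of q1 unchanged.
      have h1 : A κ q1 ∈ F (i - s κ - (1, 0)) := by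
        have h2 := hinv κ (by simp [hκ])
        rw [← hq1', gradedMap_symbol (hA κ) hq1, symbol_eq_zero_iff (hA κ _ _ hq1)] at h2
        simpa [sub_eq_add_neg] using h2
      obtain ⟨q2, hq2, hq2inv, hq2'⟩ := surj ((i - s κ - (1, 0)).1.toNat + 1) _ (by
        have := Int.self_le_toNat (i - s κ - (1, 0)).1
        push_cast; omega) _ h1 (hAA κ q1 fun k hk => hq1inv k hk)
      have hq2i : q2 ∈ F (i - (1, 0)) := by
        rwa [sub_right_comm, sub_add_cancel] at hq2
      refine ⟨q1 - q2, sub_mem hq1 (hmono _ hq2i), fun k hk => ?_, ?_⟩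
      · rcases Nat.lt_succ_iff_lt_or_eq.1 hk with hk | hk
        · rw [map_sub, hq1inv k hk, hq2inv k hk, sub_zero]
        · obtain rfl : k = κ := Fin.ext hk
          rw [map_sub, hq2', sub_self]
      · rw [symbol_sub hq1 (hmono _ hq2i), (symbol_eq_zero_iff (hmono _ hq2i)).2 hq2i, sub_zero,
          hq1']
  obtain ⟨q', h1, h2, h3⟩ := key r i q hq fun k _ => hinv k
  exact ⟨q', h1, fun k => h2 k k.2, h3⟩

end Filtered


/-! ### The module U/U m_χ and its Kazhdan filtration. -/

noncomputable section

namespace WDatum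

open Module LieAlgebra

variable {K : Type*} {g : Type*} [Field K] [LieRing g] [LieAlgebra K g] (D : WDatum K g)

/-- The left `U`-module `U / U m_χ`. -/
abbrev Whittaker : Type _ := UniversalEnvelopingAlgebra K g ⧸ D.leftIdeal

/-- The image of `1` in `U / U m_χ`. -/
def vac : D.Whittaker := Submodule.Quotient.mk 1

/-- The action of `U` on `U / U m_χ` by `K`-linear maps. -/
def act : UniversalEnvelopingAlgebra K g →ₐ[K] Module.End K D.Whittaker :=
  Algebra.lsmul K K D.Whittaker

/-- The Kazhdan degree and `θ`-weight of an element of `bigr s`. -/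
def kdeg (s : ℤ × ℤ) : ℤ × ℤ := s + (2, 0)

/-- The Kazhdan filtration of `U / U m_χ`, refined by the weights of `ad θ`. -/
def fil (i : ℤ × ℤ) : Submodule K D.Whittaker :=
  Submodule.span K {q | ∃ L : List ((ℤ × ℤ) × g), (∀ p ∈ L, p.2 ∈ D.bigr p.1) ∧
    (L.map fun p => p.1.1 + 2).sum ≤ i.1 ∧ (L.map fun p => p.1.2).sum = i.2 ∧
    q = D.act (L.map fun p => D.ιU p.2).prod D.vac}

variable {D}

lemma act_mk (u v : UniversalEnvelopingAlgebra K g) :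
    D.act u (Submodule.Quotient.mk v) = Submodule.Quotient.mk (u * v) := rfl

lemma act_vac (u : UniversalEnvelopingAlgebra K g) :
    D.act u D.vac = Submodule.Quotient.mk u := by
  rw [vac, act_mk, mul_one]

lemma ιU_lie (x y : g) : D.ιU ⁅x, y⁆ = D.ιU x * D.ιU y - D.ιU y * D.ιU x := by
  let _ : LieRing (UniversalEnvelopingAlgebra K g) := LieRing.ofAssociativeRing
  exact LieHom.map_lie (UniversalEnvelopingAlgebra.ι K) x y

lemma act_lie (x y : g) (q : D.Whittaker) : D.act (D.ιU ⁅x, y⁆) q =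
    D.act (D.ιU x) (D.act (D.ιU y) q) - D.act (D.ιU y) (D.act (D.ιU x) q) := by
  rw [ιU_lie, map_sub, map_mul, map_mul]; rfl

lemma fil_mono {i j : ℤ × ℤ} (h1 : i.1 ≤ j.1) (h2 : i.2 = j.2) : D.fil i ≤ D.fil j := by
  refine Submodule.span_mono ?_
  rintro q ⟨L, h3, h4, h5, rfl⟩
  exact ⟨L, h3, h4.trans h1, h5.trans h2, rfl⟩

lemma fil_sub_le (i : ℤ × ℤ) : D.fil (i - (1, 0)) ≤ D.fil i := fil_mono (by simp) (by simp)

lemma vac_mem_fil {i : ℤ × ℤ} (h1 : 0 ≤ i.1) (h2 : i.2 = 0) : D.vac ∈ D.fil i :=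
  Submodule.subset_span ⟨[], by simp, by simpa using h1, by simp [h2], by simp⟩

lemma act_mem_fil {s i : ℤ × ℤ} {x : g} (hx : x ∈ D.bigr s) {q : D.Whittaker} (hq : q ∈ D.fil i) :
    D.act (D.ιU x) q ∈ D.fil (i + kdeg s) := by
  unfold fil at hq
  induction hq using Submodule.span_induction with
  | mem q hq =>
    obtain ⟨L, h1, h2, h3, rfl⟩ := hq
    refine Submodule.subset_span ⟨(s, x) :: L, ?_, ?_, ?_, ?_⟩
    · simpa using ⟨hx, fun a b c h => h1 ((a, b), c) h⟩
    · rw [List.map_cons, List.sum_cons]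
      change s.1 + 2 + _ ≤ i.1 + (s.1 + 2)
      linarith
    · rw [List.map_cons, List.sum_cons, h3]
      change s.2 + i.2 = i.2 + (s.2 + 0)
      ring
    · simp
  | zero => rw [map_zero]; exact zero_mem _
  | add a b _ _ ha hb => rw [map_add]; exact add_mem ha hb
  | smul c a _ ha => rw [map_smul]; exact Submodule.smul_mem _ _ ha

/-- The induction principle for the filtration: everything is built from the vacuum by the action of
homogeneous elements of g. -/
lemma fil_le {G : ℤ × ℤ → Submodule K D.Whittaker}
    (hvac : ∀ i : ℤ × ℤ, 0 ≤ i.1 → i.2 = 0 → D.vac ∈ G i)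
    (hact : ∀ s, ∀ x ∈ D.bigr s, ∀ i, ∀ q ∈ D.fil i, q ∈ G i →
      D.act (D.ιU x) q ∈ G (i + kdeg s)) (i : ℤ × ℤ) : D.fil i ≤ G i := by
  have hlist : ∀ (L : List ((ℤ × ℤ) × g)) (i : ℤ × ℤ), (∀ p ∈ L, p.2 ∈ D.bigr p.1) →
      (L.map fun p => p.1.1 + 2).sum ≤ i.1 → (L.map fun p => p.1.2).sum = i.2 →
      D.act (L.map fun p => D.ιU p.2).prod D.vac ∈ G i := by
    intro L
    induction L with
    | nil => intro i _ h2 h3; simpa using hvac i (by simpa using h2) (by simpa using h3.symm)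
    | cons p L ih =>
      intro i h1 h2 h3
      rw [List.map_cons, List.sum_cons] at h2 h3
      have h1' : ∀ p ∈ L, p.2 ∈ D.bigr p.1 := fun p hp => h1 p (List.mem_cons_of_mem _ hp)
      have h2' : (L.map fun p => p.1.1 + 2).sum ≤ (i - kdeg p.1).1 := by
        change _ ≤ i.1 - (p.1.1 + 2); linarith
      have h3' : (L.map fun p => p.1.2).sum = (i - kdeg p.1).2 := by
        change _ = i.2 - (p.1.2 + 0); linarith
      have := hact p.1 p.2 (h1 p List.mem_cons_self) (i - kdeg p.1) _
        (Submodule.subset_span ⟨L, h1', h2', h3', rfl⟩) (ih _ h1' h2' h3')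
      rw [sub_add_cancel] at this
      simpa using this
  refine Submodule.span_le.2 ?_
  rintro q ⟨L, h1, h2, h3, rfl⟩
  exact hlist L i h1 h2 h3

variable (D) in
/-- The map `g → U`. -/
def ιLin : g →ₗ[K] UniversalEnvelopingAlgebra K g :=
  let _ : LieRing (UniversalEnvelopingAlgebra K g) := LieRing.ofAssociativeRing
  (UniversalEnvelopingAlgebra.ι K : g →ₗ⁅K⁆ UniversalEnvelopingAlgebra K g)

variable (D) in
/-- The operators `q ↦ (ξ - χ(ξ)) q` on `U / U m_χ`, for `ξ ∈ m` the adjoint action. -/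
def adm : g →ₗ[K] Module.End K D.Whittaker :=
  D.act.toLinearMap ∘ₗ ιLin - D.χ.smulRight 1

lemma adm_apply (ξ : g) (q : D.Whittaker) : D.adm ξ q = D.act (D.ιU ξ) q - D.χ ξ • q := rfl

lemma adm_vac {ξ : g} (hξ : ξ ∈ D.m) : D.adm ξ D.vac = 0 := by
  have h1 : D.adm ξ D.vac =
      (Submodule.Quotient.mk (D.ιU ξ - algebraMap K _ (D.χ ξ)) : D.Whittaker) := by
    rw [adm_apply, act_vac, vac, Algebra.algebraMap_eq_smul_one]; rfl
  rw [h1, Submodule.Quotient.mk_eq_zero]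
  exact Ideal.subset_span ⟨ξ, hξ, rfl⟩

lemma adm_act (ξ x : g) (q : D.Whittaker) :
    D.adm ξ (D.act (D.ιU x) q) = D.act (D.ιU x) (D.adm ξ q) + D.act (D.ιU ⁅ξ, x⁆) q := by
  rw [adm_apply, adm_apply, act_lie, map_sub, map_smul]; abel

lemma adm_lie (ξ η : g) (h : D.χ ⁅ξ, η⁆ = 0) (q : D.Whittaker) :
    D.adm ξ (D.adm η q) = D.adm η (D.adm ξ q) + D.adm ⁅ξ, η⁆ q := by
  rw [adm_apply η, map_sub, adm_act, map_smul, adm_apply ⁅ξ, η⁆, h, zero_smul, sub_zero,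
    adm_apply η]
  abel

/-- ξ - χ(ξ) kills the vacuum and passes through x at the cost of [ξ, x]. It therefore has degree s,
two less than the degree `kdeg s` of multiplication by ξ. -/
lemma adm_mem_fil {s i : ℤ × ℤ} {ξ : g} (hξ : ξ ∈ D.m) (hs : ξ ∈ D.bigr s) {q : D.Whittaker}
    (hq : q ∈ D.fil i) : D.adm ξ q ∈ D.fil (i + s) := by
  refine fil_le (G := fun i => (D.fil (i + s)).comap (D.adm ξ)) ?_ ?_ i hq
  · intro i _ _; rw [Submodule.mem_comap, adm_vac hξ]; exact zero_mem _
  · intro t x hx i q hq h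
    rw [Submodule.mem_comap] at h ⊢
    rw [adm_act, add_right_comm]
    refine add_mem (act_mem_fil hx h) ?_
    have := act_mem_fil (lie_mem_bigr hs hx) hq
    have e : i + kdeg (s + t) = i + s + kdeg t := by rw [kdeg, kdeg]; abel
    rwa [e] at this

variable (D) in
/-- The span of the products of at most `r` elements of degree `≥ -1` of `g`, of total Kazhdan
degree at most `n`. -/
def reducedFil (r : ℕ) (n : ℤ) : Submodule K D.Whittaker :=
  Submodule.span K {q | ∃ L : List (ℤ × g), (∀ p ∈ L, p.2 ∈ D.gr p.1 ∧ -1 ≤ p.1) ∧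
    L.length ≤ r ∧ (L.map fun p => p.1 + 2).sum ≤ n ∧
    q = D.act (L.map fun p => D.ιU p.2).prod D.vac}

lemma reducedFil_mono {r r' : ℕ} {n n' : ℤ} (hr : r ≤ r') (hn : n ≤ n') :
    D.reducedFil r n ≤ D.reducedFil r' n' := by
  refine Submodule.span_mono ?_
  rintro q ⟨L, h1, h2, h3, rfl⟩
  exact ⟨L, h1, h2.trans hr, h3.trans hn, rfl⟩

lemma reducedFil_eq_bot {r : ℕ} {n : ℤ} (hn : n < 0) : D.reducedFil r n = ⊥ := by
  rw [reducedFil, Submodule.span_eq_bot]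
  rintro q ⟨L, h1, h2, h3, rfl⟩
  have : 0 ≤ (L.map fun p => p.1 + 2).sum := by
    refine List.sum_nonneg ?_
    simp only [List.mem_map]
    rintro _ ⟨p, hp, rfl⟩
    have := (h1 p hp).2
    omega
  omega

lemma act_mem_reducedFil_of_neg_one_le {a : ℤ} (ha : -1 ≤ a) {x : g} (hx : x ∈ D.gr a) {r : ℕ}
    {n : ℤ} {q : D.Whittaker} (hq : q ∈ D.reducedFil r n) :
    D.act (D.ιU x) q ∈ D.reducedFil (r + 1) (n + (a + 2)) := by
  unfold reducedFil at hq
  induction hq using Submodule.span_induction with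
  | mem q hq =>
    obtain ⟨L, h1, h2, h3, rfl⟩ := hq
    refine Submodule.subset_span ⟨(a, x) :: L, ?_, ?_, ?_, ?_⟩
    · simpa using ⟨⟨hx, ha⟩, fun b c h => h1 (b, c) h⟩
    · simpa using h2
    · rw [List.map_cons, List.sum_cons]; linarith
    · simp
  | zero => rw [map_zero]; exact zero_mem _
  | add a b _ _ ha hb => rw [map_add]; exact add_mem ha hb
  | smul c a _ ha => rw [map_smul]; exact Submodule.smul_mem _ _ ha

section

variable [CharZero K]

/-- A factor of degree at most -2 is moved to the right until it meets the vacuum, where it acts by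
χ, a scalar nonzero only in Kazhdan degree 0. Each commutator replaces two factors by one, which
allows induction on the length. -/
lemma act_mem_reducedFil {a : ℤ} {x : g} (hx : x ∈ D.gr a) {r : ℕ}
    {n : ℤ} {q : D.Whittaker} (hq : q ∈ D.reducedFil r n) :
    D.act (D.ιU x) q ∈ D.reducedFil (r + 1) (n + (a + 2)) := by
  by_cases ha : -1 ≤ a
  · exact act_mem_reducedFil_of_neg_one_le ha hx hq
  have hvac : ∀ r : ℕ, ∀ n : ℤ, 0 ≤ n → ∀ a : ℤ, ¬ -1 ≤ a → ∀ x ∈ D.gr a,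
      D.act (D.ιU x) D.vac ∈ D.reducedFil r (n + (a + 2)) := by
    intro r n hn a ha x hx
    have h1 := adm_vac (mem_m_of_gr (by omega) hx)
    rw [adm_apply, sub_eq_zero] at h1
    rw [h1]
    by_cases h2 : a = -2
    · exact Submodule.smul_mem _ _
        (Submodule.subset_span ⟨[], by simp, by simp, by simp; omega, by simp⟩)
    · rw [χ_eq_zero_of_gr h2 hx, zero_smul]; exact zero_mem _
  unfold reducedFil at hq
  induction hq using Submodule.span_induction with
  | mem q hq =>
    obtain ⟨L, h1, h2, h3, rfl⟩ := hq
    induction L generalizing r n a x with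
    | nil => simpa using hvac _ n (by simpa using h3) a ha x hx
    | cons p L ih =>
      obtain ⟨b, z⟩ := p
      have hz := h1 (b, z) List.mem_cons_self
      simp only at hz
      rw [List.map_cons, List.sum_cons] at h3
      have h1' : ∀ p ∈ L, p.2 ∈ D.gr p.1 ∧ -1 ≤ p.1 := fun p hp => h1 p (List.mem_cons_of_mem _ hp)
      obtain ⟨r, rfl⟩ : ∃ r', r = r' + 1 := ⟨r - 1, by simp at h2; omega⟩
      have h2' : L.length ≤ r := by simpa using h2
      set q := D.act (L.map fun p => D.ιU p.2).prod D.vac with hq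
      have e1 : D.act (((b, z) :: L).map fun p => D.ιU p.2).prod D.vac = D.act (D.ιU z) q := by
        simp [hq]
      have hqmem : q ∈ D.reducedFil r (n - (b + 2)) :=
        Submodule.subset_span ⟨L, h1', h2', by simp only at h3; linarith, rfl⟩
      have e2 : D.act (D.ιU x) (D.act (D.ιU z) q) =
          D.act (D.ιU z) (D.act (D.ιU x) q) + D.act (D.ιU ⁅x, z⁆) q := by
        rw [act_lie]; abel
      rw [e1, e2]
      refine add_mem ?_ ?_
      · have h4 := ih (n := n - (b + 2)) (a := a) (x := x) hx ha h1' h2'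
          (by simp only at h3; linarith)
        have h5 := act_mem_reducedFil_of_neg_one_le hz.2 hz.1 h4
        exact reducedFil_mono le_rfl (by linarith) h5
      · by_cases hab : -1 ≤ a + b
        · exact reducedFil_mono (by omega) (by linarith)
            (act_mem_reducedFil_of_neg_one_le hab (lie_mem_gr hx hz.1) hqmem)
        · exact reducedFil_mono (by omega) (by linarith)
            (ih (n := n - (b + 2)) (a := a + b) (x := ⁅x, z⁆) (lie_mem_gr hx hz.1) hab h1' h2'
              (by simp only at h3; linarith))
  | zero => rw [map_zero]; exact zero_mem _
  | add a b _ _ ha hb => rw [map_add]; exact add_mem ha hb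
  | smul c a _ ha => rw [map_smul]; exact Submodule.smul_mem _ _ ha

/-- After straightening, only factors of ad h-degree at least -1 remain, and these have positive
Kazhdan degree. -/
lemma fil_eq_bot {i : ℤ × ℤ} (hi : i.1 < 0) : D.fil i = ⊥ := by
  have hmono : ∀ n, Monotone fun r => D.reducedFil r n := fun n r r' h => reducedFil_mono h le_rfl
  have h1 := fil_le (D := D) (G := fun i => ⨆ r, D.reducedFil r i.1) ?_ ?_ i
  · rw [eq_bot_iff]
    refine h1.trans (iSup_le fun r => (reducedFil_eq_bot hi).le)
  · intro i hi _
    exact Submodule.mem_iSup_of_mem 0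
      (Submodule.subset_span ⟨[], by simp, by simp, by simpa using hi, by simp⟩)
  · intro s x hx i q _ hq
    rw [Submodule.mem_iSup_of_directed _ (hmono _).directed_le] at hq ⊢
    obtain ⟨r, hr⟩ := hq
    exact ⟨r + 1, act_mem_reducedFil hx.1 hr⟩

end

end WDatum

end


/-! ### The triangular Heisenberg family on gr (U/U m_χ). -/

noncomputable section

namespace WDatum

open Module LieAlgebra

variable {K : Type*} {g : Type*} [Field K] [LieRing g] [LieAlgebra K g]

/-- Bases of `g` and of `m` consisting of joint eigenvectors, and a family dual to the basis of
`m`. -/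
structure Frame (D : WDatum K g) where
  n : ℕ
  b : Basis (Fin n) K g
  wt : Fin n → ℤ × ℤ
  b_mem : ∀ k, b k ∈ D.bigr (wt k)
  r : ℕ
  ξ : Fin r → g
  y : Fin r → g
  s : Fin r → ℤ × ℤ
  ξ_mem : ∀ k, ξ k ∈ D.bigr (-s k)
  span_ξ : Submodule.span K (Set.range ξ) = D.m
  s_pos : ∀ k, 0 < (s k).1
  s_anti : Antitone fun k => (s k).1
  y_mem : ∀ k, y k ∈ D.bigr ((-2, 0) + s k)
  pair : ∀ j k, D.χ ⁅ξ j, y k⁆ = if j = k then 1 else 0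
  range_le : LinearMap.range (ad K g D.f) ≤ D.m ⊔ Submodule.span K (Set.range y)

variable {D : WDatum K g}

/-- The basis of m is listed with the most negative degrees first; s records the opposite bidegrees,
whose first coordinates are therefore positive and non-increasing. -/
lemma nonempty_frame [CharZero K] [IsAlgClosed K] [FiniteDimensional K g] : Nonempty D.Frame := by
  obtain ⟨n, b, wt, hb1, hb2, hb3, -⟩ := (stable_top (D := D)).exists_basis
  obtain ⟨r, ξ, s, h1, h2, h3, h4⟩ := (stable_m (D := D)).exists_basis
  obtain ⟨y, hy2, hy3, hy4⟩ := exists_dual_family h1 h2 h3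
  refine ⟨⟨n, Basis.mk hb1 hb2.ge, wt, fun k => by simpa using hb3 k, r, ξ, y, fun k => -s k,
    fun k => by simpa using h3 k, h2, fun k => ?_, fun j k hjk => neg_le_neg (h4 hjk),
    fun k => by simpa [sub_eq_add_neg] using hy2 k, hy3, hy4⟩⟩
  have := neg_of_mem_m (h2 ▸ Submodule.subset_span ⟨k, rfl⟩) (h3 k).1 (h1.ne_zero k)
  change 0 < -(s k).1
  omega

lemma homogeneous_induction [CharZero K] [IsAlgClosed K] [FiniteDimensional K g]
    {p : Submodule K g} (hp : D.Stable p) {P : g → Prop} (hom : ∀ t, ∀ x ∈ p, x ∈ D.bigr t → P x)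
    (add : ∀ x y, P x → P y → P (x + y)) {x : g} (hx : x ∈ p) : P x := by
  obtain ⟨c, hc, rfl⟩ := (Submodule.mem_iSup_iff_exists_finsupp _ _).1 (hp.le_iSup hx)
  exact Finset.sum_induction _ P add (hom 0 0 (zero_mem _) (zero_mem _))
    fun t _ => hom t _ (hc t).1 (hc t).2

namespace Frame

variable (Φ : D.Frame)

/-- The commuting operators on `gr (U / U m_χ)` given by multiplication by the elements of `g`. -/
def ρ : g →ₗ[K] Module.End K (BiGraded D.fil) :=
  Φ.b.constr K fun k => gradedMap (D.act (D.ιU (Φ.b k))) (kdeg (Φ.wt k))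
    fun _ _ hq => act_mem_fil (Φ.b_mem k) hq

lemma ξ_mem_m (k : Fin Φ.r) : Φ.ξ k ∈ D.m := Φ.span_ξ ▸ Submodule.subset_span ⟨k, rfl⟩

/-- The adjoint action of the basis of `m` on `gr (U / U m_χ)`. -/
def X (k : Fin Φ.r) : Module.End K (BiGraded D.fil) :=
  gradedMap (D.adm (Φ.ξ k)) (-Φ.s k) fun _ _ hq => adm_mem_fil (Φ.ξ_mem_m k) (Φ.ξ_mem k) hq

/-- Multiplication on `gr (U / U m_χ)` by the dual family. -/
def Y (k : Fin Φ.r) : Module.End K (BiGraded D.fil) := Φ.ρ (Φ.y k)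

lemma X_symbol (k : Fin Φ.r) {i : ℤ × ℤ} {q : D.Whittaker} (hq : q ∈ D.fil i) :
    Φ.X k (symbol D.fil i q) = symbol D.fil (i + -Φ.s k) (D.adm (Φ.ξ k) q) :=
  gradedMap_symbol _ hq

variable [CharZero K]

/-- ρ is prescribed on a basis to make it linear on all of g. A homogeneous x involves only basis
vectors of its own bidegree, so ρ x is still the graded map of multiplication by x. -/
lemma ρ_symbol {t : ℤ × ℤ} {x : g} (hx : x ∈ D.bigr t) {i : ℤ × ℤ} {q : D.Whittaker}
    (hq : q ∈ D.fil i) :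
    Φ.ρ x (symbol D.fil i q) = symbol D.fil (i + kdeg t) (D.act (D.ιU x) q) := by
  have h1 : x ∈ Submodule.span K (Φ.b '' {k | Φ.wt k = t}) :=
    mem_span_of_mem_bigr Φ.b_mem (by rw [Φ.b.span_eq]; trivial) hx
  have h2 : ∀ z ∈ Submodule.span K (Φ.b '' {k | Φ.wt k = t}),
      D.act (ιLin z) q ∈ D.fil (i + kdeg t) ∧
      Φ.ρ z (symbol D.fil i q) = symbol D.fil (i + kdeg t) (D.act (ιLin z) q) := by
    intro z hz
    induction hz using Submodule.span_induction with
    | mem z hz =>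
      obtain ⟨k, rfl, rfl⟩ := hz
      refine ⟨act_mem_fil (Φ.b_mem k) hq, ?_⟩
      rw [ρ, Basis.constr_basis, gradedMap_symbol _ hq]; rfl
    | zero => simp [symbol_zero]
    | add a b _ _ ha hb =>
      rw [map_add, map_add, map_add, LinearMap.add_apply, LinearMap.add_apply, ha.2, hb.2,
        symbol_add ha.1 hb.1]
      exact ⟨add_mem ha.1 hb.1, rfl⟩
    | smul c a _ ha =>
      rw [map_smul, map_smul, map_smul, LinearMap.smul_apply, LinearMap.smul_apply, ha.2,
        symbol_smul ha.1]
      exact ⟨Submodule.smul_mem _ _ ha.1, rfl⟩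
  exact (h2 x h1).2

lemma ρ_mem_homPart {t : ℤ × ℤ} {x : g} (hx : x ∈ D.bigr t) {i : ℤ × ℤ} {b : BiGraded D.fil}
    (hb : b ∈ homPart D.fil i) : Φ.ρ x b ∈ homPart D.fil (i + kdeg t) := by
  obtain ⟨q, hq, rfl⟩ := mem_homPart.1 hb
  rw [Φ.ρ_symbol hx hq]
  exact mem_homPart.2 ⟨_, act_mem_fil hx hq, rfl⟩

variable [IsAlgClosed K] [FiniteDimensional K g]

/-- The commutator acts by [x, x'], whose Kazhdan degree is 2 less than the sum of the degrees of x
and x'. -/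
lemma ρ_comm (x x' : g) : Φ.ρ x * Φ.ρ x' = Φ.ρ x' * Φ.ρ x := by
  refine homogeneous_induction (P := fun x => Φ.ρ x * Φ.ρ x' = Φ.ρ x' * Φ.ρ x)
    (stable_top (D := D)) (fun t x _ hx => ?_)
    (fun a b ha hb => by rw [map_add, add_mul, mul_add, ha, hb]) (x := x) trivial
  refine homogeneous_induction (P := fun x' => Φ.ρ x * Φ.ρ x' = Φ.ρ x' * Φ.ρ x)
    (stable_top (D := D)) (fun t' x' _ hx' => ?_)
    (fun a b ha hb => by rw [map_add, add_mul, mul_add, ha, hb]) (x := x') trivial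
  refine BiGraded.hom_ext fun i q hq => ?_
  have h1 := act_mem_fil hx (act_mem_fil hx' hq)
  have h2 := act_mem_fil hx' (act_mem_fil hx hq)
  rw [add_right_comm] at h2
  rw [Module.End.mul_apply, Module.End.mul_apply, Φ.ρ_symbol hx' hq, Φ.ρ_symbol hx hq,
    Φ.ρ_symbol hx (act_mem_fil hx' hq), Φ.ρ_symbol hx' (act_mem_fil hx hq),
    add_right_comm i (kdeg t), ← sub_eq_zero, ← symbol_sub h1 h2,
    symbol_eq_zero_iff (sub_mem h1 h2), ← act_lie]
  refine fil_mono ?_ ?_ (act_mem_fil (lie_mem_bigr hx hx') hq)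
  · simp [kdeg]; omega
  · simp [kdeg]; omega

/-- x - χ(x) has degree 2 less than multiplication by x (`adm_mem_fil`), so on gr only the scalar
remains. -/
lemma ρ_of_mem_m {x : g} (hx : x ∈ D.m) : Φ.ρ x = D.χ x • 1 := by
  refine homogeneous_induction (P := fun x => Φ.ρ x = D.χ x • 1) (stable_m (D := D)) (fun t x hxm hx => ?_)
    (fun a b ha hb => by rw [map_add, map_add, add_smul, ha, hb]) hx
  refine BiGraded.hom_ext fun i q hq => ?_
  rw [Φ.ρ_symbol hx hq, LinearMap.smul_apply, Module.End.one_apply]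
  have h1 := adm_mem_fil hxm hx hq
  have h3 := act_mem_fil hx hq
  by_cases ht : t = (-2, 0)
  · have e : i + kdeg t = i := by rw [ht]; ext <;> simp [kdeg]
    rw [e] at h3 ⊢
    rw [← symbol_smul hq, ← sub_eq_zero, ← symbol_sub h3 (Submodule.smul_mem _ _ hq),
      symbol_eq_zero_iff (sub_mem h3 (Submodule.smul_mem _ _ hq)), ← adm_apply]
    exact fil_mono (by simp [ht]) (by simp [ht]) h1
  · rw [χ_eq_zero ht hx, zero_smul, symbol_eq_zero_iff h3]
    rw [adm_apply, χ_eq_zero ht hx, zero_smul, sub_zero] at h1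
    exact fil_mono (by simp [kdeg]) (by simp [kdeg]) h1

lemma X_ρ (k : Fin Φ.r) (x : g) : Φ.X k * Φ.ρ x = Φ.ρ x * Φ.X k + Φ.ρ ⁅Φ.ξ k, x⁆ := by
  refine homogeneous_induction
    (P := fun x => Φ.X k * Φ.ρ x = Φ.ρ x * Φ.X k + Φ.ρ ⁅Φ.ξ k, x⁆)
    (stable_top (D := D)) (fun t x _ hx => ?_)
    (fun a b ha hb => by rw [lie_add, map_add, map_add, mul_add, add_mul, ha, hb]; abel)
    (x := x) trivial
  refine BiGraded.hom_ext fun i q hq => ?_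
  have h1 := adm_mem_fil (Φ.ξ_mem_m k) (Φ.ξ_mem k) hq
  have h2 := act_mem_fil hx h1
  have h3 := act_mem_fil (lie_mem_bigr (Φ.ξ_mem k) hx) hq
  have e1 : i + kdeg (-Φ.s k + t) = i + kdeg t + -Φ.s k := by rw [kdeg, kdeg]; abel
  rw [add_right_comm] at h2
  rw [e1] at h3
  rw [LinearMap.add_apply, Module.End.mul_apply, Module.End.mul_apply, Φ.ρ_symbol hx hq,
    Φ.X_symbol k hq, Φ.X_symbol k (act_mem_fil hx hq), Φ.ρ_symbol hx h1,
    Φ.ρ_symbol (lie_mem_bigr (Φ.ξ_mem k) hx) hq, adm_act, add_right_comm i (-Φ.s k) (kdeg t), e1,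
    symbol_add h2 h3]

omit [IsAlgClosed K] [FiniteDimensional K g] in
lemma lie_ξ_mem_span (j k : Fin Φ.r) :
    ⁅Φ.ξ j, Φ.ξ k⁆ ∈ Submodule.span K (Φ.ξ '' {i | -Φ.s i = -Φ.s j + -Φ.s k}) := by
  refine mem_span_of_mem_bigr Φ.ξ_mem ?_ (lie_mem_bigr (Φ.ξ_mem j) (Φ.ξ_mem k))
  rw [Φ.span_ξ]
  exact (lie_mem_m (Φ.ξ_mem_m j) (Φ.ξ_mem j).1 (Φ.ξ_mem_m k) (Φ.ξ_mem k).1).1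

omit [IsAlgClosed K] [FiniteDimensional K g] in
lemma χ_lie_ξ (j k : Fin Φ.r) : D.χ ⁅Φ.ξ j, Φ.ξ k⁆ = 0 :=
  (lie_mem_m (Φ.ξ_mem_m j) (Φ.ξ_mem j).1 (Φ.ξ_mem_m k) (Φ.ξ_mem k).1).2

-- A source of triangularity: brackets in m are strictly more negative than their factors, hence
-- involve only earlier basis vectors.
omit [CharZero K] [IsAlgClosed K] [FiniteDimensional K g] in
lemma lt_of_s_eq {i j k : Fin Φ.r} (h : -Φ.s i = -Φ.s j + -Φ.s k) : i < k := by
  by_contra hik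
  have h1 := Φ.s_anti (not_lt.1 hik)
  have h2 := congrArg Prod.fst h
  have h3 := Φ.s_pos j
  simp only [Prod.fst_neg, Prod.fst_add] at h1 h2
  omega

omit [IsAlgClosed K] [FiniteDimensional K g] in
lemma adm_adm (k : Fin Φ.r) {q : D.Whittaker} (hq : ∀ j < k, D.adm (Φ.ξ j) q = 0)
    (j : Fin Φ.r) (hj : j < k) : D.adm (Φ.ξ j) (D.adm (Φ.ξ k) q) = 0 := by
  rw [adm_lie _ _ (Φ.χ_lie_ξ j k), hq j hj, map_zero, zero_add]
  have h : Submodule.span K (Φ.ξ '' {i | -Φ.s i = -Φ.s j + -Φ.s k}) ≤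
      LinearMap.ker (D.adm.flip q) := by
    rw [Submodule.span_le]
    rintro _ ⟨i, hi, rfl⟩
    exact hq i (Φ.lt_of_s_eq hi)
  exact h (Φ.lie_ξ_mem_span j k)

-- The graded form of `adm_adm`: the commutator of X_j and X_k is a combination Z of operators X_l
-- with l < k, all of which kill b.
omit [IsAlgClosed K] [FiniteDimensional K g] in
lemma X_X (k : Fin Φ.r) {b : BiGraded D.fil} (hb : ∀ j < k, Φ.X j b = 0)
    (j : Fin Φ.r) (hj : j < k) : Φ.X j (Φ.X k b) = 0 := by
  have hspan : ∀ η ∈ Submodule.span K (Φ.ξ '' {i | -Φ.s i = -Φ.s j + -Φ.s k}),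
      ∃ Z : Module.End K (BiGraded D.fil), Z b = 0 ∧ ∀ i, ∀ q ∈ D.fil i,
        D.adm η q ∈ D.fil (i + (-Φ.s j + -Φ.s k)) ∧
        Z (symbol D.fil i q) = symbol D.fil (i + (-Φ.s j + -Φ.s k)) (D.adm η q) := by
    intro η hη
    induction hη using Submodule.span_induction with
    | mem z hz =>
      obtain ⟨l, hl, rfl⟩ := hz
      refine ⟨Φ.X l, hb l (Φ.lt_of_s_eq hl), fun i q hq => ?_⟩
      rw [← (show -Φ.s l = -Φ.s j + -Φ.s k from hl)]
      exact ⟨adm_mem_fil (Φ.ξ_mem_m l) (Φ.ξ_mem l) hq, Φ.X_symbol l hq⟩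
    | zero => exact ⟨0, rfl, fun i q _ => by simp [symbol_zero]⟩
    | add a c _ _ ha hc =>
      obtain ⟨Z, hZ, hZ'⟩ := ha
      obtain ⟨Z1, hZ1, hZ1'⟩ := hc
      refine ⟨Z + Z1, by rw [LinearMap.add_apply, hZ, hZ1, add_zero], fun i q hq => ?_⟩
      rw [map_add, LinearMap.add_apply, LinearMap.add_apply, (hZ' i q hq).2, (hZ1' i q hq).2,
        symbol_add (hZ' i q hq).1 (hZ1' i q hq).1]
      exact ⟨add_mem (hZ' i q hq).1 (hZ1' i q hq).1, rfl⟩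
    | smul c a _ ha =>
      obtain ⟨Z, hZ, hZ'⟩ := ha
      refine ⟨c • Z, by rw [LinearMap.smul_apply, hZ, smul_zero], fun i q hq => ?_⟩
      rw [map_smul, LinearMap.smul_apply, LinearMap.smul_apply, (hZ' i q hq).2,
        symbol_smul (hZ' i q hq).1]
      exact ⟨Submodule.smul_mem _ _ (hZ' i q hq).1, rfl⟩
  obtain ⟨Z, hZ, hZ'⟩ := hspan _ (Φ.lie_ξ_mem_span j k)
  have key : (Φ.X j * Φ.X k : Module.End K (BiGraded D.fil)) = Φ.X k * Φ.X j + Z := by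
    refine BiGraded.hom_ext fun i q hq => ?_
    have hm := fun l i q hq => adm_mem_fil (Φ.ξ_mem_m l) (Φ.ξ_mem l) (q := q) (i := i) hq
    have h1 := hm k _ _ (hm j i q hq)
    rw [add_assoc] at h1
    rw [LinearMap.add_apply, Module.End.mul_apply, Module.End.mul_apply, Φ.X_symbol k hq,
      Φ.X_symbol j hq, Φ.X_symbol j (hm k i q hq), Φ.X_symbol k (hm j i q hq), (hZ' i q hq).2,
      adm_lie _ _ (Φ.χ_lie_ξ j k), add_assoc, add_assoc, add_comm (-Φ.s k),
      symbol_add h1 (hZ' i q hq).1]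
  rw [← Module.End.mul_apply, key, LinearMap.add_apply, Module.End.mul_apply, hb j hj, hZ,
    map_zero, add_zero]

/-- For j ≤ k the ordering puts [ξ_j, y_k] in degree at most -2, hence in m, where ρ is the scalar
χ([ξ_j, y_k]) = δ_jk. Nothing is claimed for j > k. -/
lemma triangular : TriangularHeisenberg (K := K) (B := BiGraded D.fil) (homPart D.fil) Φ.s Φ.X Φ.Y where
  X_mem k i b hb := by
    rw [sub_eq_add_neg]
    exact gradedMap_mem_homPart _ hb
  Y_mem k i b hb := by
    have := Φ.ρ_mem_homPart (Φ.y_mem k) hb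
    have e : kdeg ((-2, 0) + Φ.s k) = Φ.s k := by ext <;> simp [kdeg]
    rwa [e] at this
  nilp k b := gradedMap_locally_nilpotent (fun _ => fil_eq_bot) _
    (by simpa using Φ.s_pos k) b
  X_Y_self k := by
    have h1 : ⁅Φ.ξ k, Φ.y k⁆ ∈ D.m := by
      refine mem_m_of_gr (i := -2) le_rfl ?_
      simpa using (lie_mem_bigr (Φ.ξ_mem k) (Φ.y_mem k)).1
    rw [Y, X_ρ, ρ_of_mem_m Φ h1, Φ.pair, if_pos rfl, one_smul]
  X_Y j k hjk := by
    have h1 : ⁅Φ.ξ j, Φ.y k⁆ ∈ D.m := by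
      refine mem_m_of_gr ?_ (lie_mem_bigr (Φ.ξ_mem j) (Φ.y_mem k)).1
      have := Φ.s_anti hjk.le
      simp only at this
      simp; omega
    rw [Y, X_ρ, ρ_of_mem_m Φ h1, Φ.pair, if_neg hjk.ne, zero_smul, add_zero]
  Y_Y j k := Φ.ρ_comm _ _
  X_X k b hb := Φ.X_X k hb

end Frame

end WDatum

end


/-! ### Homogeneous tensors, right multiplication by invariants, and θ-weights. -/

noncomputable section

namespace WDatum

open Module LieAlgebra

variable {K : Type*} {g : Type*} [Field K] [LieRing g] [LieAlgebra K g] (D : WDatum K g)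

/-- The part of the tensor algebra of given Kazhdan degree and `θ`-weight. -/
def tens (i : ℤ × ℤ) : Submodule K (TensorAlgebra K g) :=
  Submodule.span K {t | ∃ L : List ((ℤ × ℤ) × g), (∀ p ∈ L, p.2 ∈ D.bigr p.1) ∧
    (L.map fun p => kdeg p.1).sum = i ∧ t = (L.map fun p => TensorAlgebra.ι K p.2).prod}

variable {D}

lemma one_mem_tens : (1 : TensorAlgebra K g) ∈ D.tens 0 :=
  Submodule.subset_span ⟨[], by simp, by simp, by simp⟩

lemma ι_mul_mem_tens {s i : ℤ × ℤ} {x : g} (hx : x ∈ D.bigr s) {t : TensorAlgebra K g}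
    (ht : t ∈ D.tens i) : TensorAlgebra.ι K x * t ∈ D.tens (kdeg s + i) := by
  unfold tens at ht
  induction ht using Submodule.span_induction with
  | mem t ht =>
    obtain ⟨L, h1, h2, rfl⟩ := ht
    refine Submodule.subset_span ⟨(s, x) :: L, ?_, ?_, ?_⟩
    · simpa using ⟨hx, fun a b c h => h1 ((a, b), c) h⟩
    · rw [List.map_cons, List.sum_cons, h2]
    · rw [List.map_cons, List.prod_cons]
  | zero => rw [mul_zero]; exact zero_mem _
  | add a b _ _ ha hb => rw [mul_add]; exact add_mem ha hb
  | smul c a _ ha => rw [mul_smul_comm]; exact Submodule.smul_mem _ _ ha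

lemma ι_mem_tens {s : ℤ × ℤ} {x : g} (hx : x ∈ D.bigr s) :
    TensorAlgebra.ι K x ∈ D.tens (kdeg s) := by
  simpa using ι_mul_mem_tens hx one_mem_tens

lemma tens_le {G : ℤ × ℤ → Submodule K (TensorAlgebra K g)} (h1 : 1 ∈ G 0)
    (h2 : ∀ s, ∀ x ∈ D.bigr s, ∀ i, ∀ t ∈ D.tens i, t ∈ G i →
      TensorAlgebra.ι K x * t ∈ G (kdeg s + i)) (i : ℤ × ℤ) : D.tens i ≤ G i := by
  refine Submodule.span_le.2 ?_
  rintro _ ⟨L, hL, rfl, rfl⟩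
  suffices h : (L.map fun p => TensorAlgebra.ι K p.2).prod ∈ D.tens (L.map fun p => kdeg p.1).sum ∧
      (L.map fun p => TensorAlgebra.ι K p.2).prod ∈ G (L.map fun p => kdeg p.1).sum from h.2
  induction L with
  | nil => exact ⟨one_mem_tens, h1⟩
  | cons p L ih =>
    obtain ⟨ih1, ih2⟩ := ih fun p hp => hL p (List.mem_cons_of_mem _ hp)
    have hp := hL p List.mem_cons_self
    rw [List.map_cons, List.map_cons, List.prod_cons, List.sum_cons]
    exact ⟨ι_mul_mem_tens hp ih1, h2 _ _ hp _ _ ih1 ih2⟩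

lemma mul_mem_tens {i j : ℤ × ℤ} {t t' : TensorAlgebra K g} (ht : t ∈ D.tens i)
    (ht' : t' ∈ D.tens j) : t * t' ∈ D.tens (i + j) := by
  refine tens_le (G := fun i => (D.tens (i + j)).comap (LinearMap.mulRight K t')) ?_ ?_ i ht
  · simpa using ht'
  · intro s x hx i t _ h
    simp only [Submodule.mem_comap, LinearMap.mulRight_apply] at h ⊢
    rw [mul_assoc, add_assoc]
    exact ι_mul_mem_tens hx h

variable (D) in
/-- The tensor algebra acting on `U / U m_χ`. -/
def tact : TensorAlgebra K g →ₐ[K] Module.End K D.Whittaker :=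
  D.act.comp (UniversalEnvelopingAlgebra.mkAlgHom K g)

lemma tact_ι (x : g) : D.tact (TensorAlgebra.ι K x) = D.act (D.ιU x) := rfl

lemma tact_vac (t : TensorAlgebra K g) : D.tact t D.vac =
    Submodule.Quotient.mk (UniversalEnvelopingAlgebra.mkAlgHom K g t) := act_vac _

lemma tact_mem_fil {i j : ℤ × ℤ} {t : TensorAlgebra K g} (ht : t ∈ D.tens i) {q : D.Whittaker}
    (hq : q ∈ D.fil j) : D.tact t q ∈ D.fil (i + j) := by
  refine tens_le (G := fun i => (D.fil (i + j)).comap (D.tact.toLinearMap.flip q)) ?_ ?_ i ht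
  · simpa using hq
  · intro s x hx i t _ h
    simp only [Submodule.mem_comap, LinearMap.flip_apply, AlgHom.toLinearMap_apply, map_mul,
      Module.End.mul_apply] at h ⊢
    rw [tact_ι, add_assoc, add_comm (kdeg s)]
    exact act_mem_fil hx h

lemma tact_vac_mem_fil {i : ℤ × ℤ} {t : TensorAlgebra K g} (ht : t ∈ D.tens i) :
    D.tact t D.vac ∈ D.fil i := by
  simpa using tact_mem_fil ht (vac_mem_fil (i := 0) le_rfl rfl)

/-- Homogeneous tensors represent symbols, so the symmetric algebra need not be compared with gr U.
-/
lemma exists_tens {i : ℤ × ℤ} {q : D.Whittaker} (hq : q ∈ D.fil i) :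
    ∃ t ∈ D.tens i, D.tact t D.vac - q ∈ D.fil (i - (1, 0)) := by
  have hG := fil_le (D := D)
    (G := fun i => (D.tens i).map (D.tact.toLinearMap.flip D.vac) ⊔ D.fil (i - (1, 0))) ?_ ?_ i hq
  · obtain ⟨_, ⟨t, ht, rfl⟩, b, hb, rfl⟩ := Submodule.mem_sup.1 hG
    refine ⟨t, ht, ?_⟩
    simpa using hb
  · intro i h1 h2
    rcases h1.lt_or_eq with h | h
    · exact Submodule.mem_sup_right (vac_mem_fil (by simp; omega) (by simpa using h2))
    · obtain rfl : i = 0 := Prod.ext h.symm h2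
      exact Submodule.mem_sup_left ⟨1, one_mem_tens, by simp⟩
  · intro s x hx i q _ hq
    obtain ⟨_, ⟨t, ht, rfl⟩, b, hb, rfl⟩ := Submodule.mem_sup.1 hq
    rw [map_add]
    refine Submodule.add_mem_sup ⟨TensorAlgebra.ι K x * t, ?_, ?_⟩ ?_
    · rw [add_comm]; exact ι_mul_mem_tens hx ht
    · simp only [LinearMap.flip_apply, AlgHom.toLinearMap_apply, map_mul, Module.End.mul_apply,
        tact_ι]
    · rw [← sub_add_eq_add_sub]
      exact act_mem_fil hx hb

lemma gr_le_iSup_bigr [FiniteDimensional K g] (i : ℤ) : D.gr i ≤ ⨆ c : ℤ, D.bigr (i, c) :=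
  Submodule.le_iSup_inf_eigenspace_intCast (A := ad K g D.θ) D.θ_integral
    fun _ hx => D.lie_θ_gr hx

lemma kazhdanTensor_le [FiniteDimensional K g] (k : ℤ) :
    D.kazhdanTensor k ≤ ⨆ c : ℤ, D.tens (k, c) := by
  refine Submodule.span_le.2 ?_
  rintro _ ⟨L, hL, rfl, rfl⟩
  induction L with
  | nil => exact Submodule.mem_iSup_of_mem 0 one_mem_tens
  | cons p L ih =>
    have ih := ih fun p hp => hL p (List.mem_cons_of_mem _ hp)
    have hp := gr_le_iSup_bigr _ (hL p List.mem_cons_self)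
    rw [List.map_cons, List.map_cons, List.prod_cons, List.sum_cons]
    obtain ⟨a, ha, hap⟩ := (Submodule.mem_iSup_iff_exists_finsupp _ _).1 hp
    obtain ⟨b, hb, hbL⟩ := (Submodule.mem_iSup_iff_exists_finsupp _ _).1 ih
    rw [← hap, ← hbL, Finsupp.sum, Finsupp.sum, map_sum, Finset.sum_mul_sum]
    refine Submodule.sum_mem _ fun c _ => Submodule.sum_mem _ fun c' _ =>
      Submodule.mem_iSup_of_mem (c + c') ?_
    have := ι_mul_mem_tens (ha c) (hb c')
    simpa [kdeg] using this

lemma kazhdan_vac_mem [FiniteDimensional K g] {k : ℤ} {v : UniversalEnvelopingAlgebra K g}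
    (hv : v ∈ D.kazhdan k) :
    (Submodule.Quotient.mk v : D.Whittaker) ∈ ⨆ c : ℤ, D.fil (k, c) := by
  obtain ⟨t, ht, rfl⟩ := hv
  have h : (⨆ j : {j : ℤ // j ≤ k}, D.kazhdanTensor j) ≤
      (⨆ c : ℤ, D.fil (k, c)).comap (D.tact.toLinearMap.flip D.vac) := by
    refine iSup_le fun j => (kazhdanTensor_le _).trans (iSup_le fun c t ht => ?_)
    exact Submodule.mem_iSup_of_mem c (fil_mono (i := ((j : ℤ), c)) (j := (k, c)) j.2 rfl (tact_vac_mem_fil ht))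
  have := h ht
  rw [Submodule.mem_comap, LinearMap.flip_apply, AlgHom.toLinearMap_apply, tact_vac] at this
  exact this

lemma iSup_tens [CharZero K] [IsAlgClosed K] [FiniteDimensional K g] : ⨆ i, D.tens i = ⊤ := by
  rw [eq_top_iff]
  intro t _
  induction t using TensorAlgebra.induction with
  | algebraMap c =>
    rw [Algebra.algebraMap_eq_smul_one]
    exact Submodule.smul_mem _ _ (Submodule.mem_iSup_of_mem 0 one_mem_tens)
  | ι x =>
    refine homogeneous_induction (P := fun x => TensorAlgebra.ι K x ∈ ⨆ i, D.tens i)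
      (stable_top (D := D)) (fun s x _ hx => Submodule.mem_iSup_of_mem _ (ι_mem_tens hx))
      (fun a b ha hb => ?_) (x := x) trivial
    rw [map_add]; exact add_mem ha hb
  | mul a b ha hb =>
    obtain ⟨a', ha', rfl⟩ := (Submodule.mem_iSup_iff_exists_finsupp _ _).1 (ha trivial)
    obtain ⟨b', hb', rfl⟩ := (Submodule.mem_iSup_iff_exists_finsupp _ _).1 (hb trivial)
    rw [Finsupp.sum, Finsupp.sum, Finset.sum_mul_sum]
    exact Submodule.sum_mem _ fun c _ => Submodule.sum_mem _ fun c' _ =>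
      Submodule.mem_iSup_of_mem _ (mul_mem_tens (ha' c) (hb' c'))
  | add a b ha hb => exact add_mem (ha trivial) (hb trivial)

lemma iSup_fil [CharZero K] [IsAlgClosed K] [FiniteDimensional K g] : ⨆ i, D.fil i = ⊤ := by
  rw [eq_top_iff]
  intro q _
  obtain ⟨u, rfl⟩ := Submodule.Quotient.mk_surjective _ q
  obtain ⟨t, rfl⟩ := RingCon.mkₐ_surjective (α := K) (UniversalEnvelopingAlgebra.ringCon K g) u
  have h : (⨆ i, D.tens i) ≤ (⨆ i, D.fil i).comap (D.tact.toLinearMap.flip D.vac) :=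
    iSup_le fun i t ht => Submodule.mem_iSup_of_mem i (tact_vac_mem_fil ht)
  rw [iSup_tens] at h
  exact (tact_vac t) ▸ h (x := t) trivial

/-! ### Right multiplication by invariants -/

variable (D) in
/-- The invariants of `m` in `U / U m_χ`. -/
def whittakerInvariants : Submodule K D.Whittaker where
  carrier := {q | ∀ ξ ∈ D.m, D.adm ξ q = 0}
  add_mem' ha hb ξ hξ := by rw [map_add, ha ξ hξ, hb ξ hξ, add_zero]
  zero_mem' ξ _ := map_zero _
  smul_mem' c a ha ξ hξ := by rw [map_smul, ha ξ hξ, smul_zero]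

/-- Right multiplication by an invariant. -/
def rmul {q : D.Whittaker} (hq : q ∈ D.whittakerInvariants) :
    D.Whittaker →ₗ[UniversalEnvelopingAlgebra K g] D.Whittaker :=
  Submodule.liftQ D.leftIdeal (LinearMap.toSpanSingleton _ _ q) (by
    refine Submodule.span_le.2 ?_
    rintro _ ⟨ξ, hξ, rfl⟩
    have := hq ξ hξ
    rw [adm_apply] at this
    change (D.ιU ξ - algebraMap K _ (D.χ ξ)) • q = 0
    rw [sub_smul, algebraMap_smul]
    exact this)

lemma rmul_mk {q : D.Whittaker} (hq : q ∈ D.whittakerInvariants)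
    (u : UniversalEnvelopingAlgebra K g) :
    rmul hq (Submodule.Quotient.mk u) = D.act u q := rfl

lemma rmul_vac {q : D.Whittaker} (hq : q ∈ D.whittakerInvariants) : rmul hq D.vac = q := by
  rw [vac, rmul_mk, map_one]; rfl

lemma rmul_act {q : D.Whittaker} (hq : q ∈ D.whittakerInvariants)
    (u : UniversalEnvelopingAlgebra K g) (q' : D.Whittaker) :
    rmul hq (D.act u q') = D.act u (rmul hq q') := map_smul (rmul hq) u q'

lemma rmul_mem_fil {q : D.Whittaker} (hq : q ∈ D.whittakerInvariants) {i j : ℤ × ℤ}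
    (hqi : q ∈ D.fil i) {q' : D.Whittaker} (hq' : q' ∈ D.fil j) : rmul hq q' ∈ D.fil (j + i) := by
  refine fil_le (G := fun j => (D.fil (j + i)).comap ((rmul hq).restrictScalars K)) ?_ ?_ j hq'
  · intro j h1 h2
    simp only [Submodule.mem_comap, LinearMap.restrictScalars_apply, rmul_vac]
    exact fil_mono (by simpa using h1) (by simp [h2]) hqi
  · intro s x hx j q' _ h
    simp only [Submodule.mem_comap, LinearMap.restrictScalars_apply] at h ⊢
    rw [rmul_act, add_right_comm]
    exact act_mem_fil hx h

/-- As ξ acts on the vacuum by χ(ξ), the elements (ξ - χ(ξ))u and [ξ, u] have the same class. -/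
lemma mk_mem_whittakerInvariants_iff {u : UniversalEnvelopingAlgebra K g} :
    (Submodule.Quotient.mk u : D.Whittaker) ∈ D.whittakerInvariants ↔ u ∈ D.invariants := by
  have key : ∀ ξ ∈ D.m, D.adm ξ (Submodule.Quotient.mk u) =
      (Submodule.Quotient.mk (D.ιU ξ * u - u * D.ιU ξ) : D.Whittaker) := by
    intro ξ hξ
    rw [← act_vac u, adm_apply]
    have h1 := congrArg (D.act u) (adm_vac hξ)
    rw [adm_apply, map_sub, map_smul, map_zero, sub_eq_zero] at h1
    rw [← h1, ← act_vac, map_sub, map_mul, map_mul]; rfl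
  constructor
  · intro h ξ hξ
    rw [← Submodule.Quotient.mk_eq_zero, ← key ξ hξ]
    exact h ξ hξ
  · intro h ξ hξ
    rw [key ξ hξ, Submodule.Quotient.mk_eq_zero]
    exact h ξ hξ

variable (D) in
/-- The embedding of the W-algebra into `U / U m_χ`. -/
def toWhittaker : D.W →ₗ[K] D.Whittaker where
  toFun := Quotient.lift (fun u : D.invariants =>
      (Submodule.Quotient.mk (u : UniversalEnvelopingAlgebra K g) : D.Whittaker)) (by
    intro a b hab
    rw [Submodule.Quotient.eq]
    exact (Submodule.quotientRel_def D.invariantsIdeal).1 hab)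
  map_add' a b := by
    obtain ⟨a, rfl⟩ := Ideal.Quotient.mk_surjective a
    obtain ⟨b, rfl⟩ := Ideal.Quotient.mk_surjective b
    rfl
  map_smul' c a := by
    obtain ⟨a, rfl⟩ := Ideal.Quotient.mk_surjective a
    rfl

lemma toWhittaker_mk (u : D.invariants) :
    D.toWhittaker (Ideal.Quotient.mk D.invariantsIdeal u) =
      Submodule.Quotient.mk (u : UniversalEnvelopingAlgebra K g) := rfl

lemma toWhittaker_injective : Function.Injective D.toWhittaker := by
  rw [injective_iff_map_eq_zero]
  intro w hw
  obtain ⟨u, rfl⟩ := Ideal.Quotient.mk_surjective w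
  rw [toWhittaker_mk, Submodule.Quotient.mk_eq_zero] at hw
  exact Ideal.Quotient.eq_zero_iff_mem.2 hw

lemma toWhittaker_mem (w : D.W) : D.toWhittaker w ∈ D.whittakerInvariants := by
  obtain ⟨u, rfl⟩ := Ideal.Quotient.mk_surjective w
  exact mk_mem_whittakerInvariants_iff.2 u.2

lemma exists_toWhittaker_eq {q : D.Whittaker} (hq : q ∈ D.whittakerInvariants) :
    ∃ w, D.toWhittaker w = q := by
  obtain ⟨u, rfl⟩ := Submodule.Quotient.mk_surjective _ q
  exact ⟨D.mkW u (mk_mem_whittakerInvariants_iff.1 hq), rfl⟩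

lemma toWhittaker_mul (w w' : D.W) :
    D.toWhittaker (w * w') = rmul (toWhittaker_mem w') (D.toWhittaker w) := by
  obtain ⟨u, rfl⟩ := Ideal.Quotient.mk_surjective w
  obtain ⟨u', rfl⟩ := Ideal.Quotient.mk_surjective w'
  rfl

lemma toWhittaker_one : D.toWhittaker 1 = D.vac := rfl

/-! ### The action of `ad θ` -/

variable (D) in
/-- `ad θ` on `U / U m_χ`. -/
def adθ : Module.End K D.Whittaker :=
  D.act (D.ιU D.θ) - (rmul (toWhittaker_mem D.θW)).restrictScalars K

lemma adθ_apply (q : D.Whittaker) :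
    D.adθ q = D.act (D.ιU D.θ) q - rmul (toWhittaker_mem D.θW) q := rfl

lemma adθ_toWhittaker (w : D.W) : D.adθ (D.toWhittaker w) =
    D.toWhittaker (D.θW * w - w * D.θW) := by
  rw [adθ_apply, map_sub, toWhittaker_mul w]
  congr 1
  obtain ⟨u, rfl⟩ := Ideal.Quotient.mk_surjective w
  rfl

lemma mem_weightSpace_iff {α : ℤ} {w : D.W} :
    w ∈ D.weightSpace α ↔ D.toWhittaker w ∈ D.adθ.eigenspace (α : K) := by
  rw [Module.End.mem_eigenspace_iff, adθ_toWhittaker, ← map_smul, toWhittaker_injective.eq_iff]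
  rfl

/-- ad θ kills the vacuum and passes through x at the cost of [θ, x], so weights add up along a
product. -/
lemma fil_le_eigenspace (i : ℤ × ℤ) : D.fil i ≤ D.adθ.eigenspace (i.2 : K) := by
  refine fil_le (G := fun i => D.adθ.eigenspace (i.2 : K)) ?_ ?_ i
  · intro i _ h
    rw [Module.End.mem_eigenspace_iff, h, ← toWhittaker_one, adθ_toWhittaker]
    simp
  · intro s x hx i q _ hq
    rw [Module.End.mem_eigenspace_iff, adθ_apply] at *
    have h1 : D.act (D.ιU D.θ) (D.act (D.ιU x) q) =
        D.act (D.ιU x) (D.act (D.ιU D.θ) q) + D.act (D.ιU ⁅D.θ, x⁆) q := by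
      rw [act_lie]; abel
    have h2 : D.ιU ((s.2 : K) • x) = (s.2 : K) • D.ιU x := map_smul ιLin _ _
    rw [rmul_act, h1, add_sub_right_comm, ← map_sub, hq, map_smul, mem_θEigenspace.1 hx.2, h2,
      map_smul, LinearMap.smul_apply, ← add_smul]
    simp [kdeg]

lemma exists_mem_fil_of_mem_weightSpace [CharZero K] [IsAlgClosed K] [FiniteDimensional K g]
    {β : ℤ} {w : D.W} (hw : w ∈ D.weightSpace β) : ∃ n : ℤ, D.toWhittaker w ∈ D.fil (n, β) := by
  have hind : iSupIndep fun c : ℤ => D.adθ.eigenspace (c : K) :=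
    D.adθ.eigenspaces_iSupIndep.comp (Int.cast_injective (α := K))
  have hle : ⨆ i, D.fil i ≤ ⨆ c : ℤ, ⨆ n : ℤ, D.fil (n, c) :=
    iSup_le fun i => le_iSup_of_le i.2 (le_iSup (fun n => D.fil (n, i.2)) i.1)
  rw [iSup_fil] at hle
  obtain ⟨q, hq, hq'⟩ := Submodule.exists_mem_of_map_mem hind LinearMap.id
    (p := fun c : ℤ => ⨆ n : ℤ, D.fil (n, c)) (fun c => by
      change (⨆ n : ℤ, D.fil (n, c)) ≤ _
      exact iSup_le fun n => fil_le_eigenspace (n, c)) (hle trivial) (mem_weightSpace_iff.1 hw)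
  rw [LinearMap.id_apply, LinearMap.id_apply] at hq'
  rw [hq', Submodule.mem_iSup_of_directed] at hq
  · exact hq
  · exact Monotone.directed_le fun n n' h => fil_mono h rfl

lemma mem_weightSpace_of_mem_fil {i : ℤ × ℤ} {w : D.W} (hw : D.toWhittaker w ∈ D.fil i) :
    w ∈ D.weightSpace i.2 := mem_weightSpace_iff.2 (fil_le_eigenspace i hw)

lemma mul_mem_weightSpace {α β : ℤ} {w w' : D.W} (hw : w ∈ D.weightSpace α)
    (hw' : w' ∈ D.weightSpace β) : w * w' ∈ D.weightSpace (α + β) := by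
  change D.θW * w - w * D.θW = (α : K) • w at hw
  change D.θW * w' - w' * D.θW = (β : K) • w' at hw'
  change D.θW * (w * w') - w * w' * D.θW = ((α + β : ℤ) : K) • (w * w')
  have : D.θW * (w * w') - w * w' * D.θW = (D.θW * w - w * D.θW) * w' +
      w * (D.θW * w' - w' * D.θW) := by noncomm_ring
  rw [this, hw, hw', smul_mul_assoc, mul_smul_comm, ← add_smul]; push_cast; rfl

lemma one_mem_weightSpace : (1 : D.W) ∈ D.weightSpace 0 := by
  change D.θW * 1 - 1 * D.θW = ((0 : ℤ) : K) • (1 : D.W)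
  simp

end WDatum

end


/-! ### Functions on the Slodowy slice and their action on gr (U/U m_χ). -/

-- A is noncommutative, so evaluation goes through the commutative subalgebra generated by the a i.
open scoped IsMulCommutative in
lemma MvPolynomial.exists_algHom_of_commute {K A σ : Type*} [Field K] [Ring A] [Algebra K A]
    (a : σ → A) (h : ∀ i j, a i * a j = a j * a i) :
    ∃ φ : MvPolynomial σ K →ₐ[K] A, ∀ i, φ (MvPolynomial.X i) = a i := by
  have := Algebra.isMulCommutative_adjoin K (s := Set.range a) (by
    rintro _ ⟨i, rfl⟩ _ ⟨j, rfl⟩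
    exact h i j)
  refine ⟨(Algebra.adjoin K (Set.range a)).val.comp
    (MvPolynomial.aeval fun i => (⟨a i, Algebra.subset_adjoin ⟨i, rfl⟩⟩ :
      Algebra.adjoin K (Set.range a))), fun i => ?_⟩
  rw [AlgHom.comp_apply, MvPolynomial.aeval_X]
  rfl

noncomputable section

namespace WDatum

open Module LieAlgebra

variable {K : Type*} {g : Type*} [Field K] [LieRing g] [LieAlgebra K g] (D : WDatum K g)
  [CharZero K] [IsAlgClosed K] [FiniteDimensional K g]

/-- The projection of `g` to the centralizer of `e` along `[f, g]`. -/
def proj : g →ₗ[K] LinearMap.ker (ad K g D.e) :=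
  Submodule.projectionOnto _ _ D.isCompl_ker_range

/-- A basis of the centralizer of `e`. -/
def centralizerBasis : Basis (Fin (finrank K (LinearMap.ker (ad K g D.e)))) K
    (LinearMap.ker (ad K g D.e)) := Module.finBasis K _

/-- The polynomial functions on the Slodowy slice. -/
abbrev SlicePoly : Type _ := MvPolynomial (Fin (finrank K (LinearMap.ker (ad K g D.e)))) K

/-- The restriction of linear functions to the Slodowy slice. -/
def sliceLin : g →ₗ[K] D.SlicePoly :=
  D.centralizerBasis.constr K MvPolynomial.X ∘ₗ D.proj +
    Algebra.linearMap K D.SlicePoly ∘ₗ D.χ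

/-- The restriction of polynomial functions to the Slodowy slice. -/
def slice : TensorAlgebra K g →ₐ[K] D.SlicePoly := TensorAlgebra.lift K D.sliceLin

variable {D}

lemma proj_of_mem {x : g} (hx : x ∈ LinearMap.ker (ad K g D.e)) : (D.proj x : g) = x := by
  rw [proj, Submodule.projectionOnto_apply_of_mem_left _ hx]

lemma sub_proj_mem (x : g) : x - D.proj x ∈ LinearMap.range (ad K g D.f) := by
  rw [← Submodule.projectionOnto_apply_eq_zero_iff D.isCompl_ker_range]
  change D.proj (x - D.proj x) = 0
  rw [map_sub, sub_eq_zero]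
  exact Subtype.ext (proj_of_mem (D.proj x).2).symm

lemma χ_proj (x : g) : D.χ (D.proj x) = 0 := χ_eq_zero_of_lie_e (D.proj x).2

lemma sliceLin_apply (x : g) : D.sliceLin x =
    D.centralizerBasis.constr K MvPolynomial.X (D.proj x) + algebraMap K _ (D.χ x) := rfl

lemma sliceLin_eq (x : g) :
    D.sliceLin x = D.sliceLin (D.proj x) + algebraMap K _ (D.χ x) := by
  have h : D.proj (D.proj x : g) = D.proj x := Subtype.ext (proj_of_mem (D.proj x).2)
  rw [sliceLin_apply, sliceLin_apply (D.proj x : g), h, χ_proj, map_zero, add_zero]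

lemma slice_ι (x : g) : D.slice (TensorAlgebra.ι K x) = D.sliceLin x := TensorAlgebra.lift_ι_apply ..

/-- Both z_g(e) and [f, g] are stable under ad h and ad θ, so the two parts of a homogeneous vector
are homogeneous of the same bidegree. The family p tracks both parts at once. -/
lemma proj_mem_bigr {s : ℤ × ℤ} {x : g} (hx : x ∈ D.bigr s) : (D.proj x : g) ∈ D.bigr s := by
  have hk := (stable_ker_ad (e_mem_bigr (D := D))).le_iSup (D.proj x).2
  have hr := (stable_range_ad (f_mem_bigr (D := D))).le_iSup (sub_proj_mem (D := D) x)
  set p : ℤ × ℤ → Submodule K (g × g) := fun t =>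
    (LinearMap.ker (ad K g D.e) ⊓ D.bigr t).prod (LinearMap.range (ad K g D.f) ⊓ D.bigr t) with hp
  have h1 : (⨆ t, LinearMap.ker (ad K g D.e) ⊓ D.bigr t) ≤
      (⨆ t, p t).comap (LinearMap.inl K g g) :=
    iSup_le fun t y hy => Submodule.mem_iSup_of_mem t ⟨hy, zero_mem _⟩
  have h2 : (⨆ t, LinearMap.range (ad K g D.f) ⊓ D.bigr t) ≤
      (⨆ t, p t).comap (LinearMap.inr K g g) :=
    iSup_le fun t y hy => Submodule.mem_iSup_of_mem t ⟨zero_mem _, hy⟩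
  have h3 : ((D.proj x : g), x - D.proj x) ∈ ⨆ t, p t := by
    simpa using add_mem (Submodule.mem_comap.1 (h1 hk)) (Submodule.mem_comap.1 (h2 hr))
  obtain ⟨⟨a, b⟩, ⟨ha, hb⟩, hab⟩ := Submodule.exists_mem_of_map_mem (iSupIndep_bigr (D := D))
    (LinearMap.coprod LinearMap.id LinearMap.id) (p := p) (i := s)
    (fun t y hy => by simpa using add_mem hy.1.2 hy.2.2) h3 (by simpa using hx)
  simp only [LinearMap.coprod_apply, LinearMap.id_apply] at hab
  have h4 : D.proj b = 0 :=
    (Submodule.projectionOnto_apply_eq_zero_iff D.isCompl_ker_range).2 hb.1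
  have h5 : a + b = x := by rw [hab]; abel
  rw [← h5, map_add, h4, add_zero, proj_of_mem ha.1]
  exact ha.2

/-! ### Evaluation at the points of the slice -/

lemma lift_form_eq_eval {z : g} (hz : ⁅D.f, z⁆ = 0) (t : TensorAlgebra K g) :
    TensorAlgebra.lift K (D.form (D.e + z)) t =
      MvPolynomial.eval (fun j => D.form z (D.centralizerBasis j)) (D.slice t) := by
  have key : TensorAlgebra.lift K (D.form (D.e + z)) =
      (MvPolynomial.aeval fun j => D.form z (D.centralizerBasis j)).comp D.slice := by
    refine TensorAlgebra.hom_ext (LinearMap.ext fun x => ?_)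
    have h1 : D.form z x = D.form z (D.proj x) := by
      rw [← sub_eq_zero, ← map_sub, D.form_symm]
      exact form_eq_zero_of_lie_f (sub_proj_mem x) hz
    have h2 : (MvPolynomial.aeval fun j => D.form z (D.centralizerBasis j)).toLinearMap ∘ₗ
        D.centralizerBasis.constr K MvPolynomial.X = D.form z ∘ₗ Submodule.subtype _ :=
      D.centralizerBasis.ext fun j => by simp
    have h3 := LinearMap.congr_fun h2 (D.proj x)
    simp only [LinearMap.comp_apply, AlgHom.toLinearMap_apply, Submodule.subtype_apply] at h3
    simp only [LinearMap.comp_apply, AlgHom.toLinearMap_apply, TensorAlgebra.lift_ι_apply,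
      AlgHom.comp_apply, slice_ι, sliceLin_apply, map_add, LinearMap.add_apply, h3, ← h1,
      AlgHom.commutes, Algebra.algebraMap_self, RingHom.id_apply]
    rw [add_comm]; rfl
  rw [key]
  simp

lemma exists_form_eq (a : Fin (finrank K (LinearMap.ker (ad K g D.e))) → K) :
    ∃ z, ⁅D.f, z⁆ = 0 ∧ (fun j => D.form z (D.centralizerBasis j)) = a := by
  set z := (D.form.toDual D.form_nondegenerate).symm (D.centralizerBasis.constr K a ∘ₗ D.proj)
  have hz : ∀ x, D.form z x = D.centralizerBasis.constr K a (D.proj x) := fun x =>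
    LinearMap.BilinForm.apply_toDual_symm_apply _ _
  refine ⟨z, lie_f_eq_zero fun y hy => ?_, funext fun j => ?_⟩
  · rw [D.form_symm, hz, show D.proj y = 0 from
      (Submodule.projectionOnto_apply_eq_zero_iff D.isCompl_ker_range).2 hy, map_zero]
  · rw [hz, show D.proj (D.centralizerBasis j : g) = D.centralizerBasis j from
      Subtype.ext (proj_of_mem (D.centralizerBasis j).2), Basis.constr_basis]

/-- The points of z_g(f) realize all coordinate vectors (`exists_form_eq`), and K is infinite, so
polynomials on the slice are determined by their values there. -/
lemma slice_eq_of_forall {t t' : TensorAlgebra K g}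
    (h : ∀ z, ⁅D.f, z⁆ = 0 → TensorAlgebra.lift K (D.form (D.e + z)) t =
      TensorAlgebra.lift K (D.form (D.e + z)) t') : D.slice t = D.slice t' := by
  refine MvPolynomial.funext fun a => ?_
  obtain ⟨z, hz, rfl⟩ := exists_form_eq a
  rw [← lift_form_eq_eval hz, ← lift_form_eq_eval hz, h z hz]

namespace Frame

variable (Φ : D.Frame)

/-- The action of the tensor algebra on `gr (U / U m_χ)`. -/
def τ : TensorAlgebra K g →ₐ[K] Module.End K (BiGraded D.fil) := TensorAlgebra.lift K Φ.ρ

omit [CharZero K] [IsAlgClosed K] [FiniteDimensional K g] in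
lemma τ_ι (x : g) : Φ.τ (TensorAlgebra.ι K x) = Φ.ρ x := TensorAlgebra.lift_ι_apply ..

omit [IsAlgClosed K] [FiniteDimensional K g] in
lemma τ_symbol {i j : ℤ × ℤ} {t : TensorAlgebra K g} (ht : t ∈ D.tens i) {q : D.Whittaker}
    (hq : q ∈ D.fil j) : Φ.τ t (symbol D.fil j q) = symbol D.fil (i + j) (D.tact t q) := by
  let G : ℤ × ℤ → Submodule K (TensorAlgebra K g) := fun i =>
    { carrier := {t | D.tact t q ∈ D.fil (i + j) ∧
        Φ.τ t (symbol D.fil j q) = symbol D.fil (i + j) (D.tact t q)}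
      zero_mem' := by simp [symbol_zero]
      add_mem' := fun {a b} ha hb => by
        simp only [Set.mem_ofPred_eq, map_add, LinearMap.add_apply]
        exact ⟨add_mem ha.1 hb.1, by rw [ha.2, hb.2, symbol_add ha.1 hb.1]⟩
      smul_mem' := fun c a ha => by
        simp only [Set.mem_ofPred_eq, map_smul, LinearMap.smul_apply]
        exact ⟨Submodule.smul_mem _ _ ha.1, by rw [ha.2, symbol_smul ha.1]⟩ }
  refine (tens_le (G := G) ?_ ?_ i ht).2
  · refine ⟨by simpa using hq, by simp⟩
  · intro s x hx i t ht h
    have e : kdeg s + i + j = i + j + kdeg s := by abel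
    refine ⟨tact_mem_fil (ι_mul_mem_tens hx ht) hq, ?_⟩
    rw [map_mul, Module.End.mul_apply, h.2, τ_ι, Φ.ρ_symbol hx h.1, map_mul, e,
      Module.End.mul_apply, tact_ι]

/-- The symbol of the cyclic vector. -/
def symbolVac (_Φ : D.Frame) : BiGraded D.fil := symbol D.fil 0 D.vac

omit [IsAlgClosed K] [FiniteDimensional K g] in
lemma τ_symbolVac {i : ℤ × ℤ} {t : TensorAlgebra K g} (ht : t ∈ D.tens i) :
    Φ.τ t Φ.symbolVac = symbol D.fil i (D.tact t D.vac) := by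
  rw [symbolVac, Φ.τ_symbol ht (vac_mem_fil (i := 0) le_rfl rfl), add_zero]

/-- The functions vanishing on the slice. -/
def sliceKer : Submodule K (BiGraded D.fil) := ⨆ k, LinearMap.range (Φ.Y k)

omit [CharZero K] [IsAlgClosed K] [FiniteDimensional K g] in
lemma sliceKer_le_comap {A : Module.End K (BiGraded D.fil)} (hA : ∀ x, A * Φ.ρ x = Φ.ρ x * A) :
    Φ.sliceKer ≤ Φ.sliceKer.comap A := by
  refine iSup_le fun k => ?_
  rintro _ ⟨b, rfl⟩
  rw [Submodule.mem_comap, ← Module.End.mul_apply, Y, hA]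
  exact Submodule.mem_iSup_of_mem k ⟨A b, rfl⟩

lemma τ_mul_ρ (t : TensorAlgebra K g) (x : g) : Φ.τ t * Φ.ρ x = Φ.ρ x * Φ.τ t := by
  induction t using TensorAlgebra.induction with
  | algebraMap c => rw [AlgHom.commutes, Algebra.commutes]
  | ι y => rw [τ_ι, Φ.ρ_comm]
  | mul a b ha hb => rw [map_mul, mul_assoc, hb, ← mul_assoc, ha, mul_assoc]
  | add a b ha hb => rw [map_add, add_mul, mul_add, ha, hb]

lemma exists_sliceHom : ∃ φ : D.SlicePoly →ₐ[K] Module.End K (BiGraded D.fil),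
    ∀ i, φ (MvPolynomial.X i) = Φ.ρ (D.centralizerBasis i) :=
  MvPolynomial.exists_algHom_of_commute _ fun _ _ => Φ.ρ_comm _ _

/-- The action of the polynomial functions on the slice, pulled back along the projection to the
slice, on `gr (U / U m_χ)`. -/
def sliceHom : D.SlicePoly →ₐ[K] Module.End K (BiGraded D.fil) := Φ.exists_sliceHom.choose

lemma sliceHom_X (i : Fin (finrank K (LinearMap.ker (ad K g D.e)))) :
    Φ.sliceHom (MvPolynomial.X i) = Φ.ρ (D.centralizerBasis i) := Φ.exists_sliceHom.choose_spec i

lemma sliceHom_mul_ρ (p : D.SlicePoly) (x : g) :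
    Φ.sliceHom p * Φ.ρ x = Φ.ρ x * Φ.sliceHom p := by
  induction p using MvPolynomial.induction_on with
  | C c =>
    rw [← MvPolynomial.algebraMap_eq, AlgHom.commutes, Algebra.commutes]
  | add a b ha hb => rw [map_add, add_mul, mul_add, ha, hb]
  | mul_X a i ha => rw [map_mul, sliceHom_X, mul_assoc, Φ.ρ_comm, ← mul_assoc, ha, mul_assoc]

omit [IsAlgClosed K] [FiniteDimensional K g] in
lemma χ_y (k : Fin Φ.r) : D.χ (Φ.y k) = 0 :=
  χ_eq_zero (s := (-2, 0) + Φ.s k) (fun h => by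
    have h1 := congrArg Prod.fst h
    have h2 := Φ.s_pos k
    simp at h1
    omega) (Φ.y_mem k)

/-- [f, g] lies in m plus the span of the y_k. The first part acts by χ; the second maps into the
images of the Y_k, and χ(y_k) = 0. -/
lemma ρ_sub_mem_sliceKer {x : g} (hx : x ∈ LinearMap.range (ad K g D.f)) (b : BiGraded D.fil) :
    Φ.ρ x b - D.χ x • b ∈ Φ.sliceKer := by
  obtain ⟨y, hy, z, hz, rfl⟩ := Submodule.mem_sup.1 (Φ.range_le hx)
  have h : Submodule.span K (Set.range Φ.y) ≤
      Φ.sliceKer.comap (Φ.ρ.flip b - D.χ.smulRight b) := by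
    rw [Submodule.span_le]
    rintro _ ⟨k, rfl⟩
    change Φ.ρ (Φ.y k) b - D.χ (Φ.y k) • b ∈ Φ.sliceKer
    rw [χ_y, zero_smul, sub_zero]
    exact Submodule.mem_iSup_of_mem k ⟨b, rfl⟩
  have h1 : Φ.ρ z b - D.χ z • b ∈ Φ.sliceKer := h hz
  rw [map_add, map_add, add_smul, Φ.ρ_of_mem_m hy, LinearMap.add_apply, LinearMap.smul_apply,
    Module.End.one_apply, add_sub_add_left_eq_sub]
  exact h1

lemma sliceHom_sliceLin_proj (x : LinearMap.ker (ad K g D.e)) :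
    Φ.sliceHom (D.sliceLin x) = Φ.ρ x := by
  have h : Φ.sliceHom.toLinearMap ∘ₗ D.centralizerBasis.constr K MvPolynomial.X =
      Φ.ρ ∘ₗ Submodule.subtype _ :=
    D.centralizerBasis.ext fun j => by simp [sliceHom_X]
  rw [sliceLin_apply, χ_eq_zero_of_lie_e x.2, map_zero, add_zero,
    show D.proj x = x from Subtype.ext (proj_of_mem x.2)]
  exact LinearMap.congr_fun h x

/-- For t in g, this splits t along z_g(e) ⊕ [f, g]; products follow because `sliceKer` is stable
under operators commuting with all ρ x. -/
lemma τ_sub_sliceHom_mem (t : TensorAlgebra K g) (b : BiGraded D.fil) :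
    Φ.τ t b - Φ.sliceHom (D.slice t) b ∈ Φ.sliceKer := by
  induction t using TensorAlgebra.induction generalizing b with
  | algebraMap c => simp
  | ι x =>
    rw [τ_ι, slice_ι, sliceLin_eq, map_add, AlgHom.commutes, sliceHom_sliceLin_proj,
      Algebra.algebraMap_eq_smul_one, LinearMap.add_apply, LinearMap.smul_apply,
      Module.End.one_apply]
    have h := Φ.ρ_sub_mem_sliceKer (sub_proj_mem x) b
    rwa [map_sub, map_sub, χ_proj, sub_zero, LinearMap.sub_apply, sub_sub] at h
  | mul t t' h h' =>
    rw [map_mul, map_mul, map_mul, Module.End.mul_apply, Module.End.mul_apply]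
    have h1 := Φ.sliceKer_le_comap (Φ.τ_mul_ρ t) (h' b)
    rw [Submodule.mem_comap, map_sub] at h1
    simpa using add_mem h1 (h (Φ.sliceHom (D.slice t') b))
  | add t t' h h' =>
    rw [map_add, map_add, map_add, LinearMap.add_apply, LinearMap.add_apply, add_sub_add_comm]
    exact add_mem (h b) (h' b)

end Frame

end WDatum

end


/-- The component of index `a` of a sum `A t + v` that is homogeneous of index `a`. -/
lemma iSupIndep.exists_add_mem {K V V' I : Type*} [Field K] [AddCommGroup V] [Module K V]
    [AddCommGroup V'] [Module K V'] {p : I → Submodule K V} {p' q : I → Submodule K V'}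
    (hq : iSupIndep q) (A : V →ₗ[K] V') (hA : ∀ i, ∀ x ∈ p i, A x ∈ q i) (hp' : ∀ i, p' i ≤ q i)
    {a : I} {t : V} {v : V'} (ht : t ∈ ⨆ i, p i) (hv : v ∈ ⨆ i, p' i) (h : A t + v ∈ q a) :
    ∃ t' ∈ p a, ∃ v' ∈ p' a, A t' + v' = A t + v ∧ t - t' ∈ ⨆ i, p i ⊓ (p' i).comap A := by
  classical
  obtain ⟨c, hc, hct⟩ := (Submodule.mem_iSup_iff_exists_finsupp _ _).1 ht
  obtain ⟨c', hc', hcv⟩ := (Submodule.mem_iSup_iff_exists_finsupp _ _).1 hv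
  set S := insert a (c.support ∪ c'.support) with hS
  have haS : a ∈ S := by simp [hS]
  have hcS : ∑ i ∈ S, c i = t := by
    rw [← hct]
    exact (Finset.sum_subset (fun i hi => by simp [hS, Finsupp.mem_support_iff.1 hi])
      fun i _ hi => Finsupp.notMem_support_iff.1 hi).symm
  have hcS' : ∑ i ∈ S, c' i = v := by
    rw [← hcv]
    exact (Finset.sum_subset (fun i hi => by simp [hS, Finsupp.mem_support_iff.1 hi])
      fun i _ hi => Finsupp.notMem_support_iff.1 hi).symm
  have key := (iSupIndep_iff_finsetSum_eq_imp_eq _).1 hq S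
    (fun i => A (c i) + c' i) (fun i => if i = a then A t + v else 0)
    (fun i _ => ⟨add_mem (hA i _ (hc i)) (hp' i (hc' i)), by
      split_ifs with hi
      · rwa [hi]
      · exact zero_mem _⟩) (by
      rw [Finset.sum_ite_eq' S a, if_pos haS, Finset.sum_add_distrib, hcS', ← hcS, map_sum])
  refine ⟨c a, hc a, c' a, hc' a, by simpa using key a haS, ?_⟩
  rw [← hcS, ← Finset.add_sum_erase S _ haS, add_sub_cancel_left]
  refine Submodule.sum_mem _ fun i hi => Submodule.mem_iSup_of_mem i ⟨hc i, ?_⟩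
  have hi' := key i (Finset.mem_of_mem_erase hi)
  simp only [if_neg (Finset.ne_of_mem_erase hi)] at hi'
  change A (c i) ∈ p' i
  rw [add_eq_zero_iff_eq_neg.1 hi']
  exact neg_mem (hc' i)

/-! ### Symbols of elements of W on the slice, and the spanning theorem. -/

noncomputable section

namespace WDatum

open Module LieAlgebra

variable {K : Type*} {g : Type*} [Field K] [LieRing g] [LieAlgebra K g] {D : WDatum K g}
  [CharZero K] [IsAlgClosed K] [FiniteDimensional K g]

namespace Frame

variable (Φ : D.Frame)

/-- `w` lies in `fil i` and its symbol restricts to the function `p` on the Slodowy slice. -/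
def HasSymbol (i : ℤ × ℤ) (w : D.W) (p : D.SlicePoly) : Prop :=
  D.toWhittaker w ∈ D.fil i ∧
    symbol D.fil i (D.toWhittaker w) - Φ.sliceHom p Φ.symbolVac ∈ Φ.sliceKer

variable {Φ}

lemma HasSymbol.add {i : ℤ × ℤ} {w w' : D.W} {p p' : D.SlicePoly} (h : Φ.HasSymbol i w p)
    (h' : Φ.HasSymbol i w' p') : Φ.HasSymbol i (w + w') (p + p') := by
  constructor
  · rw [map_add]; exact add_mem h.1 h'.1
  · rw [map_add, map_add, symbol_add h.1 h'.1, LinearMap.add_apply, add_sub_add_comm]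
    exact add_mem h.2 h'.2

lemma HasSymbol.smul {i : ℤ × ℤ} {w : D.W} {p : D.SlicePoly} (c : K) (h : Φ.HasSymbol i w p) :
    Φ.HasSymbol i (c • w) (c • p) := by
  constructor
  · rw [map_smul]; exact Submodule.smul_mem _ _ h.1
  · rw [map_smul, map_smul, symbol_smul h.1, LinearMap.smul_apply, ← smul_sub]
    exact Submodule.smul_mem _ _ h.2

lemma HasSymbol.sub {i : ℤ × ℤ} {w w' : D.W} {p p' : D.SlicePoly} (h : Φ.HasSymbol i w p)
    (h' : Φ.HasSymbol i w' p') : Φ.HasSymbol i (w - w') (p - p') := by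
  have := h.add (h'.smul (-1))
  rwa [neg_one_smul, neg_one_smul, ← sub_eq_add_neg, ← sub_eq_add_neg] at this

lemma hasSymbol_zero (i : ℤ × ℤ) : Φ.HasSymbol i 0 0 := by
  constructor
  · rw [map_zero]; exact zero_mem _
  · simp [symbol_zero]

lemma hasSymbol_one : Φ.HasSymbol 0 1 1 := by
  constructor
  · exact vac_mem_fil le_rfl rfl
  · rw [toWhittaker_one, map_one, Module.End.one_apply, symbolVac, sub_self]
    exact zero_mem _

omit [IsAlgClosed K] [FiniteDimensional K g] in
lemma symbol_toWhittaker_of_tens {i : ℤ × ℤ} {w : D.W} {t : TensorAlgebra K g} (ht : t ∈ D.tens i)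
    (hw : D.tact t D.vac - D.toWhittaker w ∈ D.fil (i - (1, 0))) :
    D.toWhittaker w ∈ D.fil i ∧ symbol D.fil i (D.toWhittaker w) = Φ.τ t Φ.symbolVac := by
  have h1 := tact_vac_mem_fil ht
  have h2 : D.toWhittaker w ∈ D.fil i := by
    have := sub_mem h1 (fil_sub_le i hw)
    rwa [sub_sub_cancel] at this
  refine ⟨h2, ?_⟩
  rw [Φ.τ_symbolVac ht, eq_comm, ← sub_eq_zero, ← symbol_sub h1 h2,
    symbol_eq_zero_iff (sub_mem h1 h2)]
  exact hw

/-- With w represented by a tensor t modulo lower degree, ww' is t applied to w' modulo lower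
degree, because right multiplication by w' commutes with the action of U. -/
lemma HasSymbol.mul {i j : ℤ × ℤ} {w w' : D.W} {p p' : D.SlicePoly} (h : Φ.HasSymbol i w p)
    (h' : Φ.HasSymbol j w' p') : Φ.HasSymbol (i + j) (w * w') (p * p') := by
  obtain ⟨t, ht, hw⟩ := exists_tens h.1
  have h1 := rmul_mem_fil (toWhittaker_mem w') h'.1 hw
  have h2 : rmul (toWhittaker_mem w') (D.tact t D.vac) = D.tact t (D.toWhittaker w') := by
    have := rmul_act (toWhittaker_mem w') (UniversalEnvelopingAlgebra.mkAlgHom K g t) D.vac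
    rwa [rmul_vac] at this
  rw [map_sub, h2, ← toWhittaker_mul, sub_add_eq_add_sub] at h1
  have h3 := tact_mem_fil ht h'.1
  have h4 : D.toWhittaker (w * w') ∈ D.fil (i + j) := by
    have := sub_mem h3 (fil_sub_le _ h1)
    rwa [sub_sub_cancel] at this
  refine ⟨h4, ?_⟩
  have h5 : symbol D.fil (i + j) (D.toWhittaker (w * w')) =
      Φ.τ t (symbol D.fil j (D.toWhittaker w')) := by
    rw [Φ.τ_symbol ht h'.1, eq_comm, ← sub_eq_zero, ← symbol_sub h3 h4,
      symbol_eq_zero_iff (sub_mem h3 h4)]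
    exact h1
  have h6 := Φ.sliceKer_le_comap (Φ.τ_mul_ρ t) h'.2
  have h7 := Φ.τ_sub_sliceHom_mem t (Φ.sliceHom p' Φ.symbolVac)
  -- The functions `slice t` and p are not known to be equal; their actions on the vacuum symbol
  -- agree modulo `sliceKer`, and this is propagated through p'.
  have h8 := Φ.sliceKer_le_comap (Φ.sliceHom_mul_ρ p')
    (sub_mem h.2 (Φ.τ_sub_sliceHom_mem t Φ.symbolVac))
  rw [(symbol_toWhittaker_of_tens ht hw).2] at h8
  simp only [Submodule.mem_comap, map_sub, ← Module.End.mul_apply, ← map_mul] at h6 h7 h8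
  rw [mul_comm p' p, mul_comm p'] at h8
  have h9 := add_mem (add_mem h6 h7) h8
  rw [h5]
  convert h9 using 1
  abel

lemma HasSymbol.pow {i : ℤ × ℤ} {w : D.W} {p : D.SlicePoly} (h : Φ.HasSymbol i w p) (n : ℕ) :
    Φ.HasSymbol (n • i) (w ^ n) (p ^ n) := by
  induction n with
  | zero => simpa using hasSymbol_one
  | succ n ih =>
    rw [succ_nsmul, pow_succ, pow_succ]
    exact ih.mul h

lemma hasSymbol_list_prod {ι : Type*} {d : ι → ℤ × ℤ} {f : ι → D.W} {p : ι → D.SlicePoly}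
    (h : ∀ l, Φ.HasSymbol (d l) (f l) (p l)) (L : List ι) :
    Φ.HasSymbol (L.map d).sum (L.map f).prod (L.map p).prod := by
  induction L with
  | nil => exact hasSymbol_one
  | cons l L ih =>
    simp only [List.map_cons, List.sum_cons, List.prod_cons]
    exact (h l).mul ih

lemma hasSymbol_slice {i : ℤ × ℤ} {w : D.W} {t : TensorAlgebra K g} (ht : t ∈ D.tens i)
    (hw : D.tact t D.vac - D.toWhittaker w ∈ D.fil (i - (1, 0))) :
    Φ.HasSymbol i w (D.slice t) := by
  obtain ⟨h1, h2⟩ := symbol_toWhittaker_of_tens (Φ := Φ) ht hw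
  refine ⟨h1, ?_⟩
  rw [h2]
  exact Φ.τ_sub_sliceHom_mem t _

/-- Surjectivity of gr W → K[S]: project the class of t to the common kernel of the X_k, which
changes it only by `sliceKer`, then lift to a true invariant. -/
lemma exists_hasSymbol {i : ℤ × ℤ} {t : TensorAlgebra K g} (ht : t ∈ D.tens i) :
    ∃ w, Φ.HasSymbol i w (D.slice t) := by
  obtain ⟨b, hb, hXb, hbt⟩ := Φ.triangular.exists_projection (i := i) (b := Φ.τ t Φ.symbolVac) (by
    rw [Φ.τ_symbolVac ht]
    exact mem_homPart.2 ⟨_, tact_vac_mem_fil ht, rfl⟩)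
  obtain ⟨q, hq, rfl⟩ := mem_homPart.1 hb
  obtain ⟨q', hq', hinv, hqq'⟩ := exists_lift_of_triangular (fun _ => fil_eq_bot) fil_sub_le _
    Φ.triangular (fun k q hq => Φ.adm_adm k hq) hq hXb
  obtain ⟨w, rfl⟩ := exists_toWhittaker_eq (D := D) (q := q') (by
    have h1 : D.m ≤ LinearMap.ker (D.adm.flip q') := by
      rw [← Φ.span_ξ, Submodule.span_le]
      rintro _ ⟨k, rfl⟩
      exact hinv k
    exact fun ξ hξ => h1 hξ)
  refine ⟨w, hq', ?_⟩
  rw [hqq']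
  have := add_mem hbt (Φ.τ_sub_sliceHom_mem t Φ.symbolVac)
  rwa [sub_add_sub_cancel] at this

/-- Injectivity of gr W → K[S]: the symbol of an invariant is killed by all X_k, and here it also
lies in the sum of the images of the Y_k. -/
lemma HasSymbol.mem_fil_of_zero {i : ℤ × ℤ} {w : D.W} (h : Φ.HasSymbol i w 0) :
    D.toWhittaker w ∈ D.fil (i - (1, 0)) := by
  rw [← symbol_eq_zero_iff h.1]
  have h1 := h.2
  rw [map_zero, LinearMap.zero_apply, sub_zero] at h1
  refine Φ.triangular.eq_zero_of_mem (fun k => ?_) h1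
  rw [Φ.X_symbol k h.1, toWhittaker_mem w _ (Φ.ξ_mem_m k), symbol_zero]

/-- The given tensor t need not be a θ-weight vector. Its component t' of weight a represents w, and
the other components fall into lower filtration, so t and t' act alike on the vacuum symbol. -/
lemma hasSymbol_of_hasSliceSymbol {k a : ℤ} {w : D.W} {x : g} (hw : w ∈ D.weightSpace a)
    (h : D.HasSliceSymbol k w x) : Φ.HasSymbol (k, a) w (D.sliceLin x) := by
  obtain ⟨t, ht, v, hv, hu, rfl, htx⟩ := h
  have hslice : D.slice t = D.sliceLin x := by
    rw [← slice_ι]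
    refine slice_eq_of_forall fun z hz => ?_
    rw [htx z hz, TensorAlgebra.lift_ι_apply]
  have hwt : D.toWhittaker (D.mkW _ hu) = D.tact.toLinearMap.flip D.vac t +
      Submodule.Quotient.mk v := by
    rw [LinearMap.flip_apply, AlgHom.toLinearMap_apply, tact_vac]; rfl
  have hind : iSupIndep fun c : ℤ => D.adθ.eigenspace (c : K) :=
    D.adθ.eigenspaces_iSupIndep.comp (Int.cast_injective (α := K))
  obtain ⟨t', ht', v', hv', htv, htt'⟩ := hind.exists_add_mem (D.tact.toLinearMap.flip D.vac)
    (p := fun c => D.tens (k, c)) (p' := fun c => D.fil (k - 1, c))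
    (fun c u hu => fil_le_eigenspace (k, c) (tact_vac_mem_fil hu))
    (fun c => fil_le_eigenspace (k - 1, c)) (kazhdanTensor_le k ht) (kazhdan_vac_mem hv)
    (hwt ▸ mem_weightSpace_iff.1 hw)
  rw [← hwt] at htv
  have h1 := symbol_toWhittaker_of_tens (Φ := Φ) ht' (w := D.mkW _ hu) (by
    rw [← htv, LinearMap.flip_apply, AlgHom.toLinearMap_apply, sub_add_cancel_left]
    simpa using neg_mem hv')
  have h2 : (⨆ c, D.tens (k, c) ⊓ (D.fil (k - 1, c)).comap (D.tact.toLinearMap.flip D.vac)) ≤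
      LinearMap.ker (Φ.τ.toLinearMap.flip Φ.symbolVac) := by
    refine iSup_le fun c u hu => ?_
    rw [LinearMap.mem_ker, LinearMap.flip_apply, AlgHom.toLinearMap_apply, Φ.τ_symbolVac hu.1,
      symbol_eq_zero_iff (tact_vac_mem_fil hu.1)]
    simpa using hu.2
  have h3 := h2 htt'
  rw [LinearMap.mem_ker, map_sub, sub_eq_zero] at h3
  refine ⟨h1.1, ?_⟩
  rw [h1.2, ← hslice, show Φ.τ t' Φ.symbolVac = Φ.τ t Φ.symbolVac from h3.symm]
  exact Φ.τ_sub_sliceHom_mem t _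

end Frame

/-! ### Spanning by ordered monomials -/

section Spanning

variable {ι : Type*} [Fintype ι] (x : ι → g) (s : ι → ℤ × ℤ) (f : ι → D.W)

/-- The span of the functions `p · ∏ x_l ^ b_l` of degree `i`, where `p` has weight `≤ 0`. -/
def sliceMonomialSpan (D : WDatum K g) (x : ι → g) (s : ι → ℤ × ℤ) (i : ℤ × ℤ) :
    Submodule K D.SlicePoly :=
  Submodule.span K {q | ∃ (j : ℤ × ℤ) (t : TensorAlgebra K g) (b : ι → ℕ), t ∈ D.tens j ∧
    j.2 ≤ 0 ∧ j + ∑ l, b l • kdeg (s l) = i ∧ q = D.slice t * ∏ l, D.sliceLin (x l) ^ b l}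

/-- The span of the products `w₀ · ∏ f_l ^ b_l` of weight `β`, where `w₀` has weight `≤ 0`. -/
def monomialSpan (f : ι → D.W) (a : ι → ℤ) (β : ℤ) : Submodule K D.W :=
  Submodule.span K {w | ∃ (α : ℤ) (w₀ : D.W) (b : ι → ℕ), w₀ ∈ D.weightSpace α ∧ α ≤ 0 ∧
    α + ∑ l, b l • a l = β ∧ w = w₀ * (Finset.univ.toList.map fun l => f l ^ b l).prod}

variable {x s f}

/-- A factor y of weight at most 0 is absorbed into the tensor. One of positive weight has χ(y) = 0
and restricts to the slice as its projection to z_g(e)_{>0}, a combination of the x_l of the same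
bidegree, so it raises one exponent. -/
lemma sliceLin_mul_mem_sliceMonomialSpan (hx : ∀ l, x l ∈ D.bigr (s l))
    (hspan : D.centralizerPos ≤ Submodule.span K (Set.range x)) {u i : ℤ × ℤ} {y : g}
    (hy : y ∈ D.bigr u) {q : D.SlicePoly} (hq : q ∈ sliceMonomialSpan D x s i) :
    D.sliceLin y * q ∈ sliceMonomialSpan D x s (kdeg u + i) := by
  classical
  unfold sliceMonomialSpan at hq
  induction hq using Submodule.span_induction with
  | zero => rw [mul_zero]; exact zero_mem _
  | add a b _ _ ha hb => rw [mul_add]; exact add_mem ha hb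
  | smul c a _ ha => rw [mul_smul_comm]; exact Submodule.smul_mem _ _ ha
  | mem q hq =>
    obtain ⟨j, t, b, ht, hj, rfl, rfl⟩ := hq
    rcases le_or_gt u.2 0 with hu | hu
    · refine Submodule.subset_span ⟨kdeg u + j, TensorAlgebra.ι K y * t, b, ι_mul_mem_tens hy ht,
        ?_, add_assoc _ _ _, ?_⟩
      · simp [kdeg]; omega
      · rw [map_mul, slice_ι, mul_assoc]
    · have h1 : D.sliceLin y = D.sliceLin (D.proj y) := by
        rw [sliceLin_eq, χ_eq_zero (fun h => by simp [h] at hu) hy, map_zero, add_zero]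
      have h2 : (D.proj y : g) ∈ Submodule.span K (x '' {l | s l = u}) := by
        refine mem_span_of_mem_bigr hx (hspan ?_) (proj_mem_bigr hy)
        exact Submodule.mem_iSup_of_mem (p := fun α : {α : ℤ // 0 < α} =>
          LinearMap.ker (ad K g D.e) ⊓ D.θEigenspace α) ⟨u.2, hu⟩
          ⟨(D.proj y).2, (proj_mem_bigr hy).2⟩
      have h3 : Submodule.span K (x '' {l | s l = u}) ≤
          (sliceMonomialSpan D x s (kdeg u + (j + ∑ l, b l • kdeg (s l)))).comap
            (LinearMap.mulRight K (D.slice t * ∏ l, D.sliceLin (x l) ^ b l) ∘ₗ D.sliceLin) := by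
        rw [Submodule.span_le]
        rintro _ ⟨l, rfl, rfl⟩
        refine Submodule.subset_span ⟨j, t, b + Pi.single l 1, ht, hj, ?_, ?_⟩
        · simp only [Pi.add_apply, add_smul, Finset.sum_add_distrib, Pi.single_apply, ite_smul,
            one_smul, zero_smul, Finset.sum_ite_eq', Finset.mem_univ, if_true]
          abel
        · simp only [Pi.add_apply, pow_add, Finset.prod_mul_distrib, Pi.single_apply, pow_ite,
            pow_one, pow_zero, Finset.prod_ite_eq', Finset.mem_univ, if_true,
            LinearMap.comp_apply, LinearMap.mulRight_apply]
          ring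
      rw [h1]
      exact h3 h2

lemma slice_mem_sliceMonomialSpan (hx : ∀ l, x l ∈ D.bigr (s l))
    (hspan : D.centralizerPos ≤ Submodule.span K (Set.range x)) {i : ℤ × ℤ}
    {t : TensorAlgebra K g} (ht : t ∈ D.tens i) : D.slice t ∈ sliceMonomialSpan D x s i := by
  refine tens_le (G := fun i => (sliceMonomialSpan D x s i).comap D.slice.toLinearMap) ?_ ?_ i ht
  · exact Submodule.subset_span ⟨0, 1, 0, one_mem_tens, le_rfl, by simp, by simp⟩
  · intro u y hy i t _ h
    simp only [Submodule.mem_comap, AlgHom.toLinearMap_apply, map_mul, slice_ι] at h ⊢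
    exact sliceLin_mul_mem_sliceMonomialSpan hx hspan hy h

lemma exists_mem_monomialSpan {Φ : D.Frame}
    (hf : ∀ l, Φ.HasSymbol (kdeg (s l)) (f l) (D.sliceLin (x l))) {i : ℤ × ℤ} {q : D.SlicePoly}
    (hq : q ∈ sliceMonomialSpan D x s i) :
    ∃ w ∈ monomialSpan f (fun l => (s l).2) i.2, Φ.HasSymbol i w q := by
  unfold sliceMonomialSpan at hq
  induction hq using Submodule.span_induction with
  | zero => exact ⟨0, zero_mem _, Frame.hasSymbol_zero i⟩
  | add a b _ _ ha hb =>
    obtain ⟨w, hw, hwa⟩ := ha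
    obtain ⟨w', hw', hwb⟩ := hb
    exact ⟨w + w', add_mem hw hw', hwa.add hwb⟩
  | smul c a _ ha =>
    obtain ⟨w, hw, hwa⟩ := ha
    exact ⟨c • w, Submodule.smul_mem _ _ hw, hwa.smul c⟩
  | mem q hq =>
    obtain ⟨j, t, b, ht, hj, rfl, rfl⟩ := hq
    obtain ⟨w₀, hw₀⟩ := Frame.exists_hasSymbol (Φ := Φ) ht
    refine ⟨_, Submodule.subset_span ⟨j.2, w₀, b, mem_weightSpace_of_mem_fil hw₀.1, hj, ?_, rfl⟩, ?_⟩
    · simp [Prod.snd_sum, kdeg]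
    · have := hw₀.mul (Frame.hasSymbol_list_prod (fun l => (hf l).pow (b l)) Finset.univ.toList)
      rwa [Finset.sum_map_toList, Finset.prod_map_toList] at this

/-- Induction on the Kazhdan degree: a combination of ordered monomials with the same symbol as w is
subtracted, and the difference has smaller degree. -/
lemma weightSpace_le_monomialSpan {Φ : D.Frame} (hx : ∀ l, x l ∈ D.bigr (s l))
    (hspan : D.centralizerPos ≤ Submodule.span K (Set.range x))
    (hf : ∀ l, Φ.HasSymbol (kdeg (s l)) (f l) (D.sliceLin (x l))) (β : ℤ) :
    D.weightSpace β ≤ monomialSpan f (fun l => (s l).2) β := by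
  have key : ∀ N : ℕ, ∀ n : ℤ, n < N → ∀ w, D.toWhittaker w ∈ D.fil (n, β) →
      w ∈ monomialSpan f (fun l => (s l).2) β := by
    intro N
    induction N with
    | zero =>
      intro n hn w hw
      rw [fil_eq_bot (by simpa using hn), Submodule.mem_bot] at hw
      rw [toWhittaker_injective (hw.trans (map_zero _).symm)]
      exact zero_mem _
    | succ N ih =>
      intro n hn w hw
      obtain ⟨t, ht, htw⟩ := exists_tens hw
      obtain ⟨w', hw', hsym⟩ := exists_mem_monomialSpan hf
        (slice_mem_sliceMonomialSpan hx hspan ht)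
      have h1 := (Frame.hasSymbol_slice (Φ := Φ) ht htw).sub hsym
      rw [sub_self] at h1
      have h2 := ih (n - 1) (by push_cast at hn; omega) (w - w')
        (by simpa using h1.mem_fil_of_zero)
      simpa using add_mem h2 hw'
  intro w hw
  obtain ⟨n, hn⟩ := exists_mem_fil_of_mem_weightSpace hw
  exact key (n.toNat + 1) n (by push_cast; have := Int.self_le_toNat n; omega) w hn

end Spanning

end WDatum

end


/-! ### Modules: local nilpotency against large weights. -/

/-- If each `f l` acts locally nilpotently, then only finitely many ordered monomials act nontrivially
on a given vector. -/
lemma exists_list_prod_pow_smul_eq_zero {A M ι : Type*} [Ring A] [AddCommGroup M] [Module A M]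
    {f : ι → A} (hf : ∀ l, ∀ m : M, ∃ N : ℕ, f l ^ N • m = 0) (m : M) (L : List ι) :
    (Set.range fun b : ι → ℕ => (L.map fun l => f l ^ b l).prod • m).Finite ∧
      ∃ N : ℕ, ∀ b : ι → ℕ, ∀ l ∈ L, N ≤ b l → (L.map fun l => f l ^ b l).prod • m = 0 := by
  induction L with
  | nil => exact ⟨(Set.finite_singleton m).subset (by rintro _ ⟨b, rfl⟩; simp), 0, by simp⟩
  | cons l L ih =>
    obtain ⟨hfin, N, hN⟩ := ih
    choose k hk using hf l
    -- The factors to the right produce only finitely many vectors from m, so one exponent of f l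
    -- kills them all. This is why finiteness is carried through the induction; the f l need not
    -- commute.
    obtain ⟨N₀, hN₀⟩ := (hfin.image k).bddAbove
    have hzero : ∀ b : ι → ℕ, ∀ n, N₀ ≤ n →
        f l ^ n • (L.map fun l => f l ^ b l).prod • m = 0 := by
      intro b n hn
      have h1 := hN₀ ⟨_, ⟨b, rfl⟩, rfl⟩
      rw [← Nat.sub_add_cancel (h1.trans hn), pow_add, mul_smul, hk, smul_zero]
    refine ⟨?_, max N N₀, fun b j hj hbj => ?_⟩
    · refine ((hfin.prod (Set.finite_Iic N₀)).image fun p => f l ^ p.2 • p.1).subset ?_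
      rintro _ ⟨b, rfl⟩
      refine ⟨(_, min (b l) N₀), ⟨⟨b, rfl⟩, Set.mem_Iic.2 (min_le_right _ _)⟩, ?_⟩
      simp only [List.map_cons, List.prod_cons, mul_smul]
      rcases le_total (b l) N₀ with h | h
      · rw [min_eq_left h]
      · rw [min_eq_right h, hzero b _ le_rfl, hzero b _ h]
    · simp only [List.map_cons, List.prod_cons, mul_smul]
      rcases List.mem_cons.1 hj with rfl | hj
      · exact hzero b _ ((le_max_right _ _).trans hbj)
      · rw [hN b j hj ((le_max_left _ _).trans hbj), smul_zero]

namespace WDatum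

variable {K : Type*} {g : Type*} [Field K] [LieRing g] [LieAlgebra K g] {D : WDatum K g}

lemma mul_mem_iSup_weightSpace {n n' : ℤ} (hn : n' ≤ n + 1) {w v : D.W}
    (hw : w ∈ ⨆ α : {α : ℤ // 0 < α}, D.weightSpace α)
    (hv : v ∈ ⨆ β : {β : ℤ // n ≤ β}, D.weightSpace β) :
    w * v ∈ ⨆ β : {β : ℤ // n' ≤ β}, D.weightSpace β := by
  set P : Submodule K D.W := ⨆ β : {β : ℤ // n' ≤ β}, D.weightSpace β with hP
  have hmul : ∀ α : {α : ℤ // 0 < α}, ∀ u ∈ D.weightSpace α, ∀ β : {β : ℤ // n ≤ β},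
      ∀ u' ∈ D.weightSpace β, u * u' ∈ P := by
    intro α u hu β u' hu'
    exact Submodule.mem_iSup_of_mem (p := fun β : {β : ℤ // n' ≤ β} => D.weightSpace β)
      ⟨α + β, by have := α.2; have := β.2; omega⟩ (mul_mem_weightSpace hu hu')
  induction hw using Submodule.iSup_induction' with
  | zero => rw [zero_mul]; exact zero_mem _
  | add a b _ _ ha hb => rw [add_mul]; exact add_mem ha hb
  | mem α u hu =>
    induction hv using Submodule.iSup_induction' with
    | zero => rw [mul_zero]; exact zero_mem _
    | add a b _ _ ha hb => rw [mul_add]; exact add_mem ha hb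
    | mem β u' hu' => exact hmul α u hu β u' hu'

lemma pow_mem_iSup_weightSpace {w : D.W} (hw : w ∈ D.posPart) (N : ℕ) :
    w ^ N ∈ ⨆ β : {β : ℤ // (N : ℤ) ≤ β}, D.weightSpace β := by
  induction N with
  | zero =>
    rw [pow_zero]
    exact Submodule.mem_iSup_of_mem (p := fun β : {β : ℤ // ((0 : ℕ) : ℤ) ≤ β} => D.weightSpace β)
      ⟨0, le_rfl⟩ one_mem_weightSpace
  | succ N ih =>
    rw [pow_succ']
    exact mul_mem_iSup_weightSpace (by push_cast; rfl) hw ih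

/-- The annihilator of a vector. -/
def vectorAnnihilator (D : WDatum K g) {M : Type*} [AddCommGroup M] [Module D.W M] (m : M) :
    Submodule K D.W :=
  (LinearMap.ker (LinearMap.toSpanSingleton D.W M m)).restrictScalars K

lemma mem_vectorAnnihilator {M : Type*} [AddCommGroup M] [Module D.W M] {m : M} {w : D.W} :
    w ∈ D.vectorAnnihilator m ↔ w • m = 0 := Iff.rfl

lemma KilledByLargeWeights.actsLocallyNilpotently {M : Type*} [AddCommGroup M] [Module D.W M]
    (h : D.KilledByLargeWeights M) {w : D.W} (hw : w ∈ D.posPart) :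
    D.ActsLocallyNilpotently w M := by
  intro m
  obtain ⟨α, hα⟩ := h m
  refine ⟨α.toNat, ?_⟩
  have h1 : (⨆ β : {β : ℤ // (α.toNat : ℤ) ≤ β}, D.weightSpace β) ≤ D.vectorAnnihilator m :=
    iSup_le fun β v hv => hα β ((Int.self_le_toNat α).trans β.2) v hv
  exact h1 (pow_mem_iSup_weightSpace hw _)

lemma killedByLargeWeights_of_le_monomialSpan {ι : Type*} [Fintype ι] {f : ι → D.W} {a : ι → ℤ}
    (ha : ∀ l, 0 ≤ a l) (hle : ∀ β, D.weightSpace β ≤ monomialSpan f a β)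
    {M : Type*} [AddCommGroup M] [Module D.W M] (h : ∀ l, D.ActsLocallyNilpotently (f l) M) :
    D.KilledByLargeWeights M := by
  intro m
  obtain ⟨-, N, hN⟩ := exists_list_prod_pow_smul_eq_zero h m Finset.univ.toList
  -- If all exponents were below N, the weight would be at most N ∑ a_l, since w₀ contributes at
  -- most 0.
  refine ⟨N * ∑ l, a l + 1, fun β hβ w hw => ?_⟩
  rw [← mem_vectorAnnihilator]
  refine Submodule.span_le.2 ?_ (hle β hw)
  rintro _ ⟨α, w₀, b, -, hα, hb, rfl⟩
  have hex : ∃ l, N ≤ b l := by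
    by_contra! hlt
    have : ∑ l, b l • a l ≤ N * ∑ l, a l := by
      rw [Finset.mul_sum]
      refine Finset.sum_le_sum fun l _ => ?_
      rw [nsmul_eq_mul]
      exact mul_le_mul_of_nonneg_right (by exact_mod_cast (hlt l).le) (ha l)
    omega
  obtain ⟨l, hl⟩ := hex
  change (w₀ * _) • m = 0
  rw [mul_smul, hN b l (by simp) hl, smul_zero]

/-- `IsGeneratorSystem` does not postulate that the weights a i are positive; this supplies it. -/
lemma pos_of_mem_centralizerPos [CharZero K] {x : g} (hx : x ∈ D.centralizerPos) (hx0 : x ≠ 0)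
    {a : ℤ} (ha : x ∈ D.θEigenspace a) : 0 < a := by
  by_contra h
  obtain ⟨w, hw, hwx⟩ := Submodule.exists_mem_of_map_mem (iSupIndep_θEigenspace (D := D))
    LinearMap.id (p := fun c => ⨆ _ : 0 < c, D.θEigenspace c) (i := a) (v := x)
    (fun c y hy => (iSup_le fun _ => le_rfl : (⨆ _ : 0 < c, D.θEigenspace c) ≤ _) hy)
    ((iSup_le fun α => le_iSup₂_of_le α.1 α.2 inf_le_right :
      D.centralizerPos ≤ ⨆ c : ℤ, ⨆ _ : 0 < c, D.θEigenspace c) hx) ha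
  rw [iSup_neg h, Submodule.mem_bot] at hw
  exact hx0 (by simpa [hw] using hwx.symm)

end WDatum

theorem mainTheorem6 {K : Type*} {g : Type*} [Field K] [IsAlgClosed K] [CharZero K]
    [LieRing g] [LieAlgebra K g] [FiniteDimensional K g] [LieAlgebra.HasCentralRadical K g]
    (D : WDatum K g)
    {ι : Type*} (f : ι → D.W) (hf : D.IsGeneratorSystem f)
    (M : Type*) [AddCommGroup M] [Module D.W M] [Module.Finite D.W M] :
    (D.KilledByLargeWeights M ↔ ∀ w ∈ D.posPart, D.ActsLocallyNilpotently w M) ∧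
    (D.KilledByLargeWeights M ↔ ∀ i, D.ActsLocallyNilpotently (f i) M) := by
  obtain ⟨x, a, n, h⟩ := hf
  obtain ⟨Φ⟩ := WDatum.nonempty_frame (D := D)
  have : Finite ι := Module.Finite.finite_basis x
  have : Fintype ι := Fintype.ofFinite ι
  have ha : ∀ l, 0 < a l := fun l => WDatum.pos_of_mem_centralizerPos (x l).2
    (fun h0 => x.ne_zero l (Subtype.ext h0)) (h l).1
  have hspan : D.centralizerPos ≤ Submodule.span K (Set.range fun l => (x l : g)) := by
    have h1 : Set.range (fun l => (x l : g)) = D.centralizerPos.subtype '' Set.range x := by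
      rw [← Set.range_comp]; rfl
    rw [h1, Submodule.span_image, x.span_eq, Submodule.map_top, Submodule.range_subtype]
  have hle : ∀ β, D.weightSpace β ≤ WDatum.monomialSpan f a β :=
    WDatum.weightSpace_le_monomialSpan (Φ := Φ) (x := fun l => (x l : g))
      (s := fun l => (n l, a l)) (fun l => ⟨(h l).2.1, (h l).1⟩) hspan fun l => by
        have h1 := WDatum.Frame.hasSymbol_of_hasSliceSymbol (Φ := Φ) (h l).2.2.1 (h l).2.2.2
        simpa [WDatum.kdeg] using h1
  have hpos : ∀ l, f l ∈ D.posPart := fun l =>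
    Submodule.mem_iSup_of_mem (p := fun α : {α : ℤ // 0 < α} => D.weightSpace α)
      ⟨a l, ha l⟩ (h l).2.2.1
  have key : (∀ l, D.ActsLocallyNilpotently (f l) M) → D.KilledByLargeWeights M :=
    WDatum.killedByLargeWeights_of_le_monomialSpan (fun l => (ha l).le) hle
  exact ⟨⟨fun hM w hw => hM.actsLocallyNilpotently hw, fun hM => key fun l => hM _ (hpos l)⟩,
    ⟨fun hM l => hM.actsLocallyNilpotently (hpos l), key⟩⟩
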